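/- Let $d\ge 2$, $T>0$, and let $p(\rho)=\rho^\gamma$ with $\gamma>1$. Consider the isentropic compressible Euler equations $$\partial_t m+\operatorname{div}_x\Big(\frac{m\otimes m}{\rho}\Big)+\nabla_x p(\rho)=0,\qquad \partial_t\rho+\operatorname{div}_x m=0 \tag{E}$$ and the relaxed linear system $$\partial_t m+\operatorname{div}_x M+\nabla_x Q=0,\qquad \partial_t\rho+\operatorname{div}_x m=0 \tag{R}$$ for $(\rho,m,M,Q)$ with values in $\mathbb R\times\mathbb R^d\times S^d_0\times\mathbb R$, where $S^d_0$ is the space of symmetric trace-free $d\times d$ matrices; both are understood in the sense of distributions on $(0,T)\times\mathbb R^d$. For $\rho>0$ put $m\circ m=m\otimes m-\frac1d|m|^2I_d$ and $e_{\rm kin}(\rho,m,M)=\frac d2\lambda_{\max}\big(\frac{m\otimes m}{\rho}-M\big)$, where $\lambda_{\max}$ is the largest eigenvalue, and let $$K=\Big\{(\rho,m,M,Q):\ \rho>0,\ M=\frac{m\circ m}{\rho},\ Q=p(\rho)+\frac{|m|^2}{d\rho}\Big\}.$$ Let $\Omega\subset\mathbb R^d$ be open. Let $(\rho_0,m_0,M_0,Q)$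 be a continuous solution of (R) on $[0,T]\times\mathbb R^d$ with $M_0\in S^d_0$ and $\rho_0>0$ on $(0,T)\times\mathbb R^d$, such that $Q\in C((0,T)\times\overline\Omega)\cap C([0,T];L^1\cap L^2(\Omega))$, $(\rho_0,m_0,M_0,Q)\in K$ for $x\notin\Omega$, and $$Q>p(\rho_0)+\tfrac2d e_{\rm kin}(\rho_0,m_0,M_0)\quad\text{in }(0,T)\times\Omega .$$ Let $m_*$ be one of the two fields $m_*=m_0$ or $m_*=0$. Let $X_0$ be the set of all $(\rho,m)\in C([0,T];L^\gamma_w(\mathbb R^d))\times C([0,T];L^2_w(\mathbb R^d))$ (continuity in time with respect to the weak topologies) such that * for every $t\in[0,T]$ the support of $m(t,\cdot)-m_*(t,\cdot)$ is a compact subset of $\Omega$; * $(\rho,m)(t,\cdot)=(\rho_0,m_0)(t,\cdot)$ a.e. in $\mathbb R^d$ for $t=0$ and $t=T$; * there is a field $M$ with values in $S^d_0$, $M\in L^1((0,T)\times\Omega)$, such that $\rho>0$, $(\rho,m,M,Q)$ solves (R), agrees with $(\rho_0,m_0,M_0,Q)$ a.e. outside $\Omega$, is continuous on $[0,T]\times\Omega$,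 and satisfies $$Q>p(\rho)+\tfrac2d e_{\rm kin}(\rho,m,M)>p(\rho)+\frac{|m|^2}{d\rho}\quad\text{on }(0,T)\times\Omega .$$ Let $X$ be the closure of $X_0$ in $C([0,T];L^\gamma_w(\mathbb R^d))\times C([0,T];L^2_w(\mathbb R^d))$ (uniform convergence in time with respect to the weak topologies), with the induced topology. Then the set of those $(\rho,m)\in X$ that are weak solutions of (E) on $(0,T)\times\mathbb R^d$ with $\rho>0$ a.e., that agree with $(\rho_0,m_0)$ on $\mathbb R^d\times\{0,T\}$ and on $(\mathbb R^d\setminus\Omega)\times(0,T)$, and that satisfy $$Q=p(\rho)+\frac{|m|^2}{d\rho}\quad\text{a.e. in }[0,T]\times\Omega,$$ is residual in $X$ in the sense of Baire. The same is true when $\mathbb R^d$ is replaced by the flat torus $\mathbb T^d=\mathbb R^d/\mathbb Z^d$. -/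

import Mathlib

open Set MeasureTheory Filter Topology
open scoped ContDiff ENNReal

noncomputable section

namespace IsentropicEuler

/-! ### States -/

/-- Momentum vectors: Euclidean space of dimension `d`. -/
abbrev Vec (d : ℕ) := EuclideanSpace ℝ (Fin d)

/-- Real `d × d` matrices. -/
abbrev Mat (d : ℕ) := Matrix (Fin d) (Fin d) ℝ

/-- The set of symmetric trace-free matrices. -/
def symTraceFree (d : ℕ) : Set (Mat d) := {A | A.IsSymm ∧ A.trace = 0}

/-- The pressure law `p(ρ) = ρ ^ γ`. -/
def pressure (γ r : ℝ) : ℝ := r ^ γ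

/-- The tensor product `m ⊗ m`. -/
def tensorSq {d : ℕ} (m : Vec d) : Mat d := Matrix.of fun i j => m i * m j

/-- The trace-free tensor product `m ⊗ m - (|m|² / d) I`. -/
def tracelessSq {d : ℕ} (m : Vec d) : Mat d := tensorSq m - (‖m‖ ^ 2 / d) • (1 : Mat d)

/-- The largest (real) eigenvalue of a matrix; it is used for symmetric matrices only. -/
def lambdaMax {d : ℕ} (A : Mat d) : ℝ :=
  sSup {a : ℝ | Module.End.HasEigenvalue (Matrix.toLin' A) a}

/-- The generalised kinetic energy density `(d / 2) λ_max ((m ⊗ m) / ρ - M)`. -/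
def eKin {d : ℕ} (r : ℝ) (m : Vec d) (M : Mat d) : ℝ :=
  (d : ℝ) / 2 * lambdaMax (r⁻¹ • tensorSq m - M)

/-- The constitutive set `K` of all states `(ρ, m, M, Q)` with `ρ > 0`, `M = (m ∘ m) / ρ` and
`Q = p(ρ) + |m|² / (d ρ)`. -/
def constitutiveSet (d : ℕ) (γ : ℝ) : Set (ℝ × Vec d × Mat d × ℝ) :=
  {z | 0 < z.1 ∧ z.2.2.1 = z.1⁻¹ • tracelessSq z.2.1 ∧
    z.2.2.2 = pressure γ z.1 + ‖z.2.1‖ ^ 2 / (d * z.1)}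

/-! ### The space domain

The space domain is a group `G` with a homomorphism `π` from Euclidean space to `G`: either
`G` is Euclidean space and `π` is the identity, or `G` is the flat torus and `π` is the quotient
map. Functions on `G` are differentiated along the translations `s ↦ x + π (s e_j)`. -/

/-- The quotient map from Euclidean space to the flat torus `(ℝ / ℤ)ᵈ`. -/
def torusMap (d : ℕ) : Vec d →+ UnitAddTorus (Fin d) where
  toFun y := fun i => ((y i : ℝ) : UnitAddCircle)
  map_zero' := by ext i; simp
  map_add' x y := by ext i; simp

/-- A quadruple `(ρ, m, M, Q)` of functions of time `t : ℝ` and space `x : G`. -/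
structure Fields (d : ℕ) (G : Type) where
  ρ : ℝ → G → ℝ
  m : ℝ → G → Vec d
  M : ℝ → G → Mat d
  Q : ℝ → G → ℝ

section Equations

variable {d : ℕ} {G : Type} [AddCommGroup G] [TopologicalSpace G] [MeasureSpace G]

/-- The open space-time slab `(0, T) × G`. -/
def slab (T : ℝ) (G : Type) : Set (ℝ × G) := Ioo 0 T ×ˢ univ

/-- The time derivative. -/
def dt (φ : ℝ → G → ℝ) (t : ℝ) (x : G) : ℝ := deriv (fun s => φ s x) t

/-- The partial derivative in the `j`-th space direction. -/
def dx (π : Vec d →+ G) (φ : ℝ → G → ℝ) (j : Fin d) (t : ℝ) (x : G) : ℝ :=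
  deriv (fun s : ℝ => φ t (x + π (s • EuclideanSpace.single j 1))) 0

/-- Test functions: smooth functions with compact support in `(0, T) × G`. -/
structure IsTestFunction (π : Vec d →+ G) (T : ℝ) (φ : ℝ → G → ℝ) : Prop where
  smooth : ContDiff ℝ ∞ (fun q : ℝ × Vec d => φ q.1 (π q.2))
  compact : HasCompactSupport (fun q : ℝ × G => φ q.1 q.2)
  supp : tsupport (fun q : ℝ × G => φ q.1 q.2) ⊆ slab T G

/-- `∂_t ρ + div m = 0` on `(0, T) × G` in the sense of distributions. -/
def MassEquation (π : Vec d →+ G) (T : ℝ) (ρ : ℝ → G → ℝ) (m : ℝ → G → Vec d) : Prop :=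
  ∀ φ : ℝ → G → ℝ, IsTestFunction π T φ →
    ∫ q in slab T G,
      (ρ q.1 q.2 * dt φ q.1 q.2 + ∑ j, m q.1 q.2 j * dx π φ j q.1 q.2) = 0

/-- `∂_t m + div M + ∇ Q = 0` on `(0, T) × G` in the sense of distributions. -/
def MomentumEquation (π : Vec d →+ G) (T : ℝ) (m : ℝ → G → Vec d) (M : ℝ → G → Mat d)
    (Q : ℝ → G → ℝ) : Prop :=
  ∀ (i : Fin d) (φ : ℝ → G → ℝ), IsTestFunction π T φ →
    ∫ q in slab T G,
      (m q.1 q.2 i * dt φ q.1 q.2 + ∑ j, M q.1 q.2 i j * dx π φ j q.1 q.2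
        + Q q.1 q.2 * dx π φ i q.1 q.2) = 0

/-- The relaxed linear system for `(ρ, m, M, Q)`, in the sense of distributions. -/
def RelaxedSystem (π : Vec d →+ G) (T : ℝ) (z : Fields d G) : Prop :=
  MomentumEquation π T z.m z.M z.Q ∧ MassEquation π T z.ρ z.m

/-- Weak (distributional) solutions `(ρ, m)` of the isentropic compressible Euler equations
`∂_t m + div ((m ⊗ m) / ρ) + ∇ p(ρ) = 0`, `∂_t ρ + div m = 0` on `(0, T) × G`, with positive
density. -/
structure IsWeakEulerSolution (π : Vec d →+ G) (γ T : ℝ) (ρ : ℝ → G → ℝ) (m : ℝ → G → Vec d) :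
    Prop where
  density_pos : ∀ᵐ q ∂(volume.restrict (slab T G)), 0 < ρ q.1 q.2
  density_locInt : LocallyIntegrableOn (fun q : ℝ × G => ρ q.1 q.2) (slab T G)
  momentum_locInt : LocallyIntegrableOn (fun q : ℝ × G => m q.1 q.2) (slab T G)
  flux_locInt : ∀ i j : Fin d,
    LocallyIntegrableOn (fun q : ℝ × G => m q.1 q.2 i * m q.1 q.2 j / ρ q.1 q.2) (slab T G)
  pressure_locInt : LocallyIntegrableOn (fun q : ℝ × G => pressure γ (ρ q.1 q.2)) (slab T G)
  momentum : MomentumEquation π T m (fun t x => (ρ t x)⁻¹ • tensorSq (m t x))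
    (fun t x => pressure γ (ρ t x))
  mass : MassEquation π T ρ m

/-! ### Subsolutions -/

/-- The class of generalized pressures:
`Q ∈ C((0, T) × closure Ω) ∩ C([0, T]; L¹ ∩ L² (Ω))`. -/
structure IsGeneralizedPressure (T : ℝ) (Ω : Set G) (Q : ℝ → G → ℝ) : Prop where
  cont : ContinuousOn (fun q : ℝ × G => Q q.1 q.2) (Ioo 0 T ×ˢ closure Ω)
  memLp_one : ∀ t ∈ Icc 0 T, MemLp (Q t) 1 (volume.restrict Ω)
  memLp_two : ∀ t ∈ Icc 0 T, MemLp (Q t) 2 (volume.restrict Ω)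
  cont_one : ∀ t ∈ Icc 0 T, Tendsto (fun s => eLpNorm (fun x => Q s x - Q t x) 1
    (volume.restrict Ω)) (𝓝[Icc 0 T] t) (𝓝 0)
  cont_two : ∀ t ∈ Icc 0 T, Tendsto (fun s => eLpNorm (fun x => Q s x - Q t x) 2
    (volume.restrict Ω)) (𝓝[Icc 0 T] t) (𝓝 0)

/-- The initial datum of the construction: a continuous solution of the relaxed linear system on
`[0, T] × G` that takes values in `K` outside `Ω` and is a strict subsolution in `Ω`. -/
structure IsStrictSubsolution (π : Vec d →+ G) (γ T : ℝ) (Ω : Set G) (z₀ : Fields d G) :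
    Prop where
  cont_ρ : ContinuousOn (fun q : ℝ × G => z₀.ρ q.1 q.2) (Icc 0 T ×ˢ univ)
  cont_m : ContinuousOn (fun q : ℝ × G => z₀.m q.1 q.2) (Icc 0 T ×ˢ univ)
  cont_M : ContinuousOn (fun q : ℝ × G => z₀.M q.1 q.2) (Icc 0 T ×ˢ univ)
  cont_Q : ContinuousOn (fun q : ℝ × G => z₀.Q q.1 q.2) (Icc 0 T ×ˢ univ)
  density_pos : ∀ t ∈ Ioo 0 T, ∀ x, 0 < z₀.ρ t x
  symm : ∀ t ∈ Ioo 0 T, ∀ x, z₀.M t x ∈ symTraceFree d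
  linear : RelaxedSystem π T z₀
  outside : ∀ t ∈ Ioo 0 T, ∀ x ∉ Ω,
    (z₀.ρ t x, z₀.m t x, z₀.M t x, z₀.Q t x) ∈ constitutiveSet d γ
  strict : ∀ t ∈ Ioo 0 T, ∀ x ∈ Ω,
    z₀.Q t x > pressure γ (z₀.ρ t x) + 2 / (d : ℝ) * eKin (z₀.ρ t x) (z₀.m t x) (z₀.M t x)

end Equations

/-! ### Function spaces -/

instance one_le_ofReal {γ : ℝ} [h : Fact (1 < γ)] : Fact ((1 : ℝ≥0∞) ≤ ENNReal.ofReal γ) :=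
  ⟨by simpa using ENNReal.ofReal_le_ofReal h.out.le⟩

/-- The space `C([0, T]; L^γ_w(G)) × C([0, T]; L²_w(G; ℝᵈ))` of weakly continuous paths, with
the topology of uniform convergence in time with respect to the weak topologies (which is the
compact-open topology). -/
abbrev PathSpace (d : ℕ) (γ T : ℝ) [Fact (1 < γ)] (G : Type) [MeasureSpace G] :=
  C(Icc (0 : ℝ) T, WeakSpace ℝ (Lp ℝ (ENNReal.ofReal γ) (volume : Measure G))) ×
    C(Icc (0 : ℝ) T, WeakSpace ℝ (Lp (Vec d) 2 (volume : Measure G)))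

section Spaces

variable {d : ℕ} {γ T : ℝ} [Fact (1 < γ)] {G : Type} [MeasureSpace G]

/-- The density of a path at time `t`, as a function on `G`. -/
def density (w : PathSpace d γ T G) (t : Icc (0 : ℝ) T) : G → ℝ :=
  ((toWeakSpace ℝ (Lp ℝ (ENNReal.ofReal γ) (volume : Measure G))).symm (w.1 t) :)

/-- The momentum of a path at time `t`, as a function on `G`. -/
def momentum (w : PathSpace d γ T G) (t : Icc (0 : ℝ) T) : G → Vec d :=
  ((toWeakSpace ℝ (Lp (Vec d) 2 (volume : Measure G))).symm (w.2 t) :)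

/-- The space-time functions `ρ` and `m` are jointly measurable and represent the path `w`. -/
structure Represents (w : PathSpace d γ T G) (ρ : ℝ → G → ℝ) (m : ℝ → G → Vec d) : Prop where
  meas_ρ : AEStronglyMeasurable (fun q : ℝ × G => ρ q.1 q.2) (volume.restrict (slab T G))
  meas_m : AEStronglyMeasurable (fun q : ℝ × G => m q.1 q.2) (volume.restrict (slab T G))
  eq_ρ : ∀ t : Icc (0 : ℝ) T, density w t =ᵐ[volume] ρ t
  eq_m : ∀ t : Icc (0 : ℝ) T, momentum w t =ᵐ[volume] m t

variable [AddCommGroup G] [TopologicalSpace G]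

/-- `w` is a path and `z = (ρ, m, M, Q)` is a subsolution whose components `ρ`, `m` represent
`w`. -/
structure IsSubsolution (π : Vec d →+ G) (Ω : Set G) (w : PathSpace d γ T G) (z : Fields d G) :
    Prop where
  represents : Represents w z.ρ z.m
  density_pos : ∀ t ∈ Ioo 0 T, ∀ x, 0 < z.ρ t x
  symm : ∀ t ∈ Ioo 0 T, ∀ x, z.M t x ∈ symTraceFree d
  locInt_M : ∀ i j, LocallyIntegrableOn (fun q : ℝ × G => z.M q.1 q.2 i j) (slab T G)
  int_M : ∀ i j, IntegrableOn (fun q : ℝ × G => z.M q.1 q.2 i j) (Ioo 0 T ×ˢ Ω)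
  linear : RelaxedSystem π T z
  ineq : ∀ t ∈ Ioo 0 T, ∀ x ∈ Ω,
    z.Q t x ≥ pressure γ (z.ρ t x) + 2 / (d : ℝ) * eKin (z.ρ t x) (z.m t x) (z.M t x)

/-- At `t = 0` and `t = T` the path `w` agrees with `(ρ₀, m₀)` almost everywhere. -/
def AgreesAtEndpoints (z₀ : Fields d G) (w : PathSpace d γ T G) : Prop :=
  ∀ t : Icc (0 : ℝ) T, ((t : ℝ) = 0 ∨ (t : ℝ) = T) →
    density w t =ᵐ[volume] z₀.ρ t ∧ momentum w t =ᵐ[volume] z₀.m t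

/-- The space `X₀` of strict subsolutions with the same generalized pressure as `z₀`, the same
values at `t = 0, T` and outside `Ω`, and such that `m(t, ·) - m_*(t, ·)` has compact support
in `Ω` for every `t`, where `m_*` is a given reference field. -/
def spaceX₀ (π : Vec d →+ G) (Ω : Set G) (z₀ : Fields d G) (mref : ℝ → G → Vec d) :
    Set (PathSpace d γ T G) :=
  {w | (∀ t : Icc (0 : ℝ) T, ∃ C : Set G, IsCompact C ∧ C ⊆ Ω ∧
          ∀ᵐ x : G, x ∉ C → momentum w t x = mref t x) ∧
    AgreesAtEndpoints z₀ w ∧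
    ∃ z : Fields d G, z.Q = z₀.Q ∧ IsSubsolution π Ω w z ∧
      (∀ᵐ q ∂((volume : Measure (ℝ × G)).restrict (Ioo 0 T ×ˢ Ωᶜ)),
        z.ρ q.1 q.2 = z₀.ρ q.1 q.2 ∧ z.m q.1 q.2 = z₀.m q.1 q.2 ∧
          z.M q.1 q.2 = z₀.M q.1 q.2) ∧
      ContinuousOn (fun q : ℝ × G => z.ρ q.1 q.2) (Icc 0 T ×ˢ Ω) ∧
      ContinuousOn (fun q : ℝ × G => z.m q.1 q.2) (Icc 0 T ×ˢ Ω) ∧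
      ContinuousOn (fun q : ℝ × G => z.M q.1 q.2) (Icc 0 T ×ˢ Ω) ∧
      ContinuousOn (fun q : ℝ × G => z.Q q.1 q.2) (Icc 0 T ×ˢ Ω) ∧
      ∀ t ∈ Ioo 0 T, ∀ x ∈ Ω,
        z.Q t x > pressure γ (z.ρ t x) + 2 / (d : ℝ) * eKin (z.ρ t x) (z.m t x) (z.M t x) ∧
        pressure γ (z.ρ t x) + 2 / (d : ℝ) * eKin (z.ρ t x) (z.m t x) (z.M t x) >
          pressure γ (z.ρ t x) + ‖z.m t x‖ ^ 2 / (d * z.ρ t x)}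

/-- The space `X`: the closure of `X₀` in the path space, with the subspace topology. -/
def spaceX (π : Vec d →+ G) (Ω : Set G) (z₀ : Fields d G) (mref : ℝ → G → Vec d) :
    Set (PathSpace d γ T G) :=
  closure (spaceX₀ π Ω z₀ mref)

/-- The path `w` is a weak solution of the Euler equations that agrees with `(ρ₀, m₀)` at
`t = 0, T` and outside `Ω`, and satisfies `Q = p(ρ) + |m|² / (d ρ)` almost everywhere in
`(0, T) × Ω`. -/
def IsExactSolution (π : Vec d →+ G) (Ω : Set G) (z₀ : Fields d G) (w : PathSpace d γ T G) :
    Prop :=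
  AgreesAtEndpoints z₀ w ∧
  (∀ t : Icc (0 : ℝ) T, (t : ℝ) ∈ Ioo 0 T →
    ∀ᵐ x ∂((volume : Measure G).restrict Ωᶜ),
      density w t x = z₀.ρ t x ∧ momentum w t x = z₀.m t x) ∧
  ∃ (ρ : ℝ → G → ℝ) (m : ℝ → G → Vec d), Represents w ρ m ∧
    IsWeakEulerSolution π γ T ρ m ∧
    ∀ᵐ q ∂((volume : Measure (ℝ × G)).restrict (Ioo 0 T ×ˢ Ω)),
      z₀.Q q.1 q.2 =
        pressure γ (ρ q.1 q.2) + ‖m q.1 q.2‖ ^ 2 / (d * ρ q.1 q.2)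

end Spaces

end IsentropicEuler

end

noncomputable section

set_option linter.unusedSectionVars false

namespace IsentropicEuler

open Matrix

/-! The proof is convex integration by a Baire category argument. Write f(ρ, m) = p(ρ) + |m|²/(dρ),
a strictly convex function (`energy`). For a subsolution the matrix (Q - p(ρ)) I - (m⊗m/ρ - M) is
positive semidefinite, and since M is trace-free its trace is d (Q - f). The scalar excess Q - f
therefore controls the whole matrix (`abs_defect_le`): when the excess tends to zero, M + Q I tends
to m⊗m/ρ + p(ρ) I, and the linear system turns into the Euler system (`tendsto_flux`).

The excess is not weakly continuous, so it is linearised. For a subsolution z, `gap` integrates over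
a compact box Q minus the tangent plane of f at z, evaluated at a path w. It is affine in w and
continuous on X (`continuousOn_gap`), its integrand is nonnegative for w in X, and it equals the
integrated excess when w is the path of z. Let O_n be the set of paths in X whose gap over the n-th
box, relative to some subsolution from X₀, is below 2⁻ⁿ. Continuity of the gap makes O_n open. If w
lies in every O_n, the gaps are summable, so the pointwise defects tend to zero almost everywhere.
Strict convexity then forces Q = f(ρ, m) together with pointwise convergence of the chosen
subsolutions to w, and dominated convergence turns the relaxed equations into the Euler equations
(`isExactSolution_of_seq`).

Density of O_n comes from adding oscillations. The mean eigenvalue of m⊗m/ρ - M lies below Q - p(ρ)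
by exactly the excess, which leaves room for a segment of admissible states in the direction of a
shear flow; for bounded Q its squared half-length is at least a constant times ρ · excess²
(`exists_direction`, `exists_segment`). Such waves are realised with compact support as exact
solutions of the linear system through third derivatives of a potential (`WavePotential`). They tend
weakly to zero as the frequency grows, while their momentum keeps a definite mean square. Filling a
fixed fraction of a chart with disjoint balls (Besicovitch) yields a new subsolution z', weakly as
close to z as desired, with ∫ |m' - m|²/ρ bounded below in terms of the excess of z
(`exists_improvement`).

The density ρ is never changed and f is quadratic in m, so the gap of the new path relative to z is
exactly ∫ excess(z') + (1/d) ∫ |m' - m|²/ρ (`gap_eq_of_density_eq`). By continuity this is nearly ∫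
excess(z); hence the excess drops by a fixed amount as long as it is not small, and finitely many
rounds make it small (`exists_excess_lt`).

Euclidean space and the torus are treated together: π is an isomorphism on balls of radius 1/4
(`IsLocalModel`), and every wave lives in one such chart. -/

/-! ### Quadratic forms and the largest eigenvalue -/

/-- The quadratic form of `A` is bounded by `q - ε` for some `ε > 0`. -/
def FormLT {d : ℕ} (A : Mat d) (q : ℝ) : Prop :=
  ∃ ε > 0, ∀ x : Vec d, x.ofLp ⬝ᵥ A *ᵥ x.ofLp ≤ (q - ε) * ‖x‖ ^ 2

lemma dotProduct_eq_inner {d : ℕ} (x y : Vec d) : x.ofLp ⬝ᵥ y.ofLp = inner ℝ x y := by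
  simp [PiLp.inner_apply, dotProduct, mul_comm]

lemma dotProduct_tensorSq {d : ℕ} (m x : Vec d) :
    x.ofLp ⬝ᵥ tensorSq m *ᵥ x.ofLp = inner ℝ m x ^ 2 := by
  rw [← dotProduct_eq_inner]
  have : tensorSq m *ᵥ x.ofLp = (m.ofLp ⬝ᵥ x.ofLp) • m.ofLp := by
    ext i
    simp only [tensorSq, mulVec, dotProduct, of_apply, Pi.smul_apply, smul_eq_mul, Finset.sum_mul]
    exact Finset.sum_congr rfl fun j _ => by ring
  rw [this, dotProduct_smul, dotProduct_comm, smul_eq_mul, sq]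

lemma tensorSq_isSymm {d : ℕ} (m : Vec d) : (tensorSq m).IsSymm := by
  ext i j; simp [tensorSq, mul_comm]

lemma trace_tensorSq {d : ℕ} (m : Vec d) : (tensorSq m).trace = ‖m‖ ^ 2 := by
  rw [EuclideanSpace.real_norm_sq_eq]
  simp [tensorSq, Matrix.trace, sq]

lemma isHermitian_of_isSymm {d : ℕ} {A : Mat d} (hA : A.IsSymm) : A.IsHermitian := by
  rw [Matrix.IsHermitian, conjTranspose_eq_transpose_of_trivial]; exact hA

lemma inner_eigenvectorBasis_mulVec {d : ℕ} {A : Mat d} (hA : A.IsHermitian) (x : Vec d)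
    (i : Fin d) :
    inner ℝ (hA.eigenvectorBasis i) (WithLp.toLp 2 (A *ᵥ x.ofLp))
      = hA.eigenvalues i * inner ℝ (hA.eigenvectorBasis i) x := by
  have hT : Aᵀ = A := by simpa [conjTranspose_eq_transpose_of_trivial] using hA.eq
  rw [← dotProduct_eq_inner, ← dotProduct_eq_inner, dotProduct_mulVec, ← mulVec_transpose, hT,
    hA.mulVec_eigenvectorBasis i, smul_dotProduct, smul_eq_mul]

lemma form_eq_sum {d : ℕ} {A : Mat d} (hA : A.IsHermitian) (x : Vec d) :
    x.ofLp ⬝ᵥ A *ᵥ x.ofLp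
      = ∑ i, hA.eigenvalues i * inner ℝ (hA.eigenvectorBasis i) x ^ 2 := by
  have h1 : x.ofLp ⬝ᵥ A *ᵥ x.ofLp = inner ℝ x (WithLp.toLp 2 (A *ᵥ x.ofLp)) :=
    dotProduct_eq_inner x (WithLp.toLp 2 (A *ᵥ x.ofLp))
  rw [h1, ← hA.eigenvectorBasis.sum_inner_mul_inner]
  refine Finset.sum_congr rfl fun i _ => ?_
  rw [inner_eigenvectorBasis_mulVec, real_inner_comm]
  ring

lemma norm_sq_eq_sum {d : ℕ} {A : Mat d} (hA : A.IsHermitian) (x : Vec d) :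
    ‖x‖ ^ 2 = ∑ i, inner ℝ (hA.eigenvectorBasis i) x ^ 2 := by
  rw [← real_inner_self_eq_norm_sq, ← hA.eigenvectorBasis.sum_inner_mul_inner]
  refine Finset.sum_congr rfl fun i _ => ?_
  rw [real_inner_comm, sq]

lemma lambdaMax_eq {d : ℕ} {A : Mat d} (hA : A.IsHermitian) :
    lambdaMax A = sSup (range hA.eigenvalues) := by
  rw [lambdaMax, ← hA.spectrum_real_eq_range_eigenvalues, ← Matrix.spectrum_toLin']
  congr 1
  ext a
  exact Module.End.hasEigenvalue_iff_mem_spectrum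

lemma eigenvalues_le_lambdaMax {d : ℕ} {A : Mat d} (hA : A.IsHermitian) (i : Fin d) :
    hA.eigenvalues i ≤ lambdaMax A := by
  rw [lambdaMax_eq hA]
  exact le_csSup (finite_range _).bddAbove (mem_range_self i)

lemma exists_eigenvalues_eq_lambdaMax {d : ℕ} (hd : 0 < d) {A : Mat d} (hA : A.IsHermitian) :
    ∃ i, hA.eigenvalues i = lambdaMax A := by
  have : Nonempty (Fin d) := ⟨⟨0, hd⟩⟩
  rw [lambdaMax_eq hA]
  exact (range_nonempty _).csSup_mem (finite_range _)

lemma form_le_lambdaMax {d : ℕ} {A : Mat d} (hA : A.IsSymm) (x : Vec d) :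
    x.ofLp ⬝ᵥ A *ᵥ x.ofLp ≤ lambdaMax A * ‖x‖ ^ 2 := by
  have h := isHermitian_of_isSymm hA
  rw [form_eq_sum h, norm_sq_eq_sum h, Finset.mul_sum]
  exact Finset.sum_le_sum fun i _ =>
    mul_le_mul_of_nonneg_right (eigenvalues_le_lambdaMax h i) (sq_nonneg _)

lemma form_eigenvectorBasis {d : ℕ} {A : Mat d} (hA : A.IsHermitian) (i : Fin d) :
    (hA.eigenvectorBasis i).ofLp ⬝ᵥ A *ᵥ (hA.eigenvectorBasis i).ofLp = hA.eigenvalues i := by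
  rw [hA.mulVec_eigenvectorBasis i, dotProduct_smul, dotProduct_eq_inner]
  simp

/-- The form is maximised at an eigenvector of the top eigenvalue. The version with a uniform margin
is stable under small changes and under adding rank-one forms, which is what the rest of the
argument uses. Positive dimension guarantees that an eigenvalue exists, so that the supremum is not
a default value. -/
lemma lambdaMax_lt_iff {d : ℕ} (hd : 0 < d) {A : Mat d} (hA : A.IsSymm) {q : ℝ} :
    lambdaMax A < q ↔ FormLT A q := by
  constructor
  · intro h
    exact ⟨q - lambdaMax A, by linarith, fun x => by simpa using form_le_lambdaMax hA x⟩
  · rintro ⟨ε, hε, h⟩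
    obtain ⟨i, hi⟩ := exists_eigenvalues_eq_lambdaMax hd (isHermitian_of_isSymm hA)
    have := h ((isHermitian_of_isSymm hA).eigenvectorBasis i)
    rw [form_eigenvectorBasis, hi] at this
    simp at this
    linarith

lemma trace_eq_sum {d : ℕ} {A : Mat d} (hA : A.IsHermitian) :
    A.trace = ∑ i, hA.eigenvalues i := by
  simpa using hA.trace_eq_sum_eigenvalues

lemma eq_smul_one_of_eigenvalues {d : ℕ} {A : Mat d} (hA : A.IsHermitian) {c : ℝ}
    (h : ∀ i, hA.eigenvalues i = c) : A = c • (1 : Mat d) := by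
  have key : ∀ x : Vec d, WithLp.toLp 2 (A *ᵥ x.ofLp) = c • x := by
    intro x
    apply hA.eigenvectorBasis.repr.injective
    ext i
    simp only [OrthonormalBasis.repr_apply_apply, inner_eigenvectorBasis_mulVec, h,
      inner_smul_right]
  ext i j
  have h1 := congrArg (fun v : Vec d => v i) (key (EuclideanSpace.single j 1))
  simpa [Matrix.one_apply, Pi.single_apply, PiLp.single_apply] using h1

/-- The mean eigenvalue is below the largest one unless all eigenvalues coincide, and then the
matrix is scalar. -/
lemma trace_lt_lambdaMax {d : ℕ} {A : Mat d} (hA : A.IsSymm)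
    (hne : ∀ c : ℝ, A ≠ c • (1 : Mat d)) : A.trace < d * lambdaMax A := by
  have h := isHermitian_of_isSymm hA
  rw [trace_eq_sum h]
  have : ∃ i, h.eigenvalues i ≠ lambdaMax A := by
    by_contra! hc
    exact hne _ (eq_smul_one_of_eigenvalues h hc)
  obtain ⟨i, hi⟩ := this
  calc ∑ i, h.eigenvalues i < ∑ _i : Fin d, lambdaMax A :=
        Finset.sum_lt_sum (fun i _ => eigenvalues_le_lambdaMax h i)
          ⟨i, Finset.mem_univ _, lt_of_le_of_ne (eigenvalues_le_lambdaMax h i) hi⟩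
    _ = d * lambdaMax A := by simp

lemma lambdaMax_smul_one {d : ℕ} (hd : 0 < d) (c : ℝ) : lambdaMax (c • (1 : Mat d)) = c := by
  have hs : (c • (1 : Mat d)).IsSymm := by simp [Matrix.IsSymm]
  have h := isHermitian_of_isSymm hs
  obtain ⟨i, hi⟩ := exists_eigenvalues_eq_lambdaMax hd h
  have h2 := form_eigenvectorBasis h i
  rw [← hi, ← h2, smul_mulVec, one_mulVec, dotProduct_smul, dotProduct_eq_inner]
  simp

/-- The entries of a positive semidefinite matrix are bounded by its trace. -/
lemma abs_entry_le_trace {d : ℕ} {A : Mat d} (hA : A.IsSymm)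
    (h : ∀ x : Vec d, 0 ≤ x.ofLp ⬝ᵥ A *ᵥ x.ofLp) (i j : Fin d) : |A i j| ≤ A.trace := by
  have hdiag : ∀ k, 0 ≤ A k k := fun k => by
    simpa using h (EuclideanSpace.single k 1)
  have hsum : ∀ k, A k k ≤ A.trace := fun k =>
    Finset.single_le_sum (f := fun k => A k k) (fun k _ => hdiag k) (Finset.mem_univ k)
  -- Testing with e_i ± e_j gives |2 A i j| ≤ A i i + A j j, and each diagonal entry is at most the
  -- trace.
  have hp := h (EuclideanSpace.single i 1 + EuclideanSpace.single j 1)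
  have hm := h (EuclideanSpace.single i 1 - EuclideanSpace.single j 1)
  have hij : A j i = A i j := hA.apply i j
  simp [mulVec_add, mulVec_sub, add_dotProduct, sub_dotProduct, hij] at hp hm
  rw [abs_le]
  have := hsum i
  have := hsum j
  constructor <;> linarith

/-! ### Open conditions -/

lemma abs_form_le {d : ℕ} (A : Mat d) (x : Vec d) :
    |x.ofLp ⬝ᵥ A *ᵥ x.ofLp| ≤ (∑ i, ∑ j, |A i j|) * ‖x‖ ^ 2 := by
  have hx : ∀ i, |x i| ≤ ‖x‖ := fun i => by simpa using PiLp.norm_apply_le x i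
  simp only [dotProduct, mulVec, Finset.mul_sum, Finset.sum_mul]
  refine (Finset.abs_sum_le_sum_abs _ _).trans (Finset.sum_le_sum fun i _ => ?_)
  refine (Finset.abs_sum_le_sum_abs _ _).trans (Finset.sum_le_sum fun j _ => ?_)
  rw [abs_mul, abs_mul]
  calc |x i| * (|A i j| * |x j|) = |A i j| * (|x i| * |x j|) := by ring
    _ ≤ |A i j| * (‖x‖ * ‖x‖) := by gcongr <;> apply hx
    _ = |A i j| * ‖x‖ ^ 2 := by ring

/-- Half of the margin ε absorbs any change of the matrix and of the level of total size below ε/2.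
-/
lemma isOpen_formLT (d : ℕ) : IsOpen {z : Mat d × ℝ | FormLT z.1 z.2} := by
  rw [isOpen_iff_mem_nhds]
  rintro ⟨A, q⟩ ⟨ε, hε, h⟩
  have hc : Continuous fun z : Mat d × ℝ => (∑ i, ∑ j, |z.1 i j - A i j|) + (q - z.2) := by
    fun_prop
  have h0 : (fun z : Mat d × ℝ => (∑ i, ∑ j, |z.1 i j - A i j|) + (q - z.2)) (A, q) < ε / 2 := by
    simp; linarith
  filter_upwards [hc.continuousAt.eventually_lt continuousAt_const h0] with z hz
  refine ⟨ε / 2, by linarith, fun x => ?_⟩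
  have h1 := abs_form_le (z.1 - A) x
  have h2 : x.ofLp ⬝ᵥ z.1 *ᵥ x.ofLp
      = x.ofLp ⬝ᵥ A *ᵥ x.ofLp + x.ofLp ⬝ᵥ (z.1 - A) *ᵥ x.ofLp := by
    rw [sub_mulVec, dotProduct_sub]; ring
  have h3 := h x
  have h4 := le_abs_self (x.ofLp ⬝ᵥ (z.1 - A) *ᵥ x.ofLp)
  simp only [Matrix.sub_apply] at h1
  nlinarith [sq_nonneg ‖x‖]

/-- The set of all states that are strict subsolutions in the interior of the hull and do not lie
on the manifold `M = (m ∘ m) / ρ`. -/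
def admissible (d : ℕ) (γ : ℝ) : Set (ℝ × Vec d × Mat d × ℝ) :=
  {z | 0 < z.1 ∧ FormLT (z.1⁻¹ • tensorSq z.2.1 - z.2.2.1) (z.2.2.2 - pressure γ z.1) ∧
    ∀ c : ℝ, z.1⁻¹ • tensorSq z.2.1 - z.2.2.1 ≠ c • (1 : Mat d)}

lemma continuous_tensorSq (d : ℕ) : Continuous (tensorSq : Vec d → Mat d) := by
  unfold tensorSq
  refine continuous_matrix fun i j => ?_
  simp only [of_apply]
  fun_prop

lemma isClosed_scalar (d : ℕ) : IsClosed {A : Mat d | ∃ c : ℝ, A = c • (1 : Mat d)} := by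
  have : {A : Mat d | ∃ c : ℝ, A = c • (1 : Mat d)}
      = (Submodule.span ℝ {(1 : Mat d)} : Set (Mat d)) := by
    ext A
    simp [Submodule.mem_span_singleton, eq_comm]
  rw [this]
  exact Submodule.closed_of_finiteDimensional _

lemma isOpen_admissible (d : ℕ) (γ : ℝ) : IsOpen (admissible d γ) := by
  rw [isOpen_iff_mem_nhds]
  rintro ⟨r, m, M, Q⟩ ⟨hr, h1, h2⟩
  simp only at hr h1 h2
  have hr' : ∀ᶠ z : ℝ × Vec d × Mat d × ℝ in 𝓝 (r, m, M, Q), 0 < z.1 :=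
    continuousAt_fst.eventually_const_lt hr
  have hA : ContinuousAt (fun z : ℝ × Vec d × Mat d × ℝ => z.1⁻¹ • tensorSq z.2.1 - z.2.2.1)
      (r, m, M, Q) := by
    refine ContinuousAt.sub (ContinuousAt.smul (continuousAt_fst.inv₀ hr.ne') ?_) (by fun_prop)
    exact ((continuous_tensorSq d).comp (by fun_prop)).continuousAt
  have hq : ContinuousAt (fun z : ℝ × Vec d × Mat d × ℝ => z.2.2.2 - pressure γ z.1)
      (r, m, M, Q) :=
    ContinuousAt.sub (by fun_prop) (continuousAt_fst.rpow_const (Or.inl hr.ne'))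
  have e1 := (hA.prodMk hq).preimage_mem_nhds ((isOpen_formLT d).mem_nhds h1)
  have e2 := hA.preimage_mem_nhds ((isClosed_scalar d).isOpen_compl.mem_nhds
    (by simpa using h2))
  filter_upwards [hr', e1, e2] with z z1 z2 z3
  exact ⟨z1, z2, by simpa using z3⟩

/-- M is trace-free, so the mean eigenvalue of m⊗m/ρ - M is |m|²/(dρ). The second inequality thus
says that the largest eigenvalue exceeds the mean, i.e. that the matrix is not scalar. In this form
the pointwise constraints of X₀ are visibly open. -/
lemma mem_admissible_iff {d : ℕ} (hd : 0 < d) {γ r Q : ℝ} {m : Vec d} {M : Mat d}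
    (hM : M ∈ symTraceFree d) (hr : 0 < r) :
    (r, m, M, Q) ∈ admissible d γ ↔
      Q > pressure γ r + 2 / (d : ℝ) * eKin r m M ∧
      pressure γ r + 2 / (d : ℝ) * eKin r m M > pressure γ r + ‖m‖ ^ 2 / (d * r) := by
  have hd' : (0 : ℝ) < d := by exact_mod_cast hd
  have hs : (r⁻¹ • tensorSq m - M).IsSymm := ((tensorSq_isSymm m).smul _).sub hM.1
  have he : 2 / (d : ℝ) * eKin r m M = lambdaMax (r⁻¹ • tensorSq m - M) := by
    unfold eKin; field_simp
  have ht : (r⁻¹ • tensorSq m - M).trace = ‖m‖ ^ 2 / r := by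
    rw [trace_sub, trace_smul, hM.2, trace_tensorSq, smul_eq_mul]; field_simp; ring
  rw [he]
  simp only [admissible, mem_ofPred_eq, hr, true_and, ← lambdaMax_lt_iff hd hs]
  refine and_congr ⟨fun h => by linarith, fun h => by linarith⟩ ⟨fun h => ?_, fun h c hc => ?_⟩
  · have := trace_lt_lambdaMax hs h
    rw [ht, mul_comm] at this
    have h3 : ‖m‖ ^ 2 / (d * r) = ‖m‖ ^ 2 / r / d := by field_simp
    rw [h3]
    have := (div_lt_iff₀ hd').2 this
    linarith
  · have h4 : ‖m‖ ^ 2 / r = d * c := by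
      rw [← ht, hc]; simp [trace_smul, mul_comm]
    have h3 : ‖m‖ ^ 2 / (d * r) = ‖m‖ ^ 2 / r / d := by field_simp
    rw [hc, lambdaMax_smul_one hd, h3, h4] at h
    field_simp at h
    linarith

/-! ### The direction of oscillation -/

/-- The mean eigenvalue is q - δ, so some eigenvalue l i is at most q - δ, and adding b ≤ δ/2 times
the projection onto e i keeps the form below q. The sum might be scalar, however. Tilting η slightly
from e i towards an e j with l j ≠ l i excludes this: a scalar sum would make η an eigenvector of A,
although η has components in two different eigenspaces. -/
lemma exists_direction {d : ℕ} {A : Mat d} {q δ : ℝ} (hA : A.IsSymm)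
    (hlt : FormLT A q) (hne : ∀ c : ℝ, A ≠ c • (1 : Mat d)) (hδ : 0 < δ)
    (htr : d * (q - δ) = A.trace) :
    ∃ η : Vec d, ‖η‖ = 1 ∧ ∀ b ≤ δ / 2, FormLT (A + b • tensorSq η) q ∧
      ∀ c : ℝ, A + b • tensorSq η ≠ c • (1 : Mat d) := by
  have h := isHermitian_of_isSymm hA
  obtain ⟨ε, hε, hlt⟩ := hlt
  set l := h.eigenvalues
  set e := h.eigenvectorBasis
  have hl : ∀ i, l i ≤ q - ε := fun i => by
    have := hlt (e i)
    rw [form_eigenvectorBasis] at this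
    simpa using this
  have hd : Nonempty (Fin d) := by
    by_contra hc
    rw [not_nonempty_iff] at hc
    exact hne 0 (Subsingleton.elim _ _)
  obtain ⟨i, hi⟩ : ∃ i, l i ≤ q - δ := by
    by_contra! hc
    have : ∑ _i : Fin d, (q - δ) < ∑ i, l i :=
      Finset.sum_lt_sum_of_nonempty Finset.univ_nonempty fun i _ => hc i
    rw [← trace_eq_sum h, ← htr] at this
    simp [mul_sub] at this
  obtain ⟨j, hj⟩ : ∃ j, l j ≠ l i := by
    by_contra! hc
    exact hne _ (eq_smul_one_of_eigenvalues h hc)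
  have hij : i ≠ j := fun hc => hj (by rw [hc])
  -- a unit vector close to `e i` in the plane of `e i` and `e j`
  obtain ⟨a, ha0, ha1, ha2⟩ : ∃ a : ℝ, Real.sin a ≠ 0 ∧ Real.cos a ≠ 0 ∧
      Real.cos a ^ 2 * (q - l i)⁻¹ + Real.sin a ^ 2 * (q - l j)⁻¹ < (δ / 2)⁻¹ := by
    have hc : Continuous fun a : ℝ =>
        Real.cos a ^ 2 * (q - l i)⁻¹ + Real.sin a ^ 2 * (q - l j)⁻¹ := by fun_prop
    have h0 : (fun a : ℝ =>
        Real.cos a ^ 2 * (q - l i)⁻¹ + Real.sin a ^ 2 * (q - l j)⁻¹) 0 < (δ / 2)⁻¹ := by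
      simp only [Real.cos_zero, Real.sin_zero]
      have : (q - l i)⁻¹ ≤ δ⁻¹ := inv_anti₀ hδ (by linarith)
      have h2 : δ⁻¹ < (δ / 2)⁻¹ := by
        apply inv_strictAnti₀ <;> linarith
      linarith
    have e1 := hc.continuousAt.eventually_lt continuousAt_const h0
    have e2 : ∀ᶠ a : ℝ in 𝓝 0, a ∈ Ioo (-1 : ℝ) 1 := Ioo_mem_nhds (by norm_num) (by norm_num)
    have e3 : ∀ᶠ a : ℝ in 𝓝[>] 0, 0 < a := self_mem_nhdsWithin
    obtain ⟨a, h1, h2, h3⟩ := ((e1.filter_mono nhdsWithin_le_nhds).and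
      ((e2.filter_mono nhdsWithin_le_nhds).and e3)).exists
    have hpi := Real.pi_gt_three
    refine ⟨a, (Real.sin_pos_of_pos_of_lt_pi h3 (by linarith [h2.2])).ne',
      (Real.cos_pos_of_mem_Ioo ⟨by linarith [h2.1], by linarith [h2.2]⟩).ne', h1⟩
  -- Θ is the value of the form (q - A)⁻¹ at η. It is at most 1/δ for the untilted direction, and
  -- stays below 2/δ for a small tilt.
  set Θ := Real.cos a ^ 2 * (q - l i)⁻¹ + Real.sin a ^ 2 * (q - l j)⁻¹ with hΘ
  have hqi : 0 < q - l i := by linarith [hl i]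
  have hqj : 0 < q - l j := by linarith [hl j]
  have hΘ0 : 0 < Θ := by positivity
  set η : Vec d := Real.cos a • e i + Real.sin a • e j with hη
  have hηx : ∀ x, inner ℝ η x = Real.cos a * inner ℝ (e i) x + Real.sin a * inner ℝ (e j) x := by
    intro x
    rw [hη, inner_add_left, real_inner_smul_left, real_inner_smul_left]
  have hei : inner ℝ (e i) η = Real.cos a := by
    rw [real_inner_comm, hηx]
    simp [e, hij.symm]
  have hej : inner ℝ (e j) η = Real.sin a := by
    rw [real_inner_comm, hηx]
    simp [e, hij]
  have hnorm : ‖η‖ = 1 := by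
    have : ‖η‖ ^ 2 = 1 := by
      rw [← real_inner_self_eq_norm_sq, hηx, hei, hej]
      nlinarith [Real.sin_sq_add_cos_sq a]
    nlinarith [norm_nonneg η]
  -- Cauchy-Schwarz for the form `q - A`
  have hform : ∀ x : Vec d, q * ‖x‖ ^ 2 - x.ofLp ⬝ᵥ A *ᵥ x.ofLp
      = ∑ k, (q - l k) * inner ℝ (e k) x ^ 2 := by
    intro x
    rw [form_eq_sum h, norm_sq_eq_sum h, Finset.mul_sum, ← Finset.sum_sub_distrib]
    exact Finset.sum_congr rfl fun k _ => by ring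
  have hCS : ∀ x : Vec d, inner ℝ η x ^ 2 ≤ Θ * (q * ‖x‖ ^ 2 - x.ofLp ⬝ᵥ A *ᵥ x.ofLp) := by
    intro x
    have h1 : (q - l i) * inner ℝ (e i) x ^ 2 + (q - l j) * inner ℝ (e j) x ^ 2
        ≤ q * ‖x‖ ^ 2 - x.ofLp ⬝ᵥ A *ᵥ x.ofLp := by
      rw [hform, ← Finset.sum_pair hij (f := fun k => (q - l k) * inner ℝ (e k) x ^ 2)]
      exact Finset.sum_le_sum_of_subset_of_nonneg (Finset.subset_univ _) fun k _ _ =>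
        mul_nonneg (by linarith [hl k]) (sq_nonneg _)
    refine le_trans ?_ (mul_le_mul_of_nonneg_left h1 hΘ0.le)
    rw [hηx, hΘ]
    set X := inner ℝ (e i) x
    set Y := inner ℝ (e j) x
    set P := q - l i
    set R := q - l j
    -- Lagrange's identity: Cauchy–Schwarz with an explicit square as remainder.
    have : (Real.cos a ^ 2 * P⁻¹ + Real.sin a ^ 2 * R⁻¹) * (P * X ^ 2 + R * Y ^ 2)
        - (Real.cos a * X + Real.sin a * Y) ^ 2
        = (Real.cos a * R * Y - Real.sin a * P * X) ^ 2 * (P⁻¹ * R⁻¹) := by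
      field_simp; ring
    have h2 : 0 ≤ (Real.cos a * R * Y - Real.sin a * P * X) ^ 2 * (P⁻¹ * R⁻¹) := by positivity
    linarith
  refine ⟨η, hnorm, fun b hb => ⟨?_, fun c hc => ?_⟩⟩
  -- The rank-one term uses up the fraction δΘ/2 < 1 of the margin q - A; the remaining fraction
  -- keeps a uniform gap.
  · have hσ : 0 < 1 - δ / 2 * Θ := by
      have := mul_lt_mul_of_pos_left ha2 (half_pos hδ)
      rw [mul_inv_cancel₀ (half_pos hδ).ne'] at this
      linarith
    refine ⟨(1 - δ / 2 * Θ) * ε, by positivity, fun x => ?_⟩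
    rw [add_mulVec, dotProduct_add, smul_mulVec, dotProduct_smul, dotProduct_tensorSq,
      smul_eq_mul]
    have h1 := hCS x
    have h2 := hlt x
    have h3 : b * inner ℝ η x ^ 2 ≤ δ / 2 * inner ℝ η x ^ 2 :=
      mul_le_mul_of_nonneg_right hb (sq_nonneg _)
    have h4 := mul_le_mul_of_nonneg_left h1 (half_pos hδ).le
    have h5 : (1 - δ / 2 * Θ) * (ε * ‖x‖ ^ 2)
        ≤ (1 - δ / 2 * Θ) * (q * ‖x‖ ^ 2 - x.ofLp ⬝ᵥ A *ᵥ x.ofLp) :=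
      mul_le_mul_of_nonneg_left (by linarith) hσ.le
    nlinarith
  · -- `η` would be an eigenvector of `A`
    have hA' : A = c • (1 : Mat d) - b • tensorSq η := by rw [← hc]; abel
    have hv : WithLp.toLp 2 (A *ᵥ η.ofLp) = (c - b) • η := by
      have h1 : tensorSq η *ᵥ η.ofLp = η.ofLp := by
        ext k
        have h2 : ∑ x, η x * η x = 1 := by
          have := EuclideanSpace.real_norm_sq_eq η
          rw [hnorm] at this
          simpa [sq] using this.symm
        simp only [tensorSq, mulVec, dotProduct, of_apply, mul_assoc]
        rw [← Finset.mul_sum, h2, mul_one]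
      rw [hA', sub_mulVec, smul_mulVec, smul_mulVec, h1, one_mulVec, sub_smul]
      rfl
    have k1 := inner_eigenvectorBasis_mulVec h η i
    have k2 := inner_eigenvectorBasis_mulVec h η j
    rw [hv, inner_smul_right] at k1 k2
    change (c - b) * inner ℝ (e i) η = l i * inner ℝ (e i) η at k1
    change (c - b) * inner ℝ (e j) η = l j * inner ℝ (e j) η at k2
    rw [hei] at k1
    rw [hej] at k2
    exact hj ((mul_right_cancel₀ ha0 k2).symm.trans (mul_right_cancel₀ ha1 k1))

/-- The symmetric product `a ⊗ b + b ⊗ a`. -/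
def symProd {d : ℕ} (a b : Vec d) : Mat d := Matrix.of fun i j => a i * b j + b i * a j

/-- Through every admissible state there is a segment of admissible states in the direction of a
shear flow, whose length is controlled by the deficiency `Q - p(ρ) - |m|² / (d ρ)`. -/
lemma exists_segment {d : ℕ} (hd : 2 ≤ d) {γ r Q : ℝ} {m : Vec d} {M : Mat d}
    (hM : M ∈ symTraceFree d) (hz : (r, m, M, Q) ∈ admissible d γ) :
    ∃ (η u : Vec d) (θ : ℝ), ‖η‖ = 1 ∧ inner ℝ u η = 0 ∧
      θ ^ 2 = (Q - pressure γ r - ‖m‖ ^ 2 / (d * r)) ^ 2 * r / (64 * d ^ 2 * (Q - pressure γ r)) ∧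
      ∀ s ∈ Icc (-1 : ℝ) 1,
        (r, m + (s * θ) • η, M + (s * θ) • symProd η u, Q) ∈ admissible d γ := by
  have hr : 0 < r := hz.1
  have hd0 : 0 < d := by omega
  have hd' : (2 : ℝ) ≤ d := by exact_mod_cast hd
  have hd1 : (0 : ℝ) < d := by linarith
  obtain ⟨i1, i2⟩ := (mem_admissible_iff hd0 hM hr).1 hz
  set q := Q - pressure γ r with hq
  set δ := q - ‖m‖ ^ 2 / (d * r) with hδ
  have hδ0 : 0 < δ := by linarith
  have hs : (r⁻¹ • tensorSq m - M).IsSymm := ((tensorSq_isSymm m).smul _).sub hM.1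
  have ht : (r⁻¹ • tensorSq m - M).trace = ‖m‖ ^ 2 / r := by
    rw [trace_sub, trace_smul, hM.2, trace_tensorSq, smul_eq_mul]; field_simp; ring
  obtain ⟨η, hη, H⟩ := exists_direction hs hz.2.1 hz.2.2 hδ0 (by
    rw [ht, ← hq, hδ]; field_simp; ring)
  have hmq : ‖m‖ ^ 2 ≤ d * r * q := by
    have : ‖m‖ ^ 2 / (d * r) ≤ q := by linarith
    rw [div_le_iff₀ (by positivity)] at this
    linarith
  have hqδ : δ ≤ q := by
    have : 0 ≤ ‖m‖ ^ 2 / (d * r) := by positivity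
    linarith
  have hq0 : 0 < q := by linarith
  -- Together with |m|² ≤ d r q this amplitude gives θ|m| ≤ δr/8 and θ² ≤ δr/8, so the coefficient
  -- of η⊗η below is at most 3δ/8.
  set θ := δ * Real.sqrt (r / q) / (8 * d) with hθ
  have hθ2 : θ ^ 2 = δ ^ 2 * r / (64 * d ^ 2 * q) := by
    rw [hθ, div_pow, mul_pow, Real.sq_sqrt (by positivity)]
    field_simp; norm_num
  have hθ0 : 0 ≤ θ := by positivity
  -- The drift u is the part of the velocity m/r orthogonal to η. Along the segment the cross terms
  -- of m⊗m/r with u are cancelled by the change of M, so m⊗m/r - M moves only by a multiple of η⊗η,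
  -- the situation of `exists_direction`.
  refine ⟨η, r⁻¹ • (m - (inner ℝ m η) • η), θ, hη, ?_, hθ2, fun s hs => ?_⟩
  · rw [real_inner_smul_left, inner_sub_left, real_inner_smul_left, real_inner_self_eq_norm_sq, hη]
    ring
  have hA : r⁻¹ • tensorSq (m + (s * θ) • η)
      - (M + (s * θ) • symProd η (r⁻¹ • (m - (inner ℝ m η) • η)))
      = (r⁻¹ • tensorSq m - M)
        + (2 * s * θ * inner ℝ m η / r + s ^ 2 * θ ^ 2 / r) • tensorSq η := by
    ext i j
    simp [tensorSq, symProd]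
    field_simp
    ring
  have hb : 2 * s * θ * inner ℝ m η / r + s ^ 2 * θ ^ 2 / r ≤ δ / 2 := by
    have h1 : |inner ℝ m η| ≤ ‖m‖ := by simpa [hη] using abs_real_inner_le_norm m η
    have hs1 : |s| ≤ 1 := abs_le.2 hs
    have h2 : s * inner ℝ m η ≤ ‖m‖ := by
      refine (le_abs_self _).trans ?_
      rw [abs_mul]
      calc |s| * |inner ℝ m η| ≤ 1 * ‖m‖ := by gcongr
        _ = ‖m‖ := one_mul _
    have h3 : s ^ 2 ≤ 1 := by rw [← sq_abs]; nlinarith [abs_nonneg s]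
    -- bound for `θ * ‖m‖`
    have h4 : θ * ‖m‖ ≤ δ * r / 8 := by
      refine (pow_le_pow_iff_left₀ (by positivity) (by positivity) two_ne_zero).1 ?_
      rw [mul_pow, hθ2]
      calc δ ^ 2 * r / (64 * d ^ 2 * q) * ‖m‖ ^ 2
          ≤ δ ^ 2 * r / (64 * d ^ 2 * q) * (d * r * q) := by gcongr
        _ = (δ * r / 8) ^ 2 / d := by field_simp; norm_num
        _ ≤ (δ * r / 8) ^ 2 := div_le_self (by positivity) (by linarith)
    have h5 : θ ^ 2 ≤ δ * r / 8 := by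
      rw [hθ2, div_le_iff₀ (by positivity)]
      have : δ ^ 2 * r ≤ δ * q * r := by nlinarith [mul_pos hδ0 hr]
      have h6 : (8 : ℝ) ≤ 8 * d ^ 2 := by nlinarith
      have h7 : 0 < δ * q * r := by positivity
      nlinarith
    rw [← add_div, div_le_iff₀ hr]
    have h8 : s ^ 2 * θ ^ 2 ≤ θ ^ 2 := by nlinarith [sq_nonneg θ]
    have h9 : θ * (s * inner ℝ m η) ≤ θ * ‖m‖ := mul_le_mul_of_nonneg_left h2 hθ0
    have h10 := mul_pos hδ0 hr
    have h11 : 2 * s * θ * inner ℝ m η = 2 * (θ * (s * inner ℝ m η)) := by ring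
    rw [h11]
    linarith
  refine ⟨hr, ?_, ?_⟩
  · simp only [hA, ← hq]; exact (H _ hb).1
  · simp only [hA]; exact (H _ hb).2

/-! ### Smooth functions and their directional derivatives -/

section Smooth

variable {E : Type*} [NormedAddCommGroup E] [NormedSpace ℝ E]

/-- The space of smooth real functions on `E`. -/
def smoothFn (E : Type*) [NormedAddCommGroup E] [NormedSpace ℝ E] : Submodule ℝ (E → ℝ) where
  carrier := {f | ContDiff ℝ ∞ f}
  add_mem' hf hg := by
    simp only [mem_ofPred_eq] at *
    exact hf.add hg
  zero_mem' := by
    simp only [mem_ofPred_eq]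
    exact contDiff_const
  smul_mem' c _ hf := by
    simp only [mem_ofPred_eq] at *
    exact hf.const_smul c

instance : CoeFun (smoothFn E) fun _ => E → ℝ := ⟨fun f => f.1⟩

lemma contDiff_smoothFn (f : smoothFn E) : ContDiff ℝ ∞ f := f.2

lemma differentiable_smoothFn (f : smoothFn E) : Differentiable ℝ f :=
  (contDiff_smoothFn f).differentiable (by simp)

lemma continuous_smoothFn (f : smoothFn E) : Continuous f := (contDiff_smoothFn f).continuous

@[simp] lemma smoothFn.add_apply (f g : smoothFn E) (y : E) : (f + g) y = f y + g y := rfl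
@[simp] lemma smoothFn.sub_apply (f g : smoothFn E) (y : E) : (f - g) y = f y - g y := rfl
@[simp] lemma smoothFn.neg_apply (f : smoothFn E) (y : E) : (-f) y = -f y := rfl
@[simp] lemma smoothFn.smul_apply (c : ℝ) (f : smoothFn E) (y : E) : (c • f) y = c * f y := rfl

lemma smoothFn.sum_apply {ι : Type*} (s : Finset ι) (f : ι → smoothFn E) (y : E) :
    (∑ i ∈ s, f i) y = ∑ i ∈ s, f i y := by
  simp

/-- The directional derivative, as a linear operator on smooth functions. -/
def pd : E →ₗ[ℝ] smoothFn E →ₗ[ℝ] smoothFn E :=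
  LinearMap.mk₂ ℝ (fun v f => ⟨fun y => fderiv ℝ f y v,
      ((contDiff_smoothFn f).fderiv_right (m := ∞) (by simp)).clm_apply contDiff_const⟩)
    (fun v w f => by ext y; simp)
    (fun c v f => by ext y; simp)
    (fun v f g => by
      ext y
      have := fderiv_add (𝕜 := ℝ) ((differentiable_smoothFn f) y) ((differentiable_smoothFn g) y)
      change fderiv ℝ (f.1 + g.1) y v = fderiv ℝ f.1 y v + fderiv ℝ g.1 y v
      rw [this]; rfl)
    (fun c v f => by
      ext y
      have := fderiv_const_smul (𝕜 := ℝ) ((differentiable_smoothFn f) y) c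
      change fderiv ℝ (c • f.1) y v = c * fderiv ℝ f.1 y v
      rw [this]; rfl)

lemma pd_apply (v : E) (f : smoothFn E) (y : E) : pd v f y = fderiv ℝ f y v := rfl

/-- With commuting directional derivatives, the conservation laws of the waves become algebraic
identities between linear operators. -/
lemma pd_comm (v w : E) (f : smoothFn E) : pd v (pd w f) = pd w (pd v f) := by
  have key : ∀ (a b : E) (y : E), fderiv ℝ (fun z => fderiv ℝ f z a) y b
      = fderiv ℝ (fderiv ℝ f) y b a := by
    intro a b y
    have hd : DifferentiableAt ℝ (fderiv ℝ f) y :=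
      (((contDiff_smoothFn f).fderiv_right (m := ∞) (by simp)).differentiable (by simp)) y
    rw [fderiv_clm_apply hd (differentiableAt_const a)]
    simp
  ext y
  change fderiv ℝ (fun z => fderiv ℝ f z w) y v = fderiv ℝ (fun z => fderiv ℝ f z v) y w
  rw [key, key]
  exact ((contDiff_smoothFn f).contDiffAt.isSymmSndFDerivAt (by
    simp only [minSmoothness_of_isRCLikeNormedField]
    exact WithTop.coe_le_coe.2 le_top)) v w

lemma pd_eq_zero_off {K : Set E} (hK : IsClosed K) {f : smoothFn E} (hf : ∀ y ∉ K, f y = 0)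
    (v : E) : ∀ y ∉ K, pd v f y = 0 := by
  intro y hy
  have : f.1 =ᶠ[𝓝 y] fun _ => 0 := by
    filter_upwards [hK.isOpen_compl.mem_nhds hy] with z hz using hf z hz
  rw [pd_apply, this.fderiv_eq]
  simp

lemma integral_mul_pd [FiniteDimensional ℝ E] [MeasurableSpace E] [BorelSpace E]
    (μ : Measure E) [μ.IsAddHaarMeasure] (v : E) (f g : smoothFn E) (hf : HasCompactSupport f) :
    ∫ y, f y * pd v g y ∂μ = -∫ y, pd v f y * g y ∂μ := by
  have hf' : HasCompactSupport (pd v f) := by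
    refine HasCompactSupport.of_support_subset_isCompact hf.isCompact ?_
    intro y hy
    by_contra hc
    exact hy (pd_eq_zero_off (isClosed_tsupport f.1)
      (fun z hz => image_eq_zero_of_notMem_tsupport hz) v y hc)
  exact integral_mul_fderiv_eq_neg_fderiv_mul_of_integrable
    (((continuous_smoothFn (pd v f)).mul (continuous_smoothFn g)).integrable_of_hasCompactSupport hf'.mul_right)
    (((continuous_smoothFn f).mul (continuous_smoothFn (pd v g))).integrable_of_hasCompactSupport hf.mul_right)
    (((continuous_smoothFn f).mul (continuous_smoothFn g)).integrable_of_hasCompactSupport hf.mul_right)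
    (fun x _ => differentiable_smoothFn f x) (fun x _ => differentiable_smoothFn g x)

/-! ### Rapidly oscillating functions -/

/-- The function `χ sin (n φ + β)`. -/
def oscFn (φ : E →L[ℝ] ℝ) (n : ℕ) (β : ℝ) (χ : smoothFn E) : smoothFn E :=
  ⟨fun y => χ y * Real.sin (n * φ y + β),
    (contDiff_smoothFn χ).mul (Real.contDiff_sin.comp ((contDiff_const.mul φ.contDiff).add
      contDiff_const))⟩

lemma oscFn_apply (φ : E →L[ℝ] ℝ) (n : ℕ) (β : ℝ) (χ : smoothFn E) (y : E) :
    oscFn φ n β χ y = χ y * Real.sin (n * φ y + β) := rfl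

/-- Writing the cosine as a sine shifted by π/2 keeps the family of oscillating functions closed
under differentiation. -/
lemma pd_oscFn (φ : E →L[ℝ] ℝ) (n : ℕ) (β : ℝ) (χ : smoothFn E) (v : E) :
    pd v (oscFn φ n β χ)
      = (n * φ v) • oscFn φ n (β + Real.pi / 2) χ + oscFn φ n β (pd v χ) := by
  ext y
  have h1 : HasFDerivAt (fun z => (n : ℝ) * φ z + β) ((n : ℝ) • φ) y :=
    (φ.hasFDerivAt.const_mul (n : ℝ)).add_const β
  have h2 := ((differentiable_smoothFn χ) y).hasFDerivAt.mul h1.sin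
  have h3 : fderiv ℝ (oscFn φ n β χ) y v = _ := congrArg (fun L => L v) h2.fderiv
  change fderiv ℝ (oscFn φ n β χ) y v
    = n * φ v * (χ y * Real.sin (n * φ y + (β + Real.pi / 2)))
      + fderiv ℝ χ y v * Real.sin (n * φ y + β)
  rw [h3, ← add_assoc, Real.sin_add_pi_div_two]
  simp
  ring

/-- Families of functions that are uniformly `O(1 / n)`. -/
def IsSmall {X : Type*} (F : ℕ → X → ℝ) : Prop :=
  ∃ C : ℝ, ∀ n : ℕ, 1 ≤ n → ∀ y, |F n y| ≤ C / n

lemma IsSmall.add {X : Type*} {F G : ℕ → X → ℝ} (hF : IsSmall F) (hG : IsSmall G) :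
    IsSmall fun n y => F n y + G n y := by
  obtain ⟨C, hC⟩ := hF
  obtain ⟨D, hD⟩ := hG
  exact ⟨C + D, fun n hn y => by
    rw [add_div]; exact (abs_add_le _ _).trans (add_le_add (hC n hn y) (hD n hn y))⟩

lemma IsSmall.const_mul {X : Type*} {F : ℕ → X → ℝ} (hF : IsSmall F) (c : ℝ) :
    IsSmall fun n y => c * F n y := by
  obtain ⟨C, hC⟩ := hF
  exact ⟨|c| * C, fun n hn y => by
    rw [abs_mul, mul_div_assoc]; exact mul_le_mul_of_nonneg_left (hC n hn y) (abs_nonneg _)⟩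

lemma IsSmall.congr {X : Type*} {F G : ℕ → X → ℝ} (hF : IsSmall F)
    (h : ∀ n, 1 ≤ n → ∀ y, G n y = F n y) : IsSmall G := by
  obtain ⟨C, hC⟩ := hF
  exact ⟨C, fun n hn y => by rw [h n hn y]; exact hC n hn y⟩

/-- Iterated directional derivatives. -/
def pdList : List E → smoothFn E → smoothFn E
  | [], f => f
  | v :: l, f => pdList l (pd v f)

lemma pdList_add (l : List E) (f g : smoothFn E) : pdList l (f + g) = pdList l f + pdList l g := by
  induction l generalizing f g with
  | nil => rfl
  | cons v l ih => simp [pdList, ih]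

lemma pdList_smul (l : List E) (c : ℝ) (f : smoothFn E) : pdList l (c • f) = c • pdList l f := by
  induction l generalizing f with
  | nil => rfl
  | cons v l ih => simp [pdList, ih]

/-- A derivative that falls on the sine produces a factor nφ(v) and a quarter turn of the phase; one
that falls on χ loses a power of n. After division by nᵏ only the term with all derivatives on the
sine survives. The constant has to be uniform in β because the induction shifts the phase. -/
lemma pdList_oscFn (φ : E →L[ℝ] ℝ) (l : List E) (χ : smoothFn E) (hχ : HasCompactSupport χ) :
    ∃ C : ℝ, ∀ (n : ℕ) (β : ℝ), 1 ≤ n → ∀ y,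
      |((n : ℝ) ^ l.length)⁻¹ * pdList l (oscFn φ n β χ) y
        - (l.map φ).prod * oscFn φ n (β + l.length * (Real.pi / 2)) χ y| ≤ C / n := by
  induction l generalizing χ with
  | nil => exact ⟨0, fun n β hn y => by simp [pdList]⟩
  | cons v l ih =>
    have hχ' : HasCompactSupport (pd v χ) := by
      refine HasCompactSupport.of_support_subset_isCompact hχ.isCompact ?_
      intro y hy
      by_contra hc
      exact hy (pd_eq_zero_off (isClosed_tsupport χ.1)
        (fun z hz => image_eq_zero_of_notMem_tsupport hz) v y hc)
    obtain ⟨C₁, h₁⟩ := ih χ hχ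
    obtain ⟨C₂, h₂⟩ := ih (pd v χ) hχ'
    obtain ⟨B, hB⟩ := hχ'.exists_bound_of_continuous (continuous_smoothFn (pd v χ))
    refine ⟨|φ v| * C₁ + (|C₂| + |(l.map φ).prod| * B), fun n β hn y => ?_⟩
    have hn' : (1 : ℝ) ≤ n := by exact_mod_cast hn
    have hn0 : (0 : ℝ) < n := by linarith
    have a1 := h₁ n (β + Real.pi / 2) hn y
    have a2 := h₂ n β hn y
    have a3 : |oscFn φ n (β + l.length * (Real.pi / 2)) (pd v χ) y| ≤ B := by
      rw [oscFn_apply, abs_mul]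
      calc _ ≤ B * 1 := mul_le_mul (hB y) (Real.abs_sin_le_one _) (abs_nonneg _)
            ((norm_nonneg _).trans (hB y))
        _ = B := mul_one B
    simp only [pdList, pd_oscFn, pdList_add, pdList_smul, smoothFn.add_apply, smoothFn.smul_apply,
      List.length_cons, List.map_cons, List.prod_cons]
    have e1 : β + ((l.length + 1 : ℕ) : ℝ) * (Real.pi / 2)
        = β + Real.pi / 2 + l.length * (Real.pi / 2) := by push_cast; ring
    rw [e1]
    set A := pdList l (oscFn φ n (β + Real.pi / 2) χ) y
    set A' := oscFn φ n (β + Real.pi / 2 + l.length * (Real.pi / 2)) χ y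
    set B' := pdList l (oscFn φ n β (pd v χ)) y
    set B'' := oscFn φ n (β + l.length * (Real.pi / 2)) (pd v χ) y
    set P := (l.map φ).prod
    have e2 : ((n : ℝ) ^ (l.length + 1))⁻¹ * (n * φ v * A + B') - φ v * P * A'
        = φ v * (((n : ℝ) ^ l.length)⁻¹ * A - P * A')
          + (1 / n) * ((((n : ℝ) ^ l.length)⁻¹ * B' - P * B'') + P * B'') := by
      rw [pow_succ]; field_simp; ring
    rw [e2]
    have b1 : |φ v * (((n : ℝ) ^ l.length)⁻¹ * A - P * A')| ≤ |φ v| * (C₁ / n) := by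
      rw [abs_mul]; exact mul_le_mul_of_nonneg_left a1 (abs_nonneg _)
    have b2 : |(((n : ℝ) ^ l.length)⁻¹ * B' - P * B'') + P * B''| ≤ |C₂| + |P| * B := by
      refine (abs_add_le _ _).trans (add_le_add (a2.trans ?_) ?_)
      · exact (div_le_div_of_nonneg_right (le_abs_self _) hn0.le).trans
          (div_le_self (abs_nonneg _) hn')
      · rw [abs_mul]; exact mul_le_mul_of_nonneg_left a3 (abs_nonneg _)
    refine (abs_add_le _ _).trans ?_
    rw [abs_mul (1 / (n : ℝ)), abs_of_pos (by positivity : 0 < 1 / (n : ℝ))]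
    calc _ ≤ |φ v| * (C₁ / n) + 1 / n * (|C₂| + |P| * B) := by gcongr
      _ = _ := by ring

end Smooth

/-! ### Localised shear flows -/

section Wave

variable {d : ℕ}

instance : (volume : Measure (ℝ × Vec d)).IsAddHaarMeasure :=
  inferInstanceAs (((volume : Measure ℝ).prod (volume : Measure (Vec d))).IsAddHaarMeasure)

/-- The `j`-th space direction in space-time. -/
def spaceDir (j : Fin d) : ℝ × Vec d := (0, EuclideanSpace.single j 1)

/-- The time direction in space-time. -/
def timeDir (d : ℕ) : ℝ × Vec d := (1, 0)

lemma sum_pd_spaceDir (c : Vec d) (f : smoothFn (ℝ × Vec d)) :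
    ∑ j, pd (spaceDir j) (c j • f) = pd ((0, c) : ℝ × Vec d) f := by
  have : ((0, c) : ℝ × Vec d) = ∑ j, c j • spaceDir j := by
    ext1
    · simp [Prod.fst_sum, spaceDir]
    · simp only [Prod.snd_sum, spaceDir, Prod.smul_mk]
      ext i
      simp [Pi.single_apply]
  rw [this, map_sum, LinearMap.sum_apply]
  simp

/-- The data of a localised shear flow: the potential, the direction of the momentum, the
direction of oscillation and the drift velocity. -/
structure WavePotential (d : ℕ) where
  η : Vec d
  ξ : Vec d
  u : Vec d
  Φ : smoothFn (ℝ × Vec d)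
  norm_η : ‖η‖ = 1
  norm_ξ : ‖ξ‖ = 1
  orth_ξη : inner ℝ ξ η = 0
  orth_uη : inner ℝ u η = 0

namespace WavePotential

variable (W : WavePotential d)

/-- The derivative in the direction of oscillation. -/
def d1 : smoothFn (ℝ × Vec d) →ₗ[ℝ] smoothFn (ℝ × Vec d) := pd ((0, W.ξ) : ℝ × Vec d)
/-- The derivative in the direction of the momentum. -/
def d2 : smoothFn (ℝ × Vec d) →ₗ[ℝ] smoothFn (ℝ × Vec d) := pd ((0, W.η) : ℝ × Vec d)
/-- The material derivative. -/
def dD : smoothFn (ℝ × Vec d) →ₗ[ℝ] smoothFn (ℝ × Vec d) := pd ((1, W.u) : ℝ × Vec d)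

/-- The stream function. -/
def stream : smoothFn (ℝ × Vec d) := W.d1 (W.d1 W.Φ) + W.d2 (W.d2 W.Φ)

/-- The momentum component. -/
def mom (i : Fin d) : smoothFn (ℝ × Vec d) := W.η i • W.d1 W.stream - W.ξ i • W.d2 W.stream

/-- Half the trace of the correction. -/
def corrH : smoothFn (ℝ × Vec d) := inner ℝ W.u W.ξ • W.d2 W.stream

/-- The diagonal part of the correction. -/
def corrE : smoothFn (ℝ × Vec d) :=
  (2 : ℝ) • W.d1 (W.d2 (W.dD W.Φ))
    - inner ℝ W.u W.ξ • (W.d1 (W.d1 (W.d2 W.Φ)) - W.d2 (W.d2 (W.d2 W.Φ)))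

/-- The off-diagonal part of the correction. -/
def corrB : smoothFn (ℝ × Vec d) :=
  W.d2 (W.d2 (W.dD W.Φ)) - W.d1 (W.d1 (W.dD W.Φ))
    - (2 * inner ℝ W.u W.ξ) • W.d1 (W.d2 (W.d2 W.Φ))

/-- The flux component. -/
def flux (i j : Fin d) : smoothFn (ℝ × Vec d) :=
  W.u j • W.mom i + W.u i • W.mom j
    + W.ξ j • (W.ξ i • (W.corrH + W.corrE) + W.η i • W.corrB)
    + W.η j • (W.η i • (W.corrH - W.corrE) + W.ξ i • W.corrB)

lemma d2_d1 (f : smoothFn (ℝ × Vec d)) : W.d2 (W.d1 f) = W.d1 (W.d2 f) := pd_comm _ _ f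
lemma dD_d1 (f : smoothFn (ℝ × Vec d)) : W.dD (W.d1 f) = W.d1 (W.dD f) := pd_comm _ _ f
lemma dD_d2 (f : smoothFn (ℝ × Vec d)) : W.dD (W.d2 f) = W.d2 (W.dD f) := pd_comm _ _ f

lemma sum_spaceDir_mom : ∑ j, pd (spaceDir j) (W.mom j) = 0 := by
  simp only [mom, map_sub, Finset.sum_sub_distrib, sum_pd_spaceDir]
  change W.d2 (W.d1 W.stream) - W.d1 (W.d2 W.stream) = 0
  rw [d2_d1, sub_self]

/-- The terms u⊗m + m⊗u of the flux combine with the time derivative into the material derivative of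
the momentum, as the momentum is divergence free. What remains is a divergence equation in the plane
of ξ and η. Because the stream function is a planar Laplacian of Φ, that equation is solved by third
derivatives of Φ (`corrE`, `corrB`), with no inverse Laplacian and hence no loss of compact support.
-/
lemma momentum_eq (i : Fin d) :
    pd (timeDir d) (W.mom i) + ∑ j, pd (spaceDir j) (W.flux i j) = 0 := by
  have h1 : ∑ j, pd (spaceDir j) (W.flux i j)
      = pd ((0, W.u) : ℝ × Vec d) (W.mom i) + W.u i • ∑ j, pd (spaceDir j) (W.mom j)
        + W.d1 (W.ξ i • (W.corrH + W.corrE) + W.η i • W.corrB)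
        + W.d2 (W.η i • (W.corrH - W.corrE) + W.ξ i • W.corrB) := by
    simp only [d1, d2, ← sum_pd_spaceDir, Finset.smul_sum, ← Finset.sum_add_distrib]
    exact Finset.sum_congr rfl fun j _ => by simp only [flux, map_add, map_smul]
  have h2 : pd (timeDir d) (W.mom i) + pd ((0, W.u) : ℝ × Vec d) (W.mom i) = W.dD (W.mom i) := by
    rw [dD, ← LinearMap.add_apply, ← map_add]
    simp [timeDir]
  rw [h1, sum_spaceDir_mom, smul_zero, add_zero, ← add_assoc, ← add_assoc, h2]
  simp only [mom, stream, corrH, corrE, corrB, map_add, map_sub, map_smul, d2_d1, dD_d1, dD_d2]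
  module

lemma sum_mul_of_orth {a b : Vec d} : ∑ i, a i * b i = inner ℝ a b := by
  simp [PiLp.inner_apply, mul_comm]

/-- This determines `corrH`: since u is orthogonal to η, the transport terms have trace -2 (u·ξ)
times the η-derivative of the stream function, and the two diagonal corrections contribute twice
`corrH`. -/
lemma trace_flux (y : ℝ × Vec d) : ∑ i, W.flux i i y = 0 := by
  have hξ : ∑ i, W.ξ i * W.ξ i = 1 := by
    rw [sum_mul_of_orth, real_inner_self_eq_norm_sq, W.norm_ξ]; norm_num
  have hη : ∑ i, W.η i * W.η i = 1 := by
    rw [sum_mul_of_orth, real_inner_self_eq_norm_sq, W.norm_η]; norm_num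
  have hξη : ∑ i, W.ξ i * W.η i = 0 := by rw [sum_mul_of_orth, W.orth_ξη]
  have huη : ∑ i, W.u i * W.η i = 0 := by rw [sum_mul_of_orth, W.orth_uη]
  have huξ : ∑ i, W.u i * W.ξ i = inner ℝ W.u W.ξ := sum_mul_of_orth
  have : ∀ i, W.flux i i y = 2 * W.d1 W.stream y * (W.u i * W.η i)
      - 2 * W.d2 W.stream y * (W.u i * W.ξ i) + (W.corrH y + W.corrE y) * (W.ξ i * W.ξ i)
      + (W.corrH y - W.corrE y) * (W.η i * W.η i) + 2 * W.corrB y * (W.ξ i * W.η i) := by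
    intro i
    simp only [flux, mom, smoothFn.add_apply, smoothFn.sub_apply, smoothFn.smul_apply]
    ring
  simp only [this, Finset.sum_add_distrib, Finset.sum_sub_distrib, ← Finset.mul_sum, hξ, hη, hξη,
    huη, huξ]
  simp only [corrH, smoothFn.smul_apply]
  ring

lemma flux_symm (i j : Fin d) : W.flux i j = W.flux j i := by
  simp only [flux]
  module

/-- Momentum and flux are differential expressions in Φ, hence local. -/
lemma off_d {K : Set (ℝ × Vec d)} (hK : IsClosed K) (hΦ : ∀ y ∉ K, W.Φ y = 0) :
    ∀ y ∉ K, (∀ i, W.mom i y = 0) ∧ ∀ i j, W.flux i j y = 0 := by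
  have P := fun v f hf y hy => pd_eq_zero_off (E := ℝ × Vec d) hK (f := f) hf v y hy
  have h11 := P (0, W.ξ) _ (P (0, W.ξ) _ hΦ)
  have h22 := P (0, W.η) _ (P (0, W.η) _ hΦ)
  have hs : ∀ y ∉ K, W.stream y = 0 := fun y hy => by
    have a := h11 y hy
    have b := h22 y hy
    simp only [stream, d1, d2, smoothFn.add_apply]
    rw [a, b, add_zero]
  have hm : ∀ y ∉ K, ∀ i, W.mom i y = 0 := fun y hy i => by
    have a := P (0, W.ξ) _ hs y hy
    have b := P (0, W.η) _ hs y hy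
    simp only [mom, d1, d2, smoothFn.sub_apply, smoothFn.smul_apply]
    rw [a, b]; ring
  have hH : ∀ y ∉ K, W.corrH y = 0 := fun y hy => by
    have b := P (0, W.η) _ hs y hy
    simp only [corrH, d2, smoothFn.smul_apply]
    rw [b, mul_zero]
  have hD := P (1, W.u) _ hΦ
  have h2 := P (0, W.η) _ hΦ
  have hE : ∀ y ∉ K, W.corrE y = 0 := fun y hy => by
    have a := P (0, W.ξ) _ (P (0, W.η) _ hD) y hy
    have b := P (0, W.ξ) _ (P (0, W.ξ) _ h2) y hy
    have c := P (0, W.η) _ h22 y hy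
    simp only [corrE, d1, d2, dD, smoothFn.sub_apply, smoothFn.smul_apply]
    rw [a, b, c]; ring
  have hB : ∀ y ∉ K, W.corrB y = 0 := fun y hy => by
    have a := P (0, W.η) _ (P (0, W.η) _ hD) y hy
    have b := P (0, W.ξ) _ (P (0, W.ξ) _ hD) y hy
    have c := P (0, W.ξ) _ h22 y hy
    simp only [corrB, d1, d2, dD, smoothFn.sub_apply, smoothFn.smul_apply]
    rw [a, b, c]; ring
  intro y hy
  refine ⟨hm y hy, fun i j => ?_⟩
  simp only [flux, smoothFn.add_apply, smoothFn.sub_apply, smoothFn.smul_apply, hm y hy, hH y hy,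
    hE y hy, hB y hy]
  ring

end WavePotential

/-- A shear flow varies in a direction transverse to its momentum; this is where dimension at least
two is indispensable. -/
lemma exists_orthogonal_unit (hd : 2 ≤ d) (η : Vec d) : ∃ ξ : Vec d, ‖ξ‖ = 1 ∧ inner ℝ ξ η = 0 := by
  have h : (Submodule.span ℝ {η})ᗮ ≠ ⊥ := by
    intro hb
    have h1 := Submodule.finrank_add_finrank_orthogonal (Submodule.span ℝ {η})
    rw [hb] at h1
    have h2 : Module.finrank ℝ (Submodule.span ℝ {η}) ≤ 1 := by
      simpa using finrank_span_le_card (R := ℝ) ({η} : Set (Vec d))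
    simp at h1
    omega
  obtain ⟨v, hv, hv0⟩ := Submodule.exists_mem_ne_zero_of_ne_bot h
  refine ⟨‖v‖⁻¹ • v, by rw [norm_smul, norm_inv, norm_norm,
    inv_mul_cancel₀ (norm_ne_zero_iff.2 hv0)], ?_⟩
  rw [real_inner_smul_left, Submodule.mem_orthogonal_singleton_iff_inner_left.1 hv, mul_zero]

/-- The factor n⁻³ and the phase shift -3π/2 undo the effect of three derivatives, so the leading
term has order one and phase α. -/
lemma isSmall_third (φ : (ℝ × Vec d) →L[ℝ] ℝ) (χ : smoothFn (ℝ × Vec d))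
    (hχ : HasCompactSupport χ) (α : ℝ) (a b c : ℝ × Vec d) :
    IsSmall fun (n : ℕ) y =>
      pd a (pd b (pd c (((n : ℝ) ^ 3)⁻¹ • oscFn φ n (α - 3 * (Real.pi / 2)) χ))) y
        - φ a * φ b * φ c * (χ y * Real.sin (n * φ y + α)) := by
  obtain ⟨C, hC⟩ := pdList_oscFn φ [c, b, a] χ hχ
  refine ⟨C, fun n hn y => ?_⟩
  have := hC n (α - 3 * (Real.pi / 2)) hn y
  simp only [pdList, List.length_cons, List.length_nil, List.map_cons, List.map_nil,
    List.prod_cons, List.prod_nil, oscFn_apply] at this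
  simp only [map_smul, smoothFn.smul_apply]
  convert this using 4
  · ring
  · push_cast; ring_nf

/-- The stream function takes only two of the three derivatives that n⁻³ compensates, so it is
O(1/n). This is what makes the waves weakly small. -/
lemma isSmall_second (φ : (ℝ × Vec d) →L[ℝ] ℝ) (χ : smoothFn (ℝ × Vec d))
    (hχ : HasCompactSupport χ) (β : ℝ) (a b : ℝ × Vec d) :
    IsSmall fun (n : ℕ) y => pd a (pd b (((n : ℝ) ^ 3)⁻¹ • oscFn φ n β χ)) y := by
  obtain ⟨C, hC⟩ := pdList_oscFn φ [b, a] χ hχ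
  obtain ⟨B, hB⟩ := hχ.exists_bound_of_continuous (continuous_smoothFn χ)
  refine ⟨|C| + |φ b * φ a| * B, fun n hn y => ?_⟩
  have h := hC n β hn y
  have hn' : (1 : ℝ) ≤ n := by exact_mod_cast hn
  have hn0 : (0 : ℝ) < n := by linarith
  simp only [pdList, List.length_cons, List.length_nil, List.map_cons, List.map_nil,
    List.prod_cons, List.prod_nil, oscFn_apply, mul_one, zero_add] at h
  simp only [map_smul, smoothFn.smul_apply]
  set X := pd a (pd b (oscFn φ n β χ)) y
  set S := Real.sin (n * φ y + (β + ((1 + 1 : ℕ) : ℝ) * (Real.pi / 2)))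
  have e : ((n : ℝ) ^ 3)⁻¹ * X
      = ((((n : ℝ) ^ (1 + 1))⁻¹ * X - φ b * φ a * (χ y * S)) + φ b * φ a * (χ y * S)) / n := by
    field_simp; ring
  rw [e, abs_div, abs_of_pos hn0]
  gcongr
  refine (abs_add_le _ _).trans (add_le_add (h.trans ?_) ?_)
  · exact (div_le_div_of_nonneg_right (le_abs_self _) hn0.le).trans
      (div_le_self (abs_nonneg _) hn')
  · rw [abs_mul]
    refine mul_le_mul_of_nonneg_left ?_ (abs_nonneg _)
    rw [abs_mul]
    calc _ ≤ B * 1 := mul_le_mul (hB y) (Real.abs_sin_le_one _) (abs_nonneg _)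
          ((norm_nonneg _).trans (hB y))
      _ = B := mul_one B

/-- Localised shear flows oscillating with large frequency `n`. -/
lemma exists_wavePotential (hd : 2 ≤ d) {η u : Vec d} (hη : ‖η‖ = 1) (huη : inner ℝ u η = 0)
    (χ : smoothFn (ℝ × Vec d)) (hχ : HasCompactSupport χ) :
    ∃ (φ : (ℝ × Vec d) →L[ℝ] ℝ) (W : ℕ → ℝ → WavePotential d),
      (∀ n α, ∀ y ∉ tsupport χ, (W n α).Φ y = 0) ∧
      (∀ α i, IsSmall fun n y => (W n α).mom i y - χ y * Real.sin (n * φ y + α) * η i) ∧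
      (∀ α i j, IsSmall fun n y =>
        (W n α).flux i j y - χ y * Real.sin (n * φ y + α) * symProd η u i j) ∧
      (∀ α, IsSmall fun n y => (W n α).stream y) ∧
      ∃ ξ : Vec d, ∀ n α, (W n α).ξ = ξ ∧ (W n α).η = η := by
  obtain ⟨ξ, hξ, hξη⟩ := exists_orthogonal_unit hd η
  -- The phase φ(t, x) = ξ·x - (ξ·u) t has slope one along ξ and is constant along η and along the
  -- drift (1, u). Every correction term contains an η-derivative or a material derivative and is
  -- therefore O(1/n).
  let φ : (ℝ × Vec d) →L[ℝ] ℝ := (innerSL ℝ ξ).comp (ContinuousLinearMap.snd ℝ ℝ (Vec d))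
    - (inner ℝ ξ u) • ContinuousLinearMap.fst ℝ ℝ (Vec d)
  have hφ : ∀ y, φ y = inner ℝ ξ y.2 - inner ℝ ξ u * y.1 := fun y => rfl
  have φ1 : φ (0, ξ) = 1 := by
    rw [hφ]
    simp [hξ]
  have φ2 : φ (0, η) = 0 := by rw [hφ]; simp [hξη]
  have φD : φ (1, u) = 0 := by rw [hφ]; simp
  let W : ℕ → ℝ → WavePotential d := fun n α =>
    ⟨η, ξ, u, ((n : ℝ) ^ 3)⁻¹ • oscFn φ n (α - 3 * (Real.pi / 2)) χ, hη, hξ, hξη, huη⟩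
  have T := fun α a b c => isSmall_third φ χ hχ α a b c
  have hp : ∀ α, IsSmall fun n y =>
      (W n α).d1 (W n α).stream y - χ y * Real.sin (n * φ y + α) := fun α => by
    refine ((T α (0, ξ) (0, ξ) (0, ξ)).add (T α (0, ξ) (0, η) (0, η))).congr fun n _ y => ?_
    simp only [WavePotential.stream, map_add, smoothFn.add_apply, φ1, φ2]
    simp only [W, WavePotential.d1, WavePotential.d2]
    ring
  have hs : ∀ α, IsSmall fun n y => (W n α).d2 (W n α).stream y := fun α => by
    refine ((T α (0, η) (0, ξ) (0, ξ)).add (T α (0, η) (0, η) (0, η))).congr fun n _ y => ?_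
    simp only [WavePotential.stream, map_add, smoothFn.add_apply, φ1, φ2]
    simp only [W, WavePotential.d1, WavePotential.d2]
    ring
  have hm : ∀ α i, IsSmall fun n y =>
      (W n α).mom i y - χ y * Real.sin (n * φ y + α) * η i := fun α i => by
    refine (((hp α).const_mul (η i)).add ((hs α).const_mul (-ξ i))).congr fun n _ y => ?_
    simp only [WavePotential.mom, smoothFn.sub_apply, smoothFn.smul_apply, W]
    ring
  have hH : ∀ α, IsSmall fun n y => (W n α).corrH y := fun α => by
    refine ((hs α).const_mul (inner ℝ u ξ)).congr fun n _ y => ?_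
    simp only [WavePotential.corrH, smoothFn.smul_apply, W]
  have hE : ∀ α, IsSmall fun n y => (W n α).corrE y := fun α => by
    refine (((T α (0, ξ) (0, η) (1, u)).const_mul 2).add
      (((T α (0, ξ) (0, ξ) (0, η)).const_mul (-inner ℝ u ξ)).add
        ((T α (0, η) (0, η) (0, η)).const_mul (inner ℝ u ξ)))).congr fun n _ y => ?_
    simp only [WavePotential.corrE, smoothFn.sub_apply, smoothFn.smul_apply, φ1, φ2, φD]
    simp only [W, WavePotential.d1, WavePotential.d2, WavePotential.dD]
    ring
  have hB : ∀ α, IsSmall fun n y => (W n α).corrB y := fun α => by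
    refine ((T α (0, η) (0, η) (1, u)).add
      (((T α (0, ξ) (0, ξ) (1, u)).const_mul (-1)).add
        ((T α (0, ξ) (0, η) (0, η)).const_mul (-(2 * inner ℝ u ξ))))).congr fun n _ y => ?_
    simp only [WavePotential.corrB, smoothFn.sub_apply, smoothFn.smul_apply, φ1, φ2, φD]
    simp only [W, WavePotential.d1, WavePotential.d2, WavePotential.dD]
    ring
  refine ⟨φ, W, fun n α y hy => ?_, hm, fun α i j => ?_, fun α => ?_,
    ξ, fun n α => ⟨rfl, rfl⟩⟩
  · have : χ y = 0 := image_eq_zero_of_notMem_tsupport hy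
    simp only [W, smoothFn.smul_apply, oscFn_apply, this, zero_mul, mul_zero]
  · refine ((((hm α i).const_mul (u j)).add ((hm α j).const_mul (u i))).add
      ((((hH α).const_mul (ξ i * ξ j + η i * η j)).add
        ((hE α).const_mul (ξ i * ξ j - η i * η j))).add
        ((hB α).const_mul (ξ j * η i + η j * ξ i)))).congr fun n _ y => ?_
    simp only [WavePotential.flux, smoothFn.add_apply, smoothFn.sub_apply, smoothFn.smul_apply,
      symProd, Matrix.of_apply]
    simp only [W]
    ring
  · refine ((isSmall_second φ χ hχ (α - 3 * (Real.pi / 2)) (0, ξ) (0, ξ)).add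
      (isSmall_second φ χ hχ (α - 3 * (Real.pi / 2)) (0, η) (0, η))).congr fun n _ y => ?_
    simp only [WavePotential.stream, smoothFn.add_apply, W, WavePotential.d1, WavePotential.d2]

/-- The restriction of a space-time function to a time slice. -/
def slice (t : ℝ) (f : smoothFn (ℝ × Vec d)) : smoothFn (Vec d) :=
  ⟨fun x => f (t, x), (contDiff_smoothFn f).comp (contDiff_prodMk_right t)⟩

lemma pd_slice (t : ℝ) (f : smoothFn (ℝ × Vec d)) (v : Vec d) :
    pd v (slice t f) = slice t (pd ((0, v) : ℝ × Vec d) f) := by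
  ext x
  change fderiv ℝ (fun x => f (t, x)) x v = fderiv ℝ f (t, x) (0, v)
  have h1 : HasFDerivAt (fun x : Vec d => ((t, x) : ℝ × Vec d))
      (ContinuousLinearMap.inr ℝ ℝ (Vec d)) x := hasFDerivAt_prodMk_right t x
  have h2 : HasFDerivAt (fun x => f (t, x)) _ x :=
    (differentiable_smoothFn f (t, x)).hasFDerivAt.comp x h1
  rw [h2.fderiv]
  rfl

/-- Localised shear flows are small when tested with a fixed smooth function. -/
lemma WavePotential.integral_mom (W : WavePotential d) (H : Fin d → smoothFn (Vec d))
    (hH : ∀ i, HasCompactSupport (H i)) {ε : ℝ} (hε : ∀ y, |W.stream y| ≤ ε) (t : ℝ) :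
    |∑ i, ∫ x, H i x * W.mom i (t, x)|
      ≤ ε * ∑ i, (|W.η i| * ∫ x, |pd W.ξ (H i) x|) + ε * ∑ i, (|W.ξ i| * ∫ x, |pd W.η (H i) x|) := by
  have hc : ∀ i v, HasCompactSupport (pd v (H i)) := fun i v => by
    refine HasCompactSupport.of_support_subset_isCompact (hH i).isCompact ?_
    intro y hy
    by_contra hc
    exact hy (pd_eq_zero_off (isClosed_tsupport (H i).1)
      (fun z hz => image_eq_zero_of_notMem_tsupport hz) v y hc)
  have hb : ∀ i v, |∫ x, pd v (H i) x * slice t W.stream x| ≤ ε * ∫ x, |pd v (H i) x| := by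
    intro i v
    rw [← integral_const_mul]
    refine (abs_integral_le_integral_abs).trans (integral_mono_of_nonneg
      (Eventually.of_forall fun x => abs_nonneg _) ?_ (Eventually.of_forall fun x => ?_))
    · exact (((continuous_smoothFn (pd v (H i))).integrable_of_hasCompactSupport
        (hc i v)).abs).const_mul ε
    · simp only [abs_mul]
      rw [mul_comm]
      exact mul_le_mul_of_nonneg_right (hε (t, x)) (abs_nonneg _)
  -- The momentum consists of purely spatial first derivatives of the stream function. Integrating
  -- by parts on a time slice leaves only the small stream function, uniformly in t.
  have key : ∀ i, ∫ x, H i x * W.mom i (t, x)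
      = -(W.η i * ∫ x, pd W.ξ (H i) x * slice t W.stream x)
        + W.ξ i * ∫ x, pd W.η (H i) x * slice t W.stream x := by
    intro i
    have e1 := integral_mul_pd volume W.ξ (H i) (slice t W.stream) (hH i)
    have e2 := integral_mul_pd volume W.η (H i) (slice t W.stream) (hH i)
    have i1 : Integrable fun x => H i x * pd W.ξ (slice t W.stream) x :=
      ((continuous_smoothFn (H i)).mul (continuous_smoothFn _)).integrable_of_hasCompactSupport
        (hH i).mul_right
    have i2 : Integrable fun x => H i x * pd W.η (slice t W.stream) x :=
      ((continuous_smoothFn (H i)).mul (continuous_smoothFn _)).integrable_of_hasCompactSupport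
        (hH i).mul_right
    have : ∀ x, H i x * W.mom i (t, x) = W.η i * (H i x * pd W.ξ (slice t W.stream) x)
        - W.ξ i * (H i x * pd W.η (slice t W.stream) x) := by
      intro x
      simp only [pd_slice, WavePotential.mom, smoothFn.sub_apply, smoothFn.smul_apply]
      change _ = W.η i * (H i x * W.d1 W.stream (t, x)) - W.ξ i * (H i x * W.d2 W.stream (t, x))
      ring
    simp only [this]
    rw [integral_sub (i1.const_mul _) (i2.const_mul _), integral_const_mul, integral_const_mul,
      e1, e2]
    ring
  simp only [key]
  rw [Finset.sum_add_distrib, Finset.mul_sum, Finset.mul_sum]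
  refine (abs_add_le _ _).trans (add_le_add ?_ ?_) <;>
    refine (Finset.abs_sum_le_sum_abs _ _).trans (Finset.sum_le_sum fun i _ => ?_)
  · rw [abs_neg, abs_mul, mul_left_comm]
    exact mul_le_mul_of_nonneg_left (hb i _) (abs_nonneg _)
  · rw [abs_mul, mul_left_comm]
    exact mul_le_mul_of_nonneg_left (hb i _) (abs_nonneg _)

/-- Localised shear flows satisfy the homogeneous mass equation in the sense of distributions. -/
lemma WavePotential.integral_mass (W : WavePotential d) (hΦ : HasCompactSupport W.Φ)
    (g : smoothFn (ℝ × Vec d)) : ∫ y, ∑ j, W.mom j y * pd (spaceDir j) g y = 0 := by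
  have hoff := W.off_d (isClosed_tsupport W.Φ.1) (fun y hy => image_eq_zero_of_notMem_tsupport hy)
  have hm : ∀ i, HasCompactSupport (W.mom i) := fun i =>
    HasCompactSupport.intro hΦ.isCompact fun y hy => (hoff y hy).1 i
  have hint : ∀ j f, Integrable fun y => W.mom j y * (f : smoothFn (ℝ × Vec d)) y := fun j f =>
    ((continuous_smoothFn _).mul (continuous_smoothFn f)).integrable_of_hasCompactSupport
      (hm j).mul_right
  have hm' : ∀ j v, HasCompactSupport (pd v (W.mom j)) := fun j v =>
    HasCompactSupport.intro (hm j).isCompact fun y hy => pd_eq_zero_off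
      (isClosed_tsupport _) (fun z hz => image_eq_zero_of_notMem_tsupport hz) v y hy
  rw [integral_finsetSum _ fun j _ => hint j _]
  simp only [integral_mul_pd volume _ _ _ (hm _)]
  have hint' : ∀ j, Integrable fun y => pd (spaceDir j) (W.mom j) y * g y := fun j =>
    ((continuous_smoothFn (pd (spaceDir j) (W.mom j))).mul
      (continuous_smoothFn g)).integrable_of_hasCompactSupport (hm' j _).mul_right
  rw [Finset.sum_neg_distrib, ← integral_finsetSum _ fun j _ => hint' j]
  simp only [← Finset.sum_mul, ← smoothFn.sum_apply, W.sum_spaceDir_mom]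
  simp

/-- Localised shear flows satisfy the homogeneous momentum equation in the sense of
distributions. -/
lemma WavePotential.integral_momentum (W : WavePotential d) (hΦ : HasCompactSupport W.Φ)
    (g : smoothFn (ℝ × Vec d)) (i : Fin d) :
    ∫ y, (W.mom i y * pd (timeDir d) g y + ∑ j, W.flux i j y * pd (spaceDir j) g y) = 0 := by
  have hoff := W.off_d (isClosed_tsupport W.Φ.1) (fun y hy => image_eq_zero_of_notMem_tsupport hy)
  have hm : HasCompactSupport (W.mom i) :=
    HasCompactSupport.intro hΦ.isCompact fun y hy => (hoff y hy).1 i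
  have hf : ∀ j, HasCompactSupport (W.flux i j) := fun j =>
    HasCompactSupport.intro hΦ.isCompact fun y hy => (hoff y hy).2 i j
  have hd : ∀ f : smoothFn (ℝ × Vec d), HasCompactSupport f → ∀ v, HasCompactSupport (pd v f) :=
    fun f hf v => HasCompactSupport.intro hf.isCompact fun y hy => pd_eq_zero_off
      (isClosed_tsupport _) (fun z hz => image_eq_zero_of_notMem_tsupport hz) v y hy
  have hint : ∀ f : smoothFn (ℝ × Vec d), HasCompactSupport f → ∀ h : smoothFn (ℝ × Vec d),
      Integrable fun y => f y * h y := fun f hf h =>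
    ((continuous_smoothFn _).mul (continuous_smoothFn h)).integrable_of_hasCompactSupport
      hf.mul_right
  rw [integral_add (hint _ hm _) (integrable_finsetSum _ fun j _ => hint _ (hf j) _),
    integral_finsetSum _ fun j _ => hint _ (hf j) _, integral_mul_pd volume _ _ _ hm]
  simp only [integral_mul_pd volume _ _ _ (hf _)]
  rw [Finset.sum_neg_distrib, ← integral_finsetSum _ fun j _ => hint _ (hd _ (hf j) _) g,
    ← neg_add, ← integral_add (hint _ (hd _ hm _) g)
      (integrable_finsetSum _ fun j _ => hint _ (hd _ (hf j) _) g)]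
  simp only [← Finset.sum_mul, ← add_mul, ← smoothFn.sum_apply, ← smoothFn.add_apply,
    W.momentum_eq i]
  simp

end Wave

/-! ### Space domains that are locally Euclidean through `π` -/

/-- The map `π` is locally an isomorphism of measure spaces and topological spaces, on balls of
radius `1 / 4`. -/
structure IsLocalModel {d : ℕ} {G : Type} [AddCommGroup G] [TopologicalSpace G] [MeasureSpace G]
    (π : Vec d →+ G) : Prop where
  continuous : Continuous π
  isOpenMap : IsOpenMap π
  surjective : Function.Surjective π
  injOn : ∀ x, InjOn π (Metric.ball x (1 / 4))
  measurePreserving : ∀ x, MeasurePreserving π (volume.restrict (Metric.ball x (1 / 4)))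
    (volume.restrict (π '' Metric.ball x (1 / 4)))

lemma isLocalModel_id (d : ℕ) : IsLocalModel (AddMonoidHom.id (Vec d)) where
  continuous := continuous_id
  isOpenMap := IsOpenMap.id
  surjective := Function.surjective_id
  injOn x := Function.injective_id.injOn
  measurePreserving x := by
    simpa using MeasurePreserving.id (volume.restrict (Metric.ball x (1 / 4)))

lemma continuous_torusMap (d : ℕ) : Continuous (torusMap d) :=
  continuous_pi fun i => (AddCircle.continuous_mk' (1 : ℝ)).comp (by fun_prop)

lemma isOpenMap_torusMap (d : ℕ) : IsOpenMap (torusMap d) := by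
  have h1 : IsOpenMap (Pi.map fun (_ : Fin d) (s : ℝ) => (s : UnitAddCircle)) :=
    IsOpenMap.piMap (fun _ => QuotientAddGroup.isOpenMap_coe)
      (Eventually.of_forall fun _ => QuotientAddGroup.mk_surjective)
  exact h1.comp (PiLp.homeomorph 2 (fun _ : Fin d => ℝ)).isOpenMap

lemma injOn_torusMap {d : ℕ} (a : Fin d → ℝ) :
    InjOn (torusMap d) {y : Vec d | ∀ i, y i ∈ Ioc (a i) (a i + 1)} := by
  intro x hx y hy h
  ext i
  simp only [mem_ofPred_eq] at hx hy
  exact (AddCircle.coe_eq_coe_iff_of_mem_Ioc (hx i) (hy i)).1 (congrFun h i)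

lemma measurePreserving_torusMap {d : ℕ} (a : Fin d → ℝ) :
    MeasurePreserving (torusMap d)
      (volume.restrict {y : Vec d | ∀ i, y i ∈ Ioc (a i) (a i + 1)}) volume := by
  have h1 : MeasurePreserving (fun (x : Fin d → ℝ) (i : Fin d) => (x i : UnitAddCircle))
      (Measure.pi fun i => volume.restrict (Ioc (a i) (a i + 1)))
      (volume : Measure (UnitAddTorus (Fin d))) :=
    measurePreserving_pi (f := fun _ (s : ℝ) => (s : UnitAddCircle)) _ _
      (fun i => UnitAddCircle.measurePreserving_mk (a i))
  rw [← Measure.restrict_pi_pi] at h1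
  have h2 := (PiLp.volume_preserving_ofLp (Fin d)).restrict_preimage
    (s := univ.pi fun i => Ioc (a i) (a i + 1))
    (MeasurableSet.univ_pi fun i => measurableSet_Ioc)
  have hs : {y : Vec d | ∀ i, y i ∈ Ioc (a i) (a i + 1)}
      = WithLp.ofLp ⁻¹' univ.pi fun i => Ioc (a i) (a i + 1) := by
    ext y
    simp
  rw [hs]
  exact h1.comp h2

/-- The centred half-open cube of side one is a fundamental domain of the torus; any radius up to
1/2 would fit. -/
lemma ball_subset_cube {d : ℕ} (x : Vec d) : Metric.ball x (1 / 4)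
    ⊆ {y : Vec d | ∀ i, y i ∈ Ioc (x i - 1 / 2) (x i - 1 / 2 + 1)} := by
  intro y hy
  simp only [mem_ofPred_eq]
  intro i
  have h1 : |y i - x i| ≤ dist y x := by
    rw [dist_eq_norm]; simpa using PiLp.norm_apply_le (y - x) i
  have h2 := abs_lt.1 (lt_of_le_of_lt h1 (Metric.mem_ball.1 hy))
  constructor <;> linarith [h2.1, h2.2]

lemma isLocalModel_torus (d : ℕ) : IsLocalModel (torusMap d) where
  continuous := continuous_torusMap d
  isOpenMap := isOpenMap_torusMap d
  surjective x := by
    choose y hy using fun i => QuotientAddGroup.mk_surjective (x i)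
    exact ⟨WithLp.toLp 2 y, funext hy⟩
  injOn x := (injOn_torusMap fun i => x i - 1 / 2).mono (ball_subset_cube x)
  measurePreserving x := by
    have hsub := ball_subset_cube x
    have hopen := isOpenMap_torusMap d _ (Metric.isOpen_ball (x := x) (ε := 1 / 4))
    have h := (measurePreserving_torusMap fun i => x i - 1 / 2).restrict_preimage
      hopen.measurableSet
    rw [Measure.restrict_restrict ((continuous_torusMap d).measurable hopen.measurableSet)] at h
    rwa [(injOn_torusMap fun i => x i - 1 / 2).preimage_image_inter hsub] at h

/-! ### Transport of functions and integrals between a Euclidean chart and the space domain -/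

section Push

variable {d : ℕ} {G : Type} [AddCommGroup G] [TopologicalSpace G] [MeasureSpace G]

/-- The space-time version of `π`. -/
def lift (π : Vec d →+ G) (y : ℝ × Vec d) : ℝ × G := (y.1, π y.2)

/-- The cylinder over a ball of radius `1 / 4`. -/
def cyl (x₀ : Vec d) : Set (ℝ × Vec d) := univ ×ˢ Metric.ball x₀ (1 / 4)

lemma isOpen_cyl (x₀ : Vec d) : IsOpen (cyl x₀) := isOpen_univ.prod Metric.isOpen_ball

open Classical in
/-- The function on `ℝ × G` that corresponds to a function supported in the cylinder over the
ball around `x₀`. -/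
def push {F : Type*} [Zero F] (π : Vec d →+ G) (x₀ : Vec d) (f : ℝ × Vec d → F) (t : ℝ) (x : G) :
    F :=
  if h : ∃ y ∈ Metric.ball x₀ (1 / 4), π y = x then f (t, h.choose) else 0

variable {π : Vec d →+ G} (hπ : IsLocalModel π)

include hπ in
lemma continuous_lift : Continuous (lift π) :=
  continuous_fst.prodMk (hπ.continuous.comp continuous_snd)

include hπ in
lemma isOpenMap_lift : IsOpenMap (lift π) := IsOpenMap.id.prodMap hπ.isOpenMap

include hπ in
lemma surjective_lift : Function.Surjective (lift π) := fun ⟨t, x⟩ => by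
  obtain ⟨y, rfl⟩ := hπ.surjective x
  exact ⟨(t, y), rfl⟩

include hπ in
lemma injOn_lift (x₀ : Vec d) : InjOn (lift π) (cyl x₀) := by
  rintro ⟨t, x⟩ hx ⟨s, y⟩ hy h
  simp only [lift, Prod.mk.injEq] at h
  exact Prod.ext h.1 (hπ.injOn x₀ hx.2 hy.2 h.2)

include hπ in
lemma push_lift {F : Type*} [Zero F] {x₀ : Vec d} (f : ℝ × Vec d → F) {y : ℝ × Vec d}
    (hy : y ∈ cyl x₀) : push π x₀ f (lift π y).1 (lift π y).2 = f y := by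
  have h : ∃ z ∈ Metric.ball x₀ (1 / 4), π z = (lift π y).2 := ⟨y.2, hy.2, rfl⟩
  rw [push, dif_pos h]
  exact congrArg f (Prod.ext rfl (hπ.injOn x₀ h.choose_spec.1 hy.2 h.choose_spec.2))

lemma push_eq_zero {F : Type*} [Zero F] {x₀ : Vec d} {f : ℝ × Vec d → F} {K : Set (ℝ × Vec d)}
    (hf : ∀ y ∉ K, f y = 0) {q : ℝ × G} (hq : q ∉ lift π '' K) :
    push π x₀ f q.1 q.2 = 0 := by
  unfold push
  split_ifs with h
  · refine hf _ fun hc => hq ⟨_, hc, ?_⟩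
    exact Prod.ext rfl h.choose_spec.2
  · rfl

-- At a point of the image of K, continuity is inherited from the chart because π is open. Elsewhere
-- the function vanishes nearby, the image of K being compact and hence closed.
include hπ in
lemma continuous_push [T2Space G] {F : Type*} [Zero F] [TopologicalSpace F] {x₀ : Vec d}
    {f : ℝ × Vec d → F} (hfc : Continuous f) {K : Set (ℝ × Vec d)} (hK : IsCompact K)
    (hKx : K ⊆ cyl x₀) (hf : ∀ y ∉ K, f y = 0) :
    Continuous fun q : ℝ × G => push π x₀ f q.1 q.2 := by
  rw [continuous_iff_continuousAt]
  intro q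
  by_cases hq : q ∈ lift π '' K
  · obtain ⟨y, hy, rfl⟩ := hq
    have h1 : Tendsto (fun z => push π x₀ f (lift π z).1 (lift π z).2) (𝓝 y) (𝓝 (f y)) := by
      refine Tendsto.congr' ?_ hfc.continuousAt
      filter_upwards [(isOpen_cyl x₀).mem_nhds (hKx hy)] with z hz using (push_lift hπ f hz).symm
    have h2 : (fun q : ℝ × G => push π x₀ f q.1 q.2) (lift π y) = f y := push_lift hπ f (hKx hy)
    unfold ContinuousAt
    rw [h2]
    exact (tendsto_map'_iff.2 h1).mono_left ((isOpenMap_lift hπ).nhds_le y)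
  · have hcl : IsClosed (lift π '' K) := (hK.image (continuous_lift hπ)).isClosed
    refine ContinuousAt.congr (f := fun _ => 0) continuousAt_const ?_
    filter_upwards [hcl.isOpen_compl.mem_nhds hq] with z hz using (push_eq_zero hf hz).symm

variable [BorelSpace G] [SecondCountableTopology G] [SFinite (volume : Measure G)]

include hπ in
lemma measurePreserving_lift (x₀ : Vec d) :
    MeasurePreserving (lift π) ((volume : Measure (ℝ × Vec d)).restrict (cyl x₀))
      ((volume : Measure (ℝ × G)).restrict (lift π '' cyl x₀)) := by
  have h := (MeasurePreserving.id (volume : Measure ℝ)).prod (hπ.measurePreserving x₀)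
  have e : lift π '' cyl x₀ = univ ×ˢ (π '' Metric.ball x₀ (1 / 4)) := by
    ext q
    constructor
    · rintro ⟨y, hy, rfl⟩
      exact ⟨mem_univ _, y.2, hy.2, rfl⟩
    · rintro ⟨-, y, hy, h⟩
      exact ⟨(q.1, y), ⟨mem_univ _, hy⟩, Prod.ext rfl h⟩
  have e1 : (volume : Measure (ℝ × Vec d)).restrict (cyl x₀)
      = (volume : Measure ℝ).prod (volume.restrict (Metric.ball x₀ (1 / 4))) := by
    rw [cyl, Measure.volume_eq_prod, ← Measure.prod_restrict, Measure.restrict_univ]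
  have e2 : (volume : Measure (ℝ × G)).restrict (lift π '' cyl x₀)
      = (volume : Measure ℝ).prod (volume.restrict (π '' Metric.ball x₀ (1 / 4))) := by
    rw [e, Measure.volume_eq_prod, ← Measure.prod_restrict, Measure.restrict_univ]
  rw [e1, e2]
  exact h

include hπ in
lemma measurableEmbedding_lift (x₀ : Vec d) :
    MeasurableEmbedding fun y : cyl (d := d) x₀ => lift π y := by
  refine (Topology.IsOpenEmbedding.of_continuous_injective_isOpenMap
    ((continuous_lift hπ).comp continuous_subtype_val) ?_ ?_).measurableEmbedding
  · intro y z h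
    exact Subtype.ext (injOn_lift hπ x₀ y.2 z.2 h)
  · exact (isOpenMap_lift hπ).comp (isOpen_cyl x₀).isOpenMap_subtype_val

include hπ in
lemma measurePreserving_lift_subtype (x₀ : Vec d) :
    MeasurePreserving (fun y : cyl (d := d) x₀ => lift π y)
      ((volume : Measure (ℝ × Vec d)).comap Subtype.val)
      ((volume : Measure (ℝ × G)).restrict (lift π '' cyl x₀)) := by
  have h : MeasurePreserving (Subtype.val : cyl (d := d) x₀ → ℝ × Vec d)
      ((volume : Measure (ℝ × Vec d)).comap Subtype.val)
      ((volume : Measure (ℝ × Vec d)).restrict (cyl x₀)) :=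
    ⟨measurable_subtype_coe, map_comap_subtype_coe (isOpen_cyl x₀).measurableSet _⟩
  exact (measurePreserving_lift hπ x₀).comp h

include hπ in
lemma measurableSet_lift_image {x₀ : Vec d} {S : Set (ℝ × Vec d)} (hS : MeasurableSet S)
    (hSx : S ⊆ cyl x₀) : MeasurableSet (lift π '' S) := by
  have h := (measurableEmbedding_lift hπ x₀).measurableSet_image'
    (measurable_subtype_coe hS)
  convert h using 1
  ext q
  constructor
  · rintro ⟨y, hy, rfl⟩
    exact ⟨⟨y, hSx hy⟩, hy, rfl⟩
  · rintro ⟨y, hy, rfl⟩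
    exact ⟨y, hy, rfl⟩

-- On the cylinder the lift is a measure-preserving measurable embedding, so the change of variables
-- holds for every integrand, measurable or not.
include hπ in
lemma setIntegral_lift {F : Type*} [NormedAddCommGroup F] [NormedSpace ℝ F] {x₀ : Vec d}
    {S : Set (ℝ × Vec d)} (hS : MeasurableSet S) (hSx : S ⊆ cyl x₀) (g : ℝ × G → F) :
    ∫ q in lift π '' S, g q = ∫ y in S, g (lift π y) := by
  have hU := (isOpen_cyl x₀).measurableSet (α := ℝ × Vec d)
  have hm := measurableSet_lift_image hπ hS hSx
  have key : ∀ h : ℝ × G → F, ∫ q in lift π '' cyl x₀, h q = ∫ y in cyl x₀, h (lift π y) := by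
    intro h
    rw [← (measurePreserving_lift_subtype hπ x₀).integral_comp (measurableEmbedding_lift hπ x₀),
      ← integral_subtype_comap hU]
  have h1 := key ((lift π '' S).indicator g)
  rw [setIntegral_indicator hm, inter_eq_right.2 (image_mono hSx)] at h1
  have h2 : ∀ y ∈ cyl x₀, (lift π '' S).indicator g (lift π y)
      = S.indicator (fun y => g (lift π y)) y := by
    intro y hy
    by_cases hyS : y ∈ S
    · rw [indicator_of_mem (mem_image_of_mem _ hyS), indicator_of_mem hyS]
    · rw [indicator_of_notMem, indicator_of_notMem hyS]
      rintro ⟨z, hz, hzy⟩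
      exact hyS (injOn_lift hπ x₀ (hSx hz) hy hzy ▸ hz)
  rw [h1, setIntegral_congr_fun hU h2, setIntegral_indicator hS, inter_eq_right.2 hSx]

include hπ in
lemma volume_lift_image {x₀ : Vec d} {S : Set (ℝ × Vec d)} (hS : MeasurableSet S)
    (hSx : S ⊆ cyl x₀) : volume (lift π '' S) = volume S := by
  have h := (measurePreserving_lift hπ x₀).measure_preimage
    (measurableSet_lift_image hπ hS hSx).nullMeasurableSet
  rw [Measure.restrict_apply (measurableSet_lift_image hπ hS hSx),
    inter_eq_left.2 (image_mono hSx), Measure.restrict_apply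
      ((continuous_lift hπ).measurable (measurableSet_lift_image hπ hS hSx)),
    (injOn_lift hπ x₀).preimage_image_inter hSx] at h
  exact h.symm

/-! ### Test functions -/

/-- The pull-back of a test function to Euclidean space. -/
def IsTestFunction.pull {T : ℝ} {φ : ℝ → G → ℝ} (hφ : IsTestFunction π T φ) :
    smoothFn (ℝ × Vec d) :=
  ⟨fun q => φ q.1 (π q.2), hφ.smooth⟩

lemma dt_lift {T : ℝ} {φ : ℝ → G → ℝ} (hφ : IsTestFunction π T φ) (y : ℝ × Vec d) :
    dt φ (lift π y).1 (lift π y).2 = pd (timeDir d) hφ.pull y := by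
  have h1 : HasDerivAt (fun s : ℝ => ((s, y.2) : ℝ × Vec d)) (1, 0) y.1 :=
    (hasDerivAt_id y.1).prodMk (hasDerivAt_const _ _)
  have h2 := ((differentiable_smoothFn hφ.pull y).hasFDerivAt.comp_hasDerivAt y.1 h1)
  exact h2.deriv

/-- Additivity of π turns a translation in G into a translation of the argument upstairs. -/
lemma dx_lift {T : ℝ} {φ : ℝ → G → ℝ} (hφ : IsTestFunction π T φ) (j : Fin d) (y : ℝ × Vec d) :
    dx π φ j (lift π y).1 (lift π y).2 = pd (spaceDir j) hφ.pull y := by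
  have h1 : HasDerivAt (fun s : ℝ => ((y.1, y.2 + s • EuclideanSpace.single j 1) : ℝ × Vec d))
      (spaceDir j) 0 := by
    refine (hasDerivAt_const _ _).prodMk ?_
    simpa using ((hasDerivAt_id (0 : ℝ)).smul_const (EuclideanSpace.single j (1 : ℝ))).const_add y.2
  have h0 : ((y.1, y.2 + (0 : ℝ) • EuclideanSpace.single j 1) : ℝ × Vec d) = y := by simp
  have h2 := (differentiable_smoothFn hφ.pull y).hasFDerivAt
  rw [← h0] at h2
  have h3 := (h2.comp_hasDerivAt (0 : ℝ) h1).deriv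
  rw [h0] at h3
  rw [pd_apply, ← h3]
  simp only [dx, lift, IsTestFunction.pull, ← map_add]
  rfl

-- The lift is an open surjection, hence a quotient map, so continuity may be checked after pulling
-- back.
include hπ in
lemma continuous_dt {T : ℝ} {φ : ℝ → G → ℝ} (hφ : IsTestFunction π T φ) :
    Continuous fun q : ℝ × G => dt φ q.1 q.2 := by
  rw [((isOpenMap_lift hπ).isQuotientMap (continuous_lift hπ) (surjective_lift hπ)).continuous_iff]
  exact (continuous_smoothFn (pd (timeDir d) hφ.pull)).congr fun y => (dt_lift hφ y).symm

include hπ in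
lemma continuous_dx {T : ℝ} {φ : ℝ → G → ℝ} (hφ : IsTestFunction π T φ) (j : Fin d) :
    Continuous fun q : ℝ × G => dx π φ j q.1 q.2 := by
  rw [((isOpenMap_lift hπ).isQuotientMap (continuous_lift hπ) (surjective_lift hπ)).continuous_iff]
  exact (continuous_smoothFn (pd (spaceDir j) hφ.pull)).congr fun y => (dx_lift hφ j y).symm

lemma pull_eq_zero_off {T : ℝ} {φ : ℝ → G → ℝ} (hφ : IsTestFunction π T φ) (y : ℝ × Vec d)
    (hy : y ∉ lift π ⁻¹' tsupport fun q : ℝ × G => φ q.1 q.2) : hφ.pull y = 0 :=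
  image_eq_zero_of_notMem_tsupport (f := fun q : ℝ × G => φ q.1 q.2) hy

include hπ in
lemma dt_eq_zero_off {T : ℝ} {φ : ℝ → G → ℝ} (hφ : IsTestFunction π T φ) {q : ℝ × G}
    (hq : q ∉ tsupport fun q : ℝ × G => φ q.1 q.2) : dt φ q.1 q.2 = 0 := by
  obtain ⟨y, rfl⟩ := surjective_lift hπ q
  rw [dt_lift hφ]
  exact pd_eq_zero_off ((isClosed_tsupport _).preimage (continuous_lift hπ))
    (pull_eq_zero_off hφ) _ y hq

include hπ in
lemma dx_eq_zero_off {T : ℝ} {φ : ℝ → G → ℝ} (hφ : IsTestFunction π T φ) (j : Fin d) {q : ℝ × G}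
    (hq : q ∉ tsupport fun q : ℝ × G => φ q.1 q.2) : dx π φ j q.1 q.2 = 0 := by
  obtain ⟨y, rfl⟩ := surjective_lift hπ q
  rw [dx_lift hφ]
  exact pd_eq_zero_off ((isClosed_tsupport _).preimage (continuous_lift hπ))
    (pull_eq_zero_off hφ) _ y hq

/-! ### Transplanted shear flows solve the homogeneous system -/

include hπ in
lemma integral_slab_eq_of_support {T : ℝ} {x₀ : Vec d} {K : Set (ℝ × Vec d)}
    (hKx : K ⊆ cyl x₀) (hKT : K ⊆ Ioo 0 T ×ˢ univ) {F : ℝ × G → ℝ}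
    (hF : ∀ q ∉ lift π '' K, F q = 0) :
    ∫ q in slab T G, F q = ∫ y in cyl x₀, F (lift π y) := by
  rw [setIntegral_eq_integral_of_forall_compl_eq_zero fun q hq => hF q fun hc => hq ?_,
    ← setIntegral_lift hπ (isOpen_cyl x₀).measurableSet subset_rfl,
    setIntegral_eq_integral_of_forall_compl_eq_zero fun q hq => hF q fun hc =>
      hq (image_mono hKx hc)]
  obtain ⟨y, hy, rfl⟩ := hc
  exact ⟨(hKT hy).1, mem_univ _⟩

include hπ in
lemma integral_push_mass {T : ℝ} {x₀ : Vec d} {K : Set (ℝ × Vec d)}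
    (hK : IsCompact K) (hKx : K ⊆ cyl x₀) (hKT : K ⊆ Ioo 0 T ×ˢ univ) (W : WavePotential d)
    (hW : ∀ y ∉ K, W.Φ y = 0) {φ : ℝ → G → ℝ} (hφ : IsTestFunction π T φ) :
    ∫ q in slab T G, ∑ j, push π x₀ (W.mom j) q.1 q.2 * dx π φ j q.1 q.2 = 0 := by
  have hoff := W.off_d hK.isClosed hW
  have hm : ∀ q ∉ lift π '' K, ∀ j, push π x₀ (W.mom j) q.1 q.2 = 0 := fun q hq j =>
    push_eq_zero (fun y hy => (hoff y hy).1 j) hq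
  rw [integral_slab_eq_of_support hπ hKx hKT fun q hq => by simp [hm q hq],
    ← W.integral_mass (HasCompactSupport.intro hK hW) hφ.pull]
  refine (setIntegral_congr_fun (isOpen_cyl x₀).measurableSet fun y hy => ?_).trans
    (setIntegral_eq_integral_of_forall_compl_eq_zero fun y hy => by
      simp [(hoff y fun hc => hy (hKx hc)).1])
  simp only [push_lift hπ _ hy, dx_lift hφ]

include hπ in
lemma integral_push_momentum {T : ℝ} {x₀ : Vec d} {K : Set (ℝ × Vec d)}
    (hK : IsCompact K) (hKx : K ⊆ cyl x₀) (hKT : K ⊆ Ioo 0 T ×ˢ univ) (W : WavePotential d)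
    (hW : ∀ y ∉ K, W.Φ y = 0) {φ : ℝ → G → ℝ} (hφ : IsTestFunction π T φ) (i : Fin d) :
    ∫ q in slab T G, (push π x₀ (W.mom i) q.1 q.2 * dt φ q.1 q.2
      + ∑ j, push π x₀ (W.flux i j) q.1 q.2 * dx π φ j q.1 q.2) = 0 := by
  have hoff := W.off_d hK.isClosed hW
  have hm : ∀ q ∉ lift π '' K, ∀ j, push π x₀ (W.mom j) q.1 q.2 = 0 := fun q hq j =>
    push_eq_zero (fun y hy => (hoff y hy).1 j) hq
  have hf : ∀ q ∉ lift π '' K, ∀ j, push π x₀ (W.flux i j) q.1 q.2 = 0 := fun q hq j =>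
    push_eq_zero (fun y hy => (hoff y hy).2 i j) hq
  rw [integral_slab_eq_of_support hπ hKx hKT fun q hq => by simp [hm q hq, hf q hq],
    ← W.integral_momentum (HasCompactSupport.intro hK hW) hφ.pull i]
  refine (setIntegral_congr_fun (isOpen_cyl x₀).measurableSet fun y hy => ?_).trans
    (setIntegral_eq_integral_of_forall_compl_eq_zero fun y hy => by
      simp [(hoff y fun hc => hy (hKx hc)).1, (hoff y fun hc => hy (hKx hc)).2])
  simp only [push_lift hπ _ hy, dx_lift hφ, dt_lift hφ]

end Push

/-! ### Weakly continuous paths in L^p -/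

section Paths

variable {E : Type} [NormedAddCommGroup E] [InnerProductSpace ℝ E] [FiniteDimensional ℝ E]
variable {G : Type} [MeasureSpace G]
variable {p : ℝ≥0∞} [hp : Fact (1 ≤ p)] {T : ℝ}

/-- Weakly continuous paths in `L^p`. -/
abbrev WPath (E : Type) [NormedAddCommGroup E] [InnerProductSpace ℝ E] (G : Type) [MeasureSpace G]
    (p : ℝ≥0∞) [Fact (1 ≤ p)] (T : ℝ) :=
  C(Icc (0 : ℝ) T, WeakSpace ℝ (Lp E p (volume : Measure G)))

/-- The value of a path at time `t`. -/
def pathFn (u : WPath E G p T) (t : Icc (0 : ℝ) T) : Lp E p (volume : Measure G) :=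
  (toWeakSpace ℝ (Lp E p (volume : Measure G))).symm (u t)

omit [FiniteDimensional ℝ E] in
lemma continuous_eval_dual (l : StrongDual ℝ (Lp E p (volume : Measure G))) :
    Continuous fun x : WPath E G p T × Icc (0 : ℝ) T => l (pathFn x.1 x.2) := by
  have h1 : Continuous fun v : WeakSpace ℝ (Lp E p (volume : Measure G)) =>
      l ((toWeakSpace ℝ (Lp E p (volume : Measure G))).symm v) :=
    WeakBilin.eval_continuous (topDualPairing ℝ (Lp E p (volume : Measure G))).flip l
  exact h1.comp continuous_eval

lemma memLp_of_bounded_of_support {q : ℝ≥0∞} {ψ : G → E} (hm : AEStronglyMeasurable ψ) {C : ℝ}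
    (hC : ∀ x, ‖ψ x‖ ≤ C) {S : Set G} (hS : MeasurableSet S) (hS' : volume S ≠ ⊤)
    (h0 : ∀ x ∉ S, ψ x = 0) : MemLp ψ q := by
  have : S.indicator ψ = ψ := indicator_eq_self.2 fun x hx => by
    by_contra hc
    exact hx (h0 x hc)
  rw [← this, memLp_indicator_iff_restrict hS]
  have : IsFiniteMeasure (volume.restrict S) := ⟨by simpa using hS'.lt_top⟩
  exact MemLp.of_bound hm.restrict C (Eventually.of_forall hC)

lemma exists_dual {ψ : G → E} (hψ : ∀ q : ℝ≥0∞, MemLp ψ q) :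
    ∃ l : StrongDual ℝ (Lp E p (volume : Measure G)), ∀ v, l v = ∫ x, inner ℝ (ψ x) (v x) := by
  have hq : Fact (1 ≤ p.conjExponent) := ⟨ENNReal.HolderConjugate.one_le p.conjExponent p⟩
  have : ENNReal.HolderConjugate p.conjExponent p := ENNReal.HolderConjugate.symm
  refine ⟨(innerSL ℝ (E := E)).lpPairing volume p.conjExponent p (hψ _).toLp, fun v => ?_⟩
  rw [ContinuousLinearMap.lpPairing_eq_integral]
  refine integral_congr_ae ?_
  filter_upwards [(hψ p.conjExponent).coeFn_toLp] with x hx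
  rw [hx]
  rfl

/-- A basic weak neighbourhood of zero involves only finitely many functionals; smallness of each of
them, uniform in time, suffices for convergence in the compact-open topology. -/
lemma tendsto_zero_path {v : ℕ → WPath E G p T}
    (h : ∀ l : StrongDual ℝ (Lp E p (volume : Measure G)), ∀ ε > 0, ∀ᶠ n in atTop, ∀ t,
      |l (pathFn (v n) t)| < ε) : Tendsto v atTop (𝓝 0) := by
  rw [ContinuousMap.tendsto_nhds_compactOpen]
  intro K _ U hU h0
  by_cases hK : K.Nonempty
  · obtain ⟨t, ht⟩ := hK
    have hU0 : U ∈ 𝓝 (0 : WeakSpace ℝ (Lp E p (volume : Measure G))) := hU.mem_nhds (h0 ht)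
    obtain ⟨V, hV, hVU⟩ := (LinearMap.hasBasis_weakBilin
      (topDualPairing ℝ (Lp E p (volume : Measure G))).flip).mem_iff.1 hU0
    obtain ⟨s, r, hr, rfl⟩ := (SeminormFamily.basisSets_iff _).1 hV
    have : ∀ᶠ n in atTop, ∀ l ∈ s, ∀ t, |l (pathFn (v n) t)| < r := by
      rw [eventually_all_finset]
      exact fun l _ => h l r hr
    filter_upwards [this] with n hn t _
    apply hVU
    refine (Seminorm.mem_ball_zero _).2 (Seminorm.finset_sup_apply_lt hr fun l hl => ?_)
    exact hn l hl t
  · rw [not_nonempty_iff_eq_empty] at hK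
    subst hK
    exact Eventually.of_forall fun n => mapsTo_empty _ _

variable [TopologicalSpace G] [BorelSpace G] [SecondCountableTopology G] [LocallyCompactSpace G]
  [T2Space G] [IsLocallyFiniteMeasure (volume : Measure G)]

lemma integrableOn_pathFn (v : Lp E p (volume : Measure G)) {D : Set G} (hD : IsCompact D) :
    IntegrableOn v D := by
  have : IsFiniteMeasure (volume.restrict D) := ⟨by simpa using hD.measure_lt_top⟩
  exact ((Lp.memLp v).restrict D).integrable hp.out

/-- The pairing of weakly continuous paths with a continuous field on a compact set, integrated
over time, is continuous on sets of paths that are bounded on the compact set. -/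
lemma continuousOn_pairing {D : Set G} (hD : IsCompact D) {a b : ℝ} (hT : 0 ≤ T) (hab : a ≤ b)
    (h0T : Icc a b ⊆ Icc 0 T)
    {g : ℝ → G → E} (hg : ContinuousOn (fun q : ℝ × G => g q.1 q.2) (Icc a b ×ˢ D))
    {S : Set (WPath E G p T)} {C : ℝ}
    (hS : ∀ u ∈ S, ∀ t : Icc (0 : ℝ) T, (t : ℝ) ∈ Icc a b → ∫ x in D, ‖pathFn u t x‖ ≤ C) :
    ContinuousOn (fun u => ∫ t in Icc a b, ∫ x in D,
      inner ℝ (g t x) (pathFn u (projIcc 0 T hT t) x)) S := by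
  have hDm : MeasurableSet D := hD.isClosed.measurableSet
  have hDf : volume D ≠ ⊤ := hD.measure_lt_top.ne
  let emb : Icc a b → Icc (0 : ℝ) T := fun t => ⟨t, h0T t.2⟩
  have hemb : Continuous emb := by fun_prop
  -- the inner integral
  let h : S × Icc a b → ℝ := fun z => ∫ x in D, inner ℝ (g z.2 x) (pathFn z.1.1 (emb z.2) x)
  have : CompactSpace D := isCompact_iff_compactSpace.1 hD
  have hgc : Continuous fun z : Icc a b × D => g z.1 z.2 := by
    refine hg.comp_continuous (f := fun z : Icc a b × D => ((z.1 : ℝ), (z.2 : G)))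
      (by fun_prop) fun z => ⟨z.1.2, z.2.2⟩
  -- Currying over the compact set D gives continuity of t ↦ g t in the supremum norm.
  have hsup : ∀ t₀ : Icc a b, ∀ ε > 0, ∀ᶠ t : Icc a b in 𝓝 t₀, ∀ x ∈ D, ‖g t x - g t₀ x‖ < ε := by
    intro t₀ ε hε
    let cg : C(Icc a b, C(D, E)) := ContinuousMap.curry ⟨fun z : Icc a b × D => g z.1 z.2, hgc⟩
    filter_upwards [Metric.tendsto_nhds.1 (cg.continuous.tendsto t₀) ε hε] with t ht x hx
    have := (ContinuousMap.dist_lt_iff hε).1 ht ⟨x, hx⟩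
    rwa [dist_eq_norm] at this
  have hgx : ∀ t : Icc a b, ContinuousOn (g t) D := fun t =>
    hg.comp (Continuous.prodMk_right (t : ℝ)).continuousOn fun x hx => ⟨t.2, hx⟩
  have hgb : ∀ t : Icc a b, ∃ C, ∀ x ∈ D, ‖g t x‖ ≤ C := fun t =>
    hD.exists_bound_of_continuousOn (hgx t)
  have hgm : ∀ t : Icc a b, AEStronglyMeasurable (g t) (volume.restrict D) := fun t =>
    (hgx t).aestronglyMeasurable hDm
  -- test functionals
  have hfun : ∀ t : Icc a b, ∃ l : StrongDual ℝ (Lp E p (volume : Measure G)),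
      ∀ v, l v = ∫ x in D, inner ℝ (g t x) (v x) := by
    intro t
    obtain ⟨B, hB⟩ := hgb t
    have hm : AEStronglyMeasurable (D.indicator (g t)) volume :=
      (aestronglyMeasurable_indicator_iff hDm).2 (hgm t)
    obtain ⟨l, hl⟩ := exists_dual (p := p) (ψ := D.indicator (g t)) fun q =>
      memLp_of_bounded_of_support hm (C := max B 0) (fun x => by
        by_cases hx : x ∈ D
        · rw [indicator_of_mem hx]; exact (hB x hx).trans (le_max_left _ _)
        · rw [indicator_of_notMem hx, norm_zero]; exact le_max_right _ _) hDm hDf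
        (fun x hx => indicator_of_notMem hx _)
    refine ⟨l, fun v => ?_⟩
    rw [hl, ← integral_indicator hDm]
    refine integral_congr_ae (Eventually.of_forall fun x => ?_)
    by_cases hx : x ∈ D <;> simp [hx]
  have hint : ∀ (t : Icc a b) (v : Lp E p (volume : Measure G)),
      IntegrableOn (fun x => inner ℝ (g t x) (v x)) D := by
    intro t v
    obtain ⟨B, hB⟩ := hgb t
    refine Integrable.mono' ((integrableOn_pathFn v hD).norm.const_mul B)
      ((hgm t).inner (integrableOn_pathFn v hD).aestronglyMeasurable) ?_
    filter_upwards [ae_restrict_mem hDm] with x hx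
    exact (norm_inner_le_norm _ _).trans (mul_le_mul_of_nonneg_right (hB x hx) (norm_nonneg _))
  -- Replacing g t by g t₀ costs at most the supremum of |g t - g t₀| on D times the L¹ bound on S.
  -- With the field frozen, the pairing is evaluation of one fixed functional, which is continuous
  -- in path and time jointly.
  have hcont : Continuous h := by
    rw [continuous_iff_continuousAt]
    rintro ⟨u₀, t₀⟩
    obtain ⟨l, hl⟩ := hfun t₀
    refine Metric.tendsto_nhds.2 fun ε hε => ?_
    have hC : 0 < |C| + 1 := by positivity
    have e1 : ∀ᶠ z : S × Icc a b in 𝓝 (u₀, t₀), ∀ x ∈ D,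
        ‖g z.2 x - g t₀ x‖ < ε / 2 / (|C| + 1) :=
      (continuous_snd.tendsto (u₀, t₀)).eventually (hsup t₀ _ (by positivity))
    have e2 : ∀ᶠ z : S × Icc a b in 𝓝 (u₀, t₀),
        dist (l (pathFn z.1.1 (emb z.2))) (l (pathFn u₀.1 (emb t₀))) < ε / 2 := by
      have hc : Continuous fun z : S × Icc a b => l (pathFn z.1.1 (emb z.2)) :=
        (continuous_eval_dual l).comp (by fun_prop :
          Continuous fun z : S × Icc a b => (z.1.1, emb z.2))
      exact Metric.tendsto_nhds.1 (hc.tendsto (u₀, t₀)) _ (by positivity)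
    filter_upwards [e1, e2] with z h1 h2
    have h3 : |h z - l (pathFn z.1.1 (emb z.2))| ≤ ε / 2 := by
      rw [hl, ← integral_sub (hint _ _) (hint _ _)]
      simp only [← inner_sub_left]
      calc |∫ x in D, inner ℝ (g z.2 x - g t₀ x) (pathFn z.1.1 (emb z.2) x)|
          ≤ ∫ x in D, ε / 2 / (|C| + 1) * ‖pathFn z.1.1 (emb z.2) x‖ := by
            rw [← Real.norm_eq_abs]
            refine norm_integral_le_of_norm_le
              ((integrableOn_pathFn (pathFn z.1.1 (emb z.2)) hD).norm.const_mul _) ?_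
            filter_upwards [ae_restrict_mem hDm] with x hx
            exact (norm_inner_le_norm _ _).trans
              (mul_le_mul_of_nonneg_right (h1 x hx).le (norm_nonneg _))
        _ = ε / 2 / (|C| + 1) * ∫ x in D, ‖pathFn z.1.1 (emb z.2) x‖ := integral_const_mul _ _
        _ ≤ ε / 2 / (|C| + 1) * (|C| + 1) := by
            refine mul_le_mul_of_nonneg_left ?_ (by positivity)
            have := hS z.1.1 z.1.2 (emb z.2) z.2.2
            linarith [le_abs_self C]
        _ = ε / 2 := by field_simp
    have h4 : h (u₀, t₀) = l (pathFn u₀.1 (emb t₀)) := (hl _).symm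
    rw [Real.dist_eq] at h2 ⊢
    rw [h4]
    calc |h z - l (pathFn u₀.1 (emb t₀))|
        ≤ |h z - l (pathFn z.1.1 (emb z.2))|
          + |l (pathFn z.1.1 (emb z.2)) - l (pathFn u₀.1 (emb t₀))| := abs_sub_le _ _ _
      _ < ε := by linarith
  -- integration in time
  let H : C(S, C(Icc a b, ℝ)) := ContinuousMap.curry ⟨h, hcont⟩
  have hI : Continuous fun f : C(Icc a b, ℝ) => ∫ t in Icc a b, f (projIcc a b hab t) := by
    refine (LipschitzWith.of_dist_le_mul (K := Real.toNNReal (b - a)) fun f₁ f₂ => ?_).continuous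
    have hi : ∀ f : C(Icc a b, ℝ), IntegrableOn (fun t => f (projIcc a b hab t)) (Icc a b) :=
      fun f => (f.continuous.comp continuous_projIcc).continuousOn.integrableOn_Icc
    rw [dist_eq_norm, ← integral_sub (hi f₁) (hi f₂)]
    have := norm_setIntegral_le_of_norm_le_const (μ := volume) (s := Icc a b) (C := dist f₁ f₂)
      (f := fun t => f₁ (projIcc a b hab t) - f₂ (projIcc a b hab t)) (by simp)
      fun t _ => by rw [← dist_eq_norm]; exact ContinuousMap.dist_apply_le_dist _
    refine this.trans (le_of_eq ?_)
    rw [mul_comm, Real.coe_toNNReal _ (by linarith)]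
    congr 1
    simp [Measure.real, ENNReal.toReal_ofReal (by linarith : 0 ≤ b - a)]
  rw [continuousOn_iff_continuous_domRestrict]
  refine (hI.comp H.continuous).congr fun u => ?_
  refine setIntegral_congr_fun measurableSet_Icc fun t ht => ?_
  change h (u, projIcc a b hab t) = _
  simp only [h, emb]
  rw [projIcc_of_mem hab ht, projIcc_of_mem hT (h0T ht)]

/-! ### Jointly measurable representatives -/

/-- Hahn–Banach: a closed ball is an intersection of half-spaces. The family of functionals is the
whole dual unit ball. -/
lemma exists_countable_norming {F : Type*} [NormedAddCommGroup F] [NormedSpace ℝ F] (x : F)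
    (r : ℝ) : ‖x‖ ≤ r ↔ ∀ l : StrongDual ℝ F, ‖l‖ ≤ 1 → l x ≤ r := by
  constructor
  · intro h l hl
    calc l x ≤ ‖l x‖ := le_abs_self _
      _ ≤ ‖l‖ * ‖x‖ := l.le_opNorm x
      _ ≤ 1 * ‖x‖ := by gcongr
      _ ≤ r := by linarith
  · intro h
    obtain ⟨l, hl1, hl2⟩ := exists_dual_vector'' ℝ x
    have := h l hl1
    rw [hl2] at this
    simpa using this

/-- This is weak lower semicontinuity of the norm along the path; it replaces norm continuity, which
a weakly continuous path need not have. -/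
lemma isClosed_norm_le (u : WPath E G p T) (c : Lp E p (volume : Measure G)) (r : ℝ) :
    IsClosed {t | ‖pathFn u t - c‖ ≤ r} := by
  have : {t | ‖pathFn u t - c‖ ≤ r}
      = ⋂ l : {l : StrongDual ℝ (Lp E p (volume : Measure G)) // ‖l‖ ≤ 1},
        {t | l.1 (pathFn u t) - l.1 c ≤ r} := by
    ext t
    simp only [mem_ofPred_eq, mem_iInter, Subtype.forall]
    rw [exists_countable_norming]
    simp only [map_sub]
  rw [this]
  refine isClosed_iInter fun l => isClosed_le ?_ continuous_const
  exact ((continuous_eval_dual l.1).comp (by fun_prop : Continuous fun t => (u, t))).sub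
    continuous_const

/-- A Pettis-type argument. L^p is separable because p is finite. At level k the value at time t is
replaced by the first member of a dense sequence within 2⁻ᵏ⁻¹ of it. The index depends measurably on
t by `isClosed_norm_le`, so the approximations are jointly measurable. For every fixed t the errors
are summable in L^p, hence the approximations converge almost everywhere. -/
lemma exists_measurable_representative [MeasurableSpace E] [BorelSpace E] (hp' : p ≠ ⊤)
    (hT : 0 ≤ T) (u : WPath E G p T) :
    ∃ f : ℝ → G → E, StronglyMeasurable (fun q : ℝ × G => f q.1 q.2) ∧
      ∀ t : Icc (0 : ℝ) T, pathFn u t =ᵐ[volume] f t := by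
  have : Fact (p ≠ ⊤) := ⟨hp'⟩
  let e : ℕ → Lp E p (volume : Measure G) := TopologicalSpace.denseSeq _
  have hex : ∀ (k : ℕ) (t : Icc (0 : ℝ) T), ∃ j, ‖pathFn u t - e j‖ < (1 / 2) ^ (k + 1) := by
    intro k t
    obtain ⟨j, hj⟩ := (TopologicalSpace.denseRange_denseSeq
      (Lp E p (volume : Measure G))).exists_dist_lt (pathFn u t)
      (by positivity : (0 : ℝ) < (1 / 2) ^ (k + 1))
    exact ⟨j, by rwa [← dist_eq_norm]⟩
  classical
  let j : ℕ → Icc (0 : ℝ) T → ℕ := fun k t => Nat.find (hex k t)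
  have hj : ∀ k, Measurable (j k) := by
    intro k
    refine measurable_find (hex k) fun i => ?_
    have : {t | ‖pathFn u t - e i‖ < (1 / 2) ^ (k + 1)}
        = ⋃ n : ℕ, {t | ‖pathFn u t - e i‖ ≤ (1 / 2) ^ (k + 1) - 1 / (n + 1)} := by
      ext t
      simp only [mem_ofPred_eq, mem_iUnion]
      constructor
      · intro h
        obtain ⟨n, hn⟩ := exists_nat_one_div_lt (sub_pos.2 h)
        exact ⟨n, by linarith⟩
      · rintro ⟨n, hn⟩
        have : (0 : ℝ) < 1 / (n + 1) := by positivity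
        linarith
    rw [this]
    exact MeasurableSet.iUnion fun n => (isClosed_norm_le u (e i) _).measurableSet
  have hje : ∀ k t, ‖pathFn u t - e (j k t)‖ < (1 / 2) ^ (k + 1) := fun k t =>
    Nat.find_spec (hex k t)
  let f : ℕ → Icc (0 : ℝ) T × G → E := fun k z => e (j k z.1) z.2
  have hf : ∀ k, StronglyMeasurable (f k) := by
    intro k
    have h1 : Measurable fun z : ℕ × G => e z.1 z.2 :=
      measurable_from_prod_countable_right fun i => (Lp.stronglyMeasurable (e i)).measurable
    exact (h1.comp ((hj k).comp measurable_fst |>.prodMk measurable_snd)).stronglyMeasurable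
  -- At points without convergence this is a default value; for each t they form a null set.
  let F : Icc (0 : ℝ) T × G → E := fun z => limUnder atTop fun k => f k z
  have hF : StronglyMeasurable F := StronglyMeasurable.limUnder hf
  have hlim : ∀ t, pathFn u t =ᵐ[volume] fun x => F (t, x) := by
    intro t
    have hcau : ∀ᵐ x : G, ∃ l : E, Tendsto (fun k => e (j k t) x) atTop (𝓝 l) := by
      refine Lp.ae_tendsto_of_cauchy_eLpNorm (fun k => (Lp.aestronglyMeasurable _)) hp.out
        (B := fun N => ENNReal.ofReal ((1 / 2) ^ N)) ?_ fun N n m hn hm => ?_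
      · have hs : Summable fun N : ℕ => ((1 : ℝ) / 2) ^ N := summable_geometric_two
        rw [← ENNReal.ofReal_tsum_of_nonneg (fun N => by positivity) hs]
        exact ENNReal.ofReal_ne_top
      · have h1 : ‖e (j n t) - e (j m t)‖ < (1 / 2) ^ N := by
          have hN : ∀ k, N ≤ k → ((1 : ℝ) / 2) ^ (k + 1) ≤ (1 / 2) ^ (N + 1) := fun k hk =>
            pow_le_pow_of_le_one (by norm_num) (by norm_num) (by omega)
          calc ‖e (j n t) - e (j m t)‖
              = ‖(pathFn u t - e (j m t)) - (pathFn u t - e (j n t))‖ := by congr 1; abel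
            _ ≤ ‖pathFn u t - e (j m t)‖ + ‖pathFn u t - e (j n t)‖ := norm_sub_le _ _
            _ < (1 / 2) ^ (N + 1) + (1 / 2) ^ (N + 1) :=
                add_lt_add ((hje m t).trans_le (hN m hm)) ((hje n t).trans_le (hN n hn))
            _ = (1 / 2) ^ N := by ring
        rw [Lp.norm_def] at h1
        rw [← eLpNorm_congr_ae (Lp.coeFn_sub _ _),
          ← ENNReal.ofReal_toReal (Lp.eLpNorm_ne_top _)]
        exact (ENNReal.ofReal_lt_ofReal_iff (by positivity)).2 h1
    -- The pointwise limit exists by now; a subsequence converging almost everywhere identifies it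
    -- with the value of the path.
    have hmeas : TendstoInMeasure volume (fun k => (e (j k t) : G → E)) atTop (pathFn u t) := by
      refine tendstoInMeasure_of_tendsto_eLpNorm (p := p) (zero_lt_one.trans_le hp.out).ne'
        (fun k => Lp.aestronglyMeasurable _) (Lp.aestronglyMeasurable _) ?_
      refine (Lp.tendsto_Lp_iff_tendsto_eLpNorm' _ _).1 ?_
      rw [tendsto_iff_norm_sub_tendsto_zero]
      refine squeeze_zero (fun k => norm_nonneg _) (fun k => ?_)
        ((tendsto_pow_atTop_nhds_zero_of_lt_one (by norm_num : (0 : ℝ) ≤ 1 / 2)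
          (by norm_num)).comp (tendsto_add_atTop_nat 1))
      rw [norm_sub_rev]
      exact (hje k t).le
    obtain ⟨ns, hns, hae⟩ := hmeas.exists_seq_tendsto_ae
    filter_upwards [hcau, hae] with x hx1 hx2
    obtain ⟨l, hl⟩ := hx1
    have : l = pathFn u t x := tendsto_nhds_unique (hl.comp hns.tendsto_atTop) hx2
    rw [← this]
    exact hl.limUnder_eq.symm
  refine ⟨fun t x => F (projIcc 0 T hT t, x), ?_, fun t => ?_⟩
  · exact hF.comp_measurable ((continuous_projIcc.measurable.comp measurable_fst).prodMk
      measurable_snd)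
  · simp only [projIcc_val]
    exact hlim t

/-! ### Constraints that pass to the closure, and equality at all times -/

lemma continuous_setIntegral_inner {A : Set G} (hA : MeasurableSet A) (hA' : volume A ≠ ⊤) (e : E) :
    Continuous fun x : WPath E G p T × Icc (0 : ℝ) T => ∫ y in A, inner ℝ e (pathFn x.1 x.2 y) := by
  obtain ⟨l, hl⟩ := exists_dual (p := p) (ψ := A.indicator fun _ => e) fun q =>
    memLp_of_bounded_of_support ((aestronglyMeasurable_const).indicator hA) (C := ‖e‖)
      (fun x => by
        by_cases hx : x ∈ A <;> simp [hx]) hA hA' (fun x hx => indicator_of_notMem hx _)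
  refine (continuous_eval_dual l).congr fun x => ?_
  rw [hl, ← integral_indicator hA]
  refine integral_congr_ae (Eventually.of_forall fun y => ?_)
  by_cases hy : y ∈ A <;> simp [hy]

lemma ae_restrict_of_compactCovering {S : Set G} {P : G → Prop}
    (h : ∀ n, ∀ᵐ x ∂(volume : Measure G).restrict (S ∩ compactCovering G n), P x) :
    ∀ᵐ x ∂(volume : Measure G).restrict S, P x := by
  have : S = ⋃ n, S ∩ compactCovering G n := by
    rw [← inter_iUnion, iUnion_compactCovering, inter_univ]
  rw [this, ae_restrict_iUnion_iff]
  exact h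

/-- If a weakly continuous path agrees with a continuous field on `S` at almost every time, then
it does so at every time. -/
lemma ae_eq_of_ae_time (hT : 0 < T) {S : Set G} (hS : MeasurableSet S) (u : WPath E G p T)
    {f : ℝ → G → E} (hf : ContinuousOn (fun q : ℝ × G => f q.1 q.2) (Icc 0 T ×ˢ univ))
    (h : ∀ᵐ t ∂volume.restrict (Icc 0 T), ∀ᵐ x ∂(volume : Measure G).restrict S,
      pathFn u (projIcc 0 T hT.le t) x = f t x) (t : Icc (0 : ℝ) T) :
    ∀ᵐ x ∂(volume : Measure G).restrict S, pathFn u t x = f t x := by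
  refine ae_restrict_of_compactCovering fun n => ?_
  set D := compactCovering G n
  have hD : IsCompact D := isCompact_compactCovering G n
  have hDm : MeasurableSet D := hD.isClosed.measurableSet
  have hft : ∀ t ∈ Icc 0 T, Continuous (f t) := fun t ht => by
    rw [← continuousOn_univ]
    exact hf.comp (Continuous.prodMk_right t).continuousOn fun x _ => ⟨ht, mem_univ _⟩
  have : IsFiniteMeasure (volume.restrict (S ∩ D)) :=
    ⟨by simpa using (measure_mono inter_subset_right).trans_lt hD.measure_lt_top⟩
  have hfi : ∀ t ∈ Icc 0 T, IntegrableOn (f t) (S ∩ D) := fun t ht =>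
    ((hft t ht).continuousOn.integrableOn_compact hD).mono_set inter_subset_right
  have hpi : ∀ v : Lp E p (volume : Measure G), IntegrableOn v (S ∩ D) := fun v =>
    (integrableOn_pathFn v hD).mono_set inter_subset_right
  refine Integrable.ae_eq_of_forall_setIntegral_eq _ _ (hpi _) (hfi t t.2) fun A hA _ => ?_
  rw [Measure.restrict_restrict hA]
  set A' := A ∩ (S ∩ D)
  have hA' : MeasurableSet A' := hA.inter (hS.inter hDm)
  have hsub : A' ⊆ S ∩ D := inter_subset_right
  have hAf : volume A' ≠ ⊤ :=
    ((measure_mono (hsub.trans inter_subset_right)).trans_lt hD.measure_lt_top).ne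
  refine ext_inner_left ℝ fun e => ?_
  rw [← integral_inner ((hpi _).mono_set hsub), ← integral_inner ((hfi t t.2).mono_set hsub)]
  -- Integrals over a fixed test set are continuous in time on both sides, so agreement at almost
  -- every time extends to every time.
  have c1 : ContinuousOn (fun t => ∫ y in A', inner ℝ e (pathFn u (projIcc 0 T hT.le t) y))
      (Icc 0 T) :=
    ((continuous_setIntegral_inner hA' hAf e).comp
      (by fun_prop : Continuous fun t => (u, projIcc 0 T hT.le t))).continuousOn
  have c2 : ContinuousOn (fun t => ∫ y in A', inner ℝ e (f t y)) (Icc 0 T) := by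
    obtain ⟨B, hB⟩ := (isCompact_Icc.prod hD).exists_bound_of_continuousOn
      (hf.mono (prod_mono subset_rfl (subset_univ D)))
    refine continuousOn_of_dominated (bound := fun _ => ‖e‖ * B) ?_ ?_ ?_ ?_
    · intro t ht
      exact (continuous_const.inner (hft t ht)).aestronglyMeasurable
    · intro t ht
      filter_upwards [ae_restrict_mem hA'] with y hy
      exact (norm_inner_le_norm _ _).trans (mul_le_mul_of_nonneg_left
        (hB (t, y) ⟨ht, (hsub hy).2⟩) (norm_nonneg _))
    · have : IsFiniteMeasure (volume.restrict A') := ⟨by simpa using hAf.lt_top⟩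
      exact integrable_const _
    · refine Eventually.of_forall fun y => continuousOn_const.inner ?_
      exact hf.comp (Continuous.prodMk_left y).continuousOn fun t ht => ⟨ht, mem_univ _⟩
  have heq : (fun t => ∫ y in A', inner ℝ e (pathFn u (projIcc 0 T hT.le t) y))
      =ᵐ[volume.restrict (Icc 0 T)] fun t => ∫ y in A', inner ℝ e (f t y) := by
    filter_upwards [h] with t ht
    refine setIntegral_congr_ae hA' ?_
    have := (ae_restrict_iff' hS).1 ht
    filter_upwards [this] with y hy hyA
    rw [hy (hsub hyA).1]
  have := Measure.eqOn_Icc_of_ae_eq volume hT.ne heq c1 c2 t.2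
  simpa only [projIcc_val] using this

end Paths

/-! ### The convex energy and its tangent planes -/

section Tangent

variable {d : ℕ} {γ : ℝ}

/-- The function `p(ρ) + |m|² / (d ρ)`. -/
def energy (d : ℕ) (γ r : ℝ) (m : Vec d) : ℝ := pressure γ r + ‖m‖ ^ 2 / (d * r)

/-- The tangent plane of `energy` at the state with density `r` and velocity `v`. -/
def tangent (d : ℕ) (γ r : ℝ) (v : Vec d) (ρ : ℝ) (m : Vec d) : ℝ :=
  pressure γ r + γ * r ^ (γ - 1) * (ρ - r) + 2 / d * inner ℝ v m - ‖v‖ ^ 2 / d * ρ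

/-- The Bregman distance of the pressure. -/
def bregman (γ ρ r : ℝ) : ℝ := pressure γ ρ - pressure γ r - γ * r ^ (γ - 1) * (ρ - r)

lemma rpow_sub_one_mul {r : ℝ} (hr : 0 < r) : r ^ (γ - 1) * r = r ^ γ := by
  rw [Real.rpow_sub_one hr.ne', div_mul_cancel₀ _ hr.ne']

/-- By homogeneity everything depends on ρ/r, and the sign of the bracket is Bernoulli's inequality,
strict for ρ ≠ r. -/
lemma bregman_eq {ρ r : ℝ} (hρ : 0 ≤ ρ) (hr : 0 < r) :
    bregman γ ρ r = r ^ γ * ((1 + (ρ / r - 1)) ^ γ - (1 + γ * (ρ / r - 1))) := by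
  have h1 : (1 + (ρ / r - 1)) = ρ / r := by ring
  rw [h1, Real.div_rpow hρ hr.le, bregman, pressure, pressure, ← rpow_sub_one_mul hr]
  have := (Real.rpow_pos_of_pos hr (γ - 1)).ne'
  field_simp
  ring

lemma bregman_nonneg (hγ : 1 < γ) {ρ r : ℝ} (hρ : 0 ≤ ρ) (hr : 0 < r) : 0 ≤ bregman γ ρ r := by
  rw [bregman_eq hρ hr]
  refine mul_nonneg (Real.rpow_nonneg hr.le _) (sub_nonneg.2 ?_)
  refine one_add_mul_self_le_rpow_one_add ?_ hγ.le
  have : 0 ≤ ρ / r := by positivity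
  linarith

lemma bregman_pos (hγ : 1 < γ) {ρ r : ℝ} (hρ : 0 ≤ ρ) (hr : 0 < r) (hne : ρ ≠ r) :
    0 < bregman γ ρ r := by
  rw [bregman_eq hρ hr]
  refine mul_pos (Real.rpow_pos_of_pos hr _) (sub_pos.2 ?_)
  refine one_add_mul_self_lt_rpow_one_add ?_ ?_ hγ
  · have : 0 ≤ ρ / r := by positivity
    linarith
  · rw [sub_ne_zero, Ne, div_eq_one_iff_eq hr.ne']
    exact hne

/-- The Bregman distance increases when the second argument moves away from the first. -/
lemma bregman_mono (hγ : 1 < γ) {ρ r s : ℝ} (hr : 0 < r) (hs : 0 < s)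
    (h : r ≤ s ∧ s ≤ ρ ∨ ρ ≤ s ∧ s ≤ r) : bregman γ ρ s ≤ bregman γ ρ r := by
  have h1 := bregman_nonneg hγ hs.le hr
  -- The three-point identity of Bregman distances. Its cross term is nonnegative because the
  -- derivative of p is increasing and s lies between r and ρ.
  have key : bregman γ ρ r - bregman γ ρ s
      = bregman γ s r + γ * (s ^ (γ - 1) - r ^ (γ - 1)) * (ρ - s) := by
    simp only [bregman]
    ring
  have h2 : 0 ≤ (s ^ (γ - 1) - r ^ (γ - 1)) * (ρ - s) := by
    rcases h with ⟨h1, h2⟩ | ⟨h1, h2⟩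
    · exact mul_nonneg (sub_nonneg.2 (Real.rpow_le_rpow hr.le h1 (by linarith))) (by linarith)
    · exact mul_nonneg_of_nonpos_of_nonpos
        (sub_nonpos.2 (Real.rpow_le_rpow hs.le h2 (by linarith))) (by linarith)
  have h3 : 0 ≤ γ * ((s ^ (γ - 1) - r ^ (γ - 1)) * (ρ - s)) := by positivity
  nlinarith

/-- By monotonicity, the distance at any point beyond a threshold is at least the positive distance
at the threshold itself. -/
lemma tendsto_of_bregman (hγ : 1 < γ) {ρ : ℝ} (hρ : 0 < ρ) {r : ℕ → ℝ} (hr : ∀ n, 0 < r n)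
    (h : Tendsto (fun n => bregman γ ρ (r n)) atTop (𝓝 0)) : Tendsto r atTop (𝓝 ρ) := by
  refine tendsto_order.2 ⟨fun a ha => ?_, fun b hb => ?_⟩
  -- The number a may be nonpositive; the maximum with ρ/2 keeps the comparison point inside (0, ρ).
  · have hs : 0 < max a (ρ / 2) := lt_max_of_lt_right (by linarith)
    have hsρ : max a (ρ / 2) < ρ := max_lt ha (by linarith)
    filter_upwards [(tendsto_order.1 h).2 _ (bregman_pos hγ hρ.le hs hsρ.ne')] with n hn
    by_contra! hc
    exact absurd hn (not_lt.2 (bregman_mono hγ (hr n) hs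
      (Or.inl ⟨hc.trans (le_max_left _ _), hsρ.le⟩)))
  · filter_upwards [(tendsto_order.1 h).2 _ (bregman_pos hγ hρ.le (hρ.trans hb) hb.ne)] with n hn
    by_contra! hc
    exact absurd hn (not_lt.2 (bregman_mono hγ (hr n) (hρ.trans hb) (Or.inr ⟨hb.le, hc⟩)))

/-- Strict convexity in explicit form: the defect is a Bregman distance of densities plus a weighted
square of the difference of velocities. It is nonnegative, and if it tends to zero then densities
and velocities both converge. -/
lemma energy_sub_tangent {ρ r : ℝ} (hρ : 0 < ρ) (v m : Vec d) :
    energy d γ ρ m - tangent d γ r v ρ m = bregman γ ρ r + ρ * ‖ρ⁻¹ • m - v‖ ^ 2 / d := by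
  have h : ‖ρ⁻¹ • m - v‖ ^ 2 = (ρ⁻¹) ^ 2 * ‖m‖ ^ 2 - 2 * (ρ⁻¹ * inner ℝ v m) + ‖v‖ ^ 2 := by
    rw [norm_sub_sq_real, norm_smul, inner_smul_left, real_inner_comm m v, mul_pow,
      Real.norm_eq_abs, sq_abs]
    simp
  rw [h]
  simp only [energy, tangent, bregman]
  rcases eq_or_ne (d : ℝ) 0 with hd | hd
  · simp [hd]
    ring
  · field_simp
    ring

lemma tangent_le_energy (hγ : 1 < γ) {ρ r : ℝ} (hρ : 0 < ρ) (hr : 0 < r) (v m : Vec d) :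
    tangent d γ r v ρ m ≤ energy d γ ρ m := by
  have h1 := energy_sub_tangent (γ := γ) (r := r) hρ v m
  have h2 := bregman_nonneg hγ hρ.le hr
  have h3 : 0 ≤ ρ * ‖ρ⁻¹ • m - v‖ ^ 2 / d := by positivity
  linarith

lemma tangent_self {ρ : ℝ} (hρ : 0 < ρ) (m : Vec d) :
    tangent d γ ρ (ρ⁻¹ • m) ρ m = energy d γ ρ m := by
  have h1 := energy_sub_tangent (γ := γ) (r := ρ) hρ (ρ⁻¹ • m) m
  simp only [bregman, sub_self, norm_zero] at h1
  linarith [h1.trans (by norm_num : _ = (0 : ℝ))]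

/-- Changing the momentum only: the energy defect relative to the tangent plane. -/
lemma energy_eq_tangent_add {ρ : ℝ} (hρ : 0 < ρ) (m m' : Vec d) :
    energy d γ ρ m' = tangent d γ ρ (ρ⁻¹ • m) ρ m' + ‖m' - m‖ ^ 2 / (d * ρ) := by
  have h1 := energy_sub_tangent (γ := γ) (r := ρ) hρ (ρ⁻¹ • m) m'
  rw [← smul_sub, norm_smul, mul_pow, Real.norm_eq_abs, sq_abs] at h1
  have h2 : bregman γ ρ ρ = 0 := by simp [bregman]
  have h3 : ρ * ((ρ⁻¹) ^ 2 * ‖m' - m‖ ^ 2) / d = ‖m' - m‖ ^ 2 / (d * ρ) := by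
    rcases eq_or_ne (d : ℝ) 0 with hd | hd
    · simp [hd]
    · field_simp
  rw [h2, h3] at h1
  linarith

/-- For ρ > 0 the tangent plane at the state itself gives f ≤ Q, and the limit gives the reverse
inequality, so the defect relative to the planes (r n, v n) tends to zero and `energy_sub_tangent`
yields convergence. Vacuum is excluded: at ρ = 0 the constraints for large v force m = 0, and then
every tangent plane is nonpositive at the state while Q > 0. -/
lemma exact_of_tendsto (hd : 0 < d) (hγ : 1 < γ) {ρ Q : ℝ} {m : Vec d} (hρ : 0 ≤ ρ) (hQ : 0 < Q)
    (hle : ∀ r > 0, ∀ v, tangent d γ r v ρ m ≤ Q) {r : ℕ → ℝ} {v : ℕ → Vec d}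
    (hr : ∀ n, 0 < r n)
    (hlim : Tendsto (fun n => tangent d γ (r n) (v n) ρ m) atTop (𝓝 Q)) :
    0 < ρ ∧ Q = energy d γ ρ m ∧ Tendsto r atTop (𝓝 ρ) ∧ Tendsto v atTop (𝓝 (ρ⁻¹ • m)) := by
  have hd' : (0 : ℝ) < d := by exact_mod_cast hd
  rcases hρ.eq_or_lt with h0 | h0
  · exfalso
    subst h0
    have hm : m = 0 := by
      by_contra hm
      have hm' : 0 < ‖m‖ ^ 2 := by positivity
      -- With this multiple of m as velocity, the tangent plane at r = 1 takes the value Q + 1.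
      have := hle 1 one_pos ((d * (Q + γ) / (2 * ‖m‖ ^ 2)) • m)
      simp only [tangent, pressure, Real.one_rpow, inner_smul_left, real_inner_self_eq_norm_sq,
        conj_trivial] at this
      have e : 2 / (d : ℝ) * (d * (Q + γ) / (2 * ‖m‖ ^ 2) * ‖m‖ ^ 2) = Q + γ := by
        field_simp
      rw [e] at this
      linarith
    have hneg : ∀ n, tangent d γ (r n) (v n) 0 m ≤ 0 := by
      intro n
      have := rpow_sub_one_mul (γ := γ) (hr n)
      have h2 : 0 < (r n) ^ γ := Real.rpow_pos_of_pos (hr n) _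
      simp only [tangent, pressure, hm, inner_zero_right]
      nlinarith
    exact absurd (le_of_tendsto' hlim hneg) (not_le.2 hQ)
  · have h1 : ∀ n, energy d γ ρ m - tangent d γ (r n) (v n) ρ m
        = bregman γ ρ (r n) + ρ * ‖ρ⁻¹ • m - v n‖ ^ 2 / d := fun n => energy_sub_tangent h0 _ _
    have hfQ : energy d γ ρ m ≤ Q := by
      rw [← tangent_self h0]
      exact hle ρ h0 _
    have h2 : ∀ n, 0 ≤ bregman γ ρ (r n) := fun n => bregman_nonneg hγ h0.le (hr n)
    have h3 : ∀ n, 0 ≤ ρ * ‖ρ⁻¹ • m - v n‖ ^ 2 / d := fun n => by positivity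
    have hQf : Q ≤ energy d γ ρ m :=
      le_of_tendsto' hlim fun n => by linarith [h1 n, h2 n, h3 n]
    have hQe : Q = energy d γ ρ m := le_antisymm hQf hfQ
    have hsum : Tendsto (fun n => energy d γ ρ m - tangent d γ (r n) (v n) ρ m) atTop (𝓝 0) := by
      have := (tendsto_const_nhds (x := energy d γ ρ m)).sub hlim
      rwa [sub_eq_zero.2 hQe.symm] at this
    refine ⟨h0, hQe, tendsto_of_bregman hγ h0 hr ?_, ?_⟩
    · exact squeeze_zero h2 (fun n => by linarith [h1 n, h3 n]) hsum
    · rw [tendsto_iff_norm_sub_tendsto_zero]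
      have h4 : Tendsto (fun n => ‖v n - ρ⁻¹ • m‖ ^ 2) atTop (𝓝 0) := by
        have := hsum.mul_const (d / ρ)
        rw [zero_mul] at this
        refine squeeze_zero (fun n => by positivity) (fun n => ?_) this
        rw [h1, norm_sub_rev, add_mul]
        have : ρ * ‖ρ⁻¹ • m - v n‖ ^ 2 / d * (d / ρ) = ‖ρ⁻¹ • m - v n‖ ^ 2 := by field_simp
        rw [this]
        have : 0 ≤ bregman γ ρ (r n) * (d / ρ) := mul_nonneg (h2 n) (by positivity)
        linarith
      have := h4.sqrt
      simpa using this

/-- The bounds that follow from the tangent planes at `r = 1`. -/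
lemma bounds_of_tangent_le (hd : 0 < d) (hγ : 1 < γ) {ρ Q : ℝ} {m : Vec d} (hρ : 0 ≤ ρ)
    (h0 : tangent d γ 1 0 ρ m ≤ Q)
    (h1 : ∀ i, tangent d γ 1 (EuclideanSpace.single i 1) ρ m ≤ Q)
    (h2 : ∀ i, tangent d γ 1 (EuclideanSpace.single i (-1)) ρ m ≤ Q) :
    |ρ| ≤ Q + γ ∧ ∀ i, |m i| ≤ d * (Q + γ) := by
  have hd' : (1 : ℝ) ≤ d := by exact_mod_cast hd
  simp only [tangent, pressure, Real.one_rpow, inner_zero_left, norm_zero,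
    PiLp.norm_single, EuclideanSpace.inner_single_left] at h0 h1 h2
  have hρQ : ρ ≤ Q + γ := by
    have := mul_nonneg (sub_nonneg.2 hγ.le) hρ
    norm_num at h0
    nlinarith
  refine ⟨by rwa [abs_of_nonneg hρ], fun i => ?_⟩
  have e1 := h1 i
  have e2 := h2 i
  simp only [norm_one, norm_neg, one_pow, map_one, map_neg, mul_one, one_mul, neg_mul] at e1 e2
  have e3 : 1 / (d : ℝ) * ρ ≤ γ * ρ := by
    refine mul_le_mul_of_nonneg_right ?_ hρ
    exact ((div_le_one (by linarith)).2 hd').trans hγ.le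
  have e4 : 2 / (d : ℝ) * m i ≤ Q + γ := by nlinarith
  have e5 : -(2 / (d : ℝ) * m i) ≤ Q + γ := by nlinarith
  have e6 : d * (2 / (d : ℝ) * m i) = 2 * m i := by field_simp
  have e7 : 0 ≤ d * (Q + γ) := mul_nonneg (by linarith) (by linarith)
  have e8 := mul_le_mul_of_nonneg_left e4 (by linarith : (0 : ℝ) ≤ d)
  have e9 := mul_le_mul_of_nonneg_left e5 (by linarith : (0 : ℝ) ≤ d)
  rw [abs_le]
  constructor <;> linarith

end Tangent

/-! ### The defect matrix of a subsolution -/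

section Defect

variable {d : ℕ} {γ : ℝ}

/-- The positive definite matrix `(Q - p(ρ)) I - (m ⊗ m / ρ - M)`. -/
def defect (γ r : ℝ) (m : Vec d) (M : Mat d) (Q : ℝ) : Mat d :=
  (Q - pressure γ r) • 1 - (r⁻¹ • tensorSq m - M)

/-- The eigenvalue bound makes the defect positive semidefinite, and its trace is d (Q - f) because
M is trace-free; the trace of such a matrix dominates all its entries. This passes from the scalar
excess to convergence of the whole flux. -/
lemma abs_defect_le (hd : 0 < d) {r Q : ℝ} {m : Vec d} {M : Mat d} (hM : M ∈ symTraceFree d)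
    (hr : 0 < r) (hz : Q > pressure γ r + 2 / (d : ℝ) * eKin r m M) (i j : Fin d) :
    |defect γ r m M Q i j| ≤ d * (Q - energy d γ r m) := by
  have hd' : (0 : ℝ) < d := by exact_mod_cast hd
  have hA : (r⁻¹ • tensorSq m - M).IsSymm := ((tensorSq_isSymm m).smul _).sub hM.1
  have hlt : lambdaMax (r⁻¹ • tensorSq m - M) < Q - pressure γ r := by
    have : 2 / (d : ℝ) * eKin r m M = lambdaMax (r⁻¹ • tensorSq m - M) := by
      rw [eKin]
      field_simp
    linarith
  have htr : (defect γ r m M Q).trace = d * (Q - energy d γ r m) := by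
    rw [defect, Matrix.trace_sub, Matrix.trace_sub, Matrix.trace_smul, Matrix.trace_smul,
      trace_tensorSq, hM.2, Matrix.trace_one, energy]
    simp
    field_simp
    ring
  rw [← htr]
  refine abs_entry_le_trace (((Matrix.isSymm_one).smul _).sub hA) (fun x => ?_) i j
  have h1 := form_le_lambdaMax hA x
  rw [Matrix.sub_mulVec, dotProduct_sub, Matrix.smul_mulVec, Matrix.one_mulVec,
    dotProduct_smul, dotProduct_eq_inner, real_inner_self_eq_norm_sq, smul_eq_mul]
  have : lambdaMax (r⁻¹ • tensorSq m - M) * ‖x‖ ^ 2 ≤ (Q - pressure γ r) * ‖x‖ ^ 2 :=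
    mul_le_mul_of_nonneg_right hlt.le (by positivity)
  linarith

/-- If the energy defect tends to zero then so does the defect of the flux. -/
lemma tendsto_flux (hd : 0 < d) {ρ Q : ℝ} {m : Vec d} (hρ : 0 < ρ)
    (hQ : Q = energy d γ ρ m) {r : ℕ → ℝ} {v : ℕ → Vec d} {M : ℕ → Mat d} (hr : ∀ n, 0 < r n)
    (hM : ∀ n, M n ∈ symTraceFree d)
    (hz : ∀ n, Q > pressure γ (r n) + 2 / (d : ℝ) * eKin (r n) (v n) (M n))
    (hrl : Tendsto r atTop (𝓝 ρ)) (hvl : Tendsto v atTop (𝓝 m)) (i j : Fin d) :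
    Tendsto (fun n => M n i j + (if i = j then Q else 0)) atTop
      (𝓝 (ρ⁻¹ * (m i * m j) + if i = j then pressure γ ρ else 0)) := by
  have hd' : (0 : ℝ) < d := by exact_mod_cast hd
  have hp : Tendsto (fun n => pressure γ (r n)) atTop (𝓝 (pressure γ ρ)) :=
    hrl.rpow_const (Or.inl hρ.ne')
  have hE : Tendsto (fun n => d * (Q - energy d γ (r n) (v n))) atTop (𝓝 0) := by
    have h1 : Tendsto (fun n => energy d γ (r n) (v n)) atTop (𝓝 (energy d γ ρ m)) :=
      hp.add ((hvl.norm.pow 2).div (hrl.const_mul _) (by positivity))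
    have := ((tendsto_const_nhds (x := Q)).sub h1).const_mul (d : ℝ)
    rwa [← hQ, sub_self, mul_zero] at this
  have hD : Tendsto (fun n => defect γ (r n) (v n) (M n) Q i j) atTop (𝓝 0) := by
    refine squeeze_zero_norm (fun n => ?_) hE
    rw [Real.norm_eq_abs]
    exact abs_defect_le hd (hM n) (hr n) (hz n) i j
  have hvi : ∀ i, Tendsto (fun n => v n i) atTop (𝓝 (m i)) := fun i =>
    ((EuclideanSpace.proj (𝕜 := ℝ) i).continuous.tendsto m).comp hvl
  have hT : Tendsto (fun n => (r n)⁻¹ * (v n i * v n j) + if i = j then pressure γ (r n) else 0)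
      atTop (𝓝 (ρ⁻¹ * (m i * m j) + if i = j then pressure γ ρ else 0)) := by
    refine ((hrl.inv₀ hρ.ne').mul ((hvi i).mul (hvi j))).add ?_
    split_ifs
    · exact hp
    · exact tendsto_const_nhds
  have := hD.add hT
  rw [zero_add] at this
  refine this.congr fun n => ?_
  simp only [defect, Matrix.sub_apply, Matrix.smul_apply, tensorSq, Matrix.of_apply,
    Matrix.one_apply, smul_eq_mul]
  split_ifs <;> ring

/-- A bound of the flux of a subsolution. -/
lemma abs_flux_le (hd : 0 < d) {r Q : ℝ} {m : Vec d} {M : Mat d} (hM : M ∈ symTraceFree d)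
    (hr : 0 < r) (hz : Q > pressure γ r + 2 / (d : ℝ) * eKin r m M)
    (hz' : energy d γ r m < Q) (i j : Fin d) : |M i j| ≤ (2 * d + 1) * Q := by
  have hd' : (0 : ℝ) < d := by exact_mod_cast hd
  have h1 := abs_defect_le hd hM hr hz i j
  have hp : 0 ≤ pressure γ r := Real.rpow_nonneg hr.le _
  have hmm : r⁻¹ * ‖m‖ ^ 2 ≤ d * (Q - pressure γ r) := by
    have : ‖m‖ ^ 2 / (d * r) < Q - pressure γ r := by
      rw [energy] at hz'
      linarith
    have h2 := mul_le_mul_of_nonneg_left this.le hd'.le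
    have h3 : d * (‖m‖ ^ 2 / (d * r)) = r⁻¹ * ‖m‖ ^ 2 := by field_simp
    linarith
  have hE : energy d γ r m ≥ 0 := by
    rw [energy]
    positivity
  have hmi : ∀ i, |m i| ≤ ‖m‖ := fun i => by
    have := PiLp.norm_apply_le m i
    rwa [Real.norm_eq_abs] at this
  have h4 : |r⁻¹ * (m i * m j)| ≤ d * Q := by
    rw [abs_mul, abs_mul, abs_of_pos (inv_pos.2 hr)]
    calc r⁻¹ * (|m i| * |m j|) ≤ r⁻¹ * (‖m‖ * ‖m‖) := by
          gcongr
          · exact hmi i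
          · exact hmi j
      _ = r⁻¹ * ‖m‖ ^ 2 := by ring
      _ ≤ d * Q := hmm.trans (mul_le_mul_of_nonneg_left (by linarith) hd'.le)
  have h5 : |(if i = j then Q - pressure γ r else 0)| ≤ Q := by
    have h6 : 0 ≤ r⁻¹ * ‖m‖ ^ 2 := by positivity
    have h7 : 0 ≤ Q - pressure γ r := by
      by_contra! hc
      nlinarith
    split_ifs
    · rw [abs_of_nonneg h7]
      linarith
    · rw [abs_zero]
      linarith
  have h8 : M i j = defect γ r m M Q i j + r⁻¹ * (m i * m j)
      - (if i = j then Q - pressure γ r else 0) := by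
    simp only [defect, Matrix.sub_apply, Matrix.smul_apply, tensorSq, Matrix.of_apply,
      Matrix.one_apply, smul_eq_mul]
    split_ifs <;> ring
  have h9 : d * (Q - energy d γ r m) ≤ d * Q := mul_le_mul_of_nonneg_left (by linarith) hd'.le
  rw [h8]
  calc |defect γ r m M Q i j + r⁻¹ * (m i * m j) - (if i = j then Q - pressure γ r else 0)|
      ≤ |defect γ r m M Q i j + r⁻¹ * (m i * m j)|
        + |(if i = j then Q - pressure γ r else 0)| := abs_sub _ _
    _ ≤ |defect γ r m M Q i j| + |r⁻¹ * (m i * m j)|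
        + |(if i = j then Q - pressure γ r else 0)| := by gcongr; exact abs_add_le _ _
    _ ≤ (2 * d + 1) * Q := by linarith

end Defect

/-! ### Properties of the space `X` -/

/-- Going from slices to the product requires a measurable set, so both functions are replaced by
measurable modifications. -/
lemma ae_le_of_ae_ae_le {α β : Type*} [MeasurableSpace α] [MeasurableSpace β] {μ : Measure α}
    {ν : Measure β} [SFinite μ] [SFinite ν] {f g : α × β → ℝ} (hf : AEMeasurable f (μ.prod ν))
    (hg : AEMeasurable g (μ.prod ν)) (h : ∀ᵐ t ∂μ, ∀ᵐ x ∂ν, f (t, x) ≤ g (t, x)) :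
    ∀ᵐ q ∂μ.prod ν, f q ≤ g q := by
  have hm : MeasurableSet {q | hf.mk f q ≤ hg.mk g q} :=
    measurableSet_le hf.measurable_mk hg.measurable_mk
  have h1 : ∀ᵐ q ∂μ.prod ν, q ∈ {q | hf.mk f q ≤ hg.mk g q} := by
    rw [Measure.ae_prod_mem_iff_ae_ae_mem hm]
    filter_upwards [h, Measure.ae_ae_of_ae_prod hf.ae_eq_mk,
      Measure.ae_ae_of_ae_prod hg.ae_eq_mk] with t ht1 ht2 ht3
    filter_upwards [ht1, ht2, ht3] with x hx1 hx2 hx3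
    rwa [← hx2, ← hx3]
  filter_upwards [h1, hf.ae_eq_mk, hg.ae_eq_mk] with q hq1 hq2 hq3
  rw [hq2, hq3]
  exact hq1

lemma ae_eq_of_ae_ae_eq {α β : Type*} [MeasurableSpace α] [MeasurableSpace β] {μ : Measure α}
    {ν : Measure β} [SFinite μ] [SFinite ν] {E : Type*} [NormedAddCommGroup E] {f g : α × β → E}
    (hf : AEStronglyMeasurable f (μ.prod ν)) (hg : AEStronglyMeasurable g (μ.prod ν))
    (h : ∀ᵐ t ∂μ, ∀ᵐ x ∂ν, f (t, x) = g (t, x)) : ∀ᵐ q ∂μ.prod ν, f q = g q := by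
  have := ae_le_of_ae_ae_le (f := fun q => ‖f q - g q‖) (g := fun _ => 0)
    (hf.sub hg).norm.aemeasurable aemeasurable_const (by
      filter_upwards [h] with t ht
      filter_upwards [ht] with x hx
      rw [hx, sub_self, norm_zero])
  filter_upwards [this] with q hq
  exact sub_eq_zero.1 (norm_le_zero_iff.1 hq)

lemma restrict_prod_eq {G : Type} [MeasureSpace G] [SFinite (volume : Measure G)] (A : Set ℝ)
    (S : Set G) : (volume : Measure (ℝ × G)).restrict (A ×ˢ S)
      = (volume.restrict A).prod (volume.restrict S) := by
  rw [Measure.prod_restrict]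
  rfl

section SpaceX

variable {d : ℕ} {γ T : ℝ} [hγ : Fact (1 < γ)] {G : Type} [AddCommGroup G] [TopologicalSpace G]
  [MeasureSpace G] [BorelSpace G] [SecondCountableTopology G] [LocallyCompactSpace G] [T2Space G]
  [IsLocallyFiniteMeasure (volume : Measure G)] {π : Vec d →+ G} {Ω : Set G} {z₀ : Fields d G}
  {mref : ℝ → G → Vec d}

lemma density_eq (w : PathSpace d γ T G) (t : Icc (0 : ℝ) T) :
    density w t = (pathFn w.1 t : G → ℝ) := rfl

lemma momentum_eq (w : PathSpace d γ T G) (t : Icc (0 : ℝ) T) :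
    momentum w t = (pathFn w.2 t : G → Vec d) := rfl

lemma continuous_setIntegral_density {A : Set G} (hA : MeasurableSet A) (hf : volume A ≠ ⊤)
    (α : ℝ) (t : Icc (0 : ℝ) T) :
    Continuous fun w : PathSpace d γ T G => ∫ x in A, inner ℝ α (density w t x) := by
  have h : Continuous fun u : WPath ℝ G (ENNReal.ofReal γ) T =>
      ∫ x in A, inner ℝ α (pathFn u t x) :=
    (continuous_setIntegral_inner (E := ℝ) (p := ENNReal.ofReal γ) (T := T) hA hf α).comp
      (Continuous.prodMk_left t)
  exact h.comp continuous_fst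

lemma continuous_setIntegral_momentum {A : Set G} (hA : MeasurableSet A) (hf : volume A ≠ ⊤)
    (β : Vec d) (t : Icc (0 : ℝ) T) :
    Continuous fun w : PathSpace d γ T G => ∫ x in A, inner ℝ β (momentum w t x) := by
  have h : Continuous fun u : WPath (Vec d) G 2 T =>
      ∫ x in A, inner ℝ β (pathFn u t x) :=
    (continuous_setIntegral_inner (E := Vec d) (p := 2) (T := T) hA hf β).comp
      (Continuous.prodMk_left t)
  exact h.comp continuous_snd

/-- Linear inequalities between the values of a path at a fixed time pass to the closure. -/
lemma ae_le_of_mem_closure {S : Set G} (hS : MeasurableSet S) {α : ℝ} {β : Vec d} {h : G → ℝ}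
    (hh : ∀ n, IntegrableOn h (S ∩ compactCovering G n)) (t : Icc (0 : ℝ) T)
    {A : Set (PathSpace d γ T G)}
    (hA : ∀ w ∈ A, ∀ᵐ x ∂(volume : Measure G).restrict S,
      α * density w t x + inner ℝ β (momentum w t x) ≤ h x)
    {w : PathSpace d γ T G} (hw : w ∈ closure A) :
    ∀ᵐ x ∂(volume : Measure G).restrict S,
      α * density w t x + inner ℝ β (momentum w t x) ≤ h x := by
  have hint : ∀ (w : PathSpace d γ T G) n, IntegrableOn (fun x => inner ℝ α (density w t x))
      (S ∩ compactCovering G n) ∧ IntegrableOn (fun x => inner ℝ β (momentum w t x))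
      (S ∩ compactCovering G n) := fun w n =>
    ⟨(((integrableOn_pathFn (pathFn w.1 t) (isCompact_compactCovering G n)).mono_set
        inter_subset_right).const_inner α),
      (((integrableOn_pathFn (pathFn w.2 t) (isCompact_compactCovering G n)).mono_set
        inter_subset_right).const_inner β)⟩
  have hin : ∀ a : ℝ, α * a = inner ℝ α a := fun a => by simp [mul_comm]
  refine ae_restrict_of_compactCovering fun n => ?_
  set D := S ∩ compactCovering G n
  have hD : MeasurableSet D := hS.inter (isCompact_compactCovering G n).isClosed.measurableSet
  have hDf : volume D ≠ ⊤ :=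
    ((measure_mono inter_subset_right).trans_lt
      (isCompact_compactCovering G n).measure_lt_top).ne
  have hsum : ∀ w : PathSpace d γ T G,
      IntegrableOn (fun x => α * density w t x + inner ℝ β (momentum w t x)) D := fun w => by
    simp only [hin]
    exact (hint w n).1.add (hint w n).2
  refine ae_le_of_forall_setIntegral_le (hsum w) (hh n) fun B hB _ => ?_
  rw [Measure.restrict_restrict hB]
  have hBD : MeasurableSet (B ∩ D) := hB.inter hD
  have hBf : volume (B ∩ D) ≠ ⊤ := ((measure_mono inter_subset_right).trans_lt hDf.lt_top).ne
  -- Tested on one set of finite measure, the linear inequality is a closed condition on the path;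
  -- all such sets together recover it almost everywhere.
  have hclosed : IsClosed {w : PathSpace d γ T G |
      (∫ x in B ∩ D, inner ℝ α (density w t x)) + ∫ x in B ∩ D, inner ℝ β (momentum w t x)
        ≤ ∫ x in B ∩ D, h x} := by
    refine isClosed_le ?_ continuous_const
    exact (continuous_setIntegral_density hBD hBf α t).add
      (continuous_setIntegral_momentum hBD hBf β t)
  have heq : ∀ w : PathSpace d γ T G,
      ∫ x in B ∩ D, (α * density w t x + inner ℝ β (momentum w t x))
        = (∫ x in B ∩ D, inner ℝ α (density w t x))
          + ∫ x in B ∩ D, inner ℝ β (momentum w t x) := fun w => by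
    simp only [hin]
    exact integral_add ((hint w n).1.mono_set inter_subset_right)
      ((hint w n).2.mono_set inter_subset_right)
  rw [heq]
  have hsubset : A ⊆ {w : PathSpace d γ T G |
      (∫ x in B ∩ D, inner ℝ α (density w t x)) + ∫ x in B ∩ D, inner ℝ β (momentum w t x)
        ≤ ∫ x in B ∩ D, h x} := fun w hw => by
    rw [mem_ofPred_eq, ← heq]
    refine setIntegral_mono_ae_restrict ((hsum w).mono_set inter_subset_right)
      ((hh n).mono_set inter_subset_right) ?_
    exact ae_restrict_of_ae_restrict_of_subset (inter_subset_right.trans inter_subset_left)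
      (hA w hw)
  exact closure_minimal hsubset hclosed hw

/-- The subsolutions that witness membership in `X₀`. -/
structure IsWitness (π : Vec d →+ G) (Ω : Set G) (z₀ : Fields d G) (w : PathSpace d γ T G)
    (z : Fields d G) : Prop where
  Q_eq : z.Q = z₀.Q
  sub : IsSubsolution π Ω w z
  outside : ∀ᵐ q ∂((volume : Measure (ℝ × G)).restrict (Ioo 0 T ×ˢ Ωᶜ)),
    z.ρ q.1 q.2 = z₀.ρ q.1 q.2 ∧ z.m q.1 q.2 = z₀.m q.1 q.2 ∧ z.M q.1 q.2 = z₀.M q.1 q.2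
  cont_ρ : ContinuousOn (fun q : ℝ × G => z.ρ q.1 q.2) (Icc 0 T ×ˢ Ω)
  cont_m : ContinuousOn (fun q : ℝ × G => z.m q.1 q.2) (Icc 0 T ×ˢ Ω)
  cont_M : ContinuousOn (fun q : ℝ × G => z.M q.1 q.2) (Icc 0 T ×ˢ Ω)
  cont_Q : ContinuousOn (fun q : ℝ × G => z.Q q.1 q.2) (Icc 0 T ×ˢ Ω)
  strict : ∀ t ∈ Ioo 0 T, ∀ x ∈ Ω,
    z.Q t x > pressure γ (z.ρ t x) + 2 / (d : ℝ) * eKin (z.ρ t x) (z.m t x) (z.M t x) ∧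
    pressure γ (z.ρ t x) + 2 / (d : ℝ) * eKin (z.ρ t x) (z.m t x) (z.M t x) >
      pressure γ (z.ρ t x) + ‖z.m t x‖ ^ 2 / (d * z.ρ t x)

lemma mem_spaceX₀ {w : PathSpace d γ T G} : w ∈ spaceX₀ π Ω z₀ mref ↔
    (∀ t : Icc (0 : ℝ) T, ∃ C : Set G, IsCompact C ∧ C ⊆ Ω ∧
      ∀ᵐ x : G, x ∉ C → momentum w t x = mref t x) ∧ AgreesAtEndpoints z₀ w ∧
      ∃ z : Fields d G, IsWitness π Ω z₀ w z := by
  simp only [spaceX₀, mem_ofPred_eq]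
  refine and_congr_right fun _ => and_congr_right fun _ => exists_congr fun z => ?_
  exact ⟨fun ⟨h1, h2, h3, h4, h5, h6, h7, h8⟩ => ⟨h1, h2, h3, h4, h5, h6, h7, h8⟩,
    fun ⟨h1, h2, h3, h4, h5, h6, h7, h8⟩ => ⟨h1, h2, h3, h4, h5, h6, h7, h8⟩⟩

lemma IsWitness.energy_lt {w : PathSpace d γ T G} {z : Fields d G} (h : IsWitness π Ω z₀ w z)
    {t : ℝ} (ht : t ∈ Ioo 0 T) {x : G} (hx : x ∈ Ω) :
    energy d γ (z.ρ t x) (z.m t x) < z₀.Q t x := by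
  have := h.strict t ht x hx
  rw [← h.Q_eq, energy]
  linarith [this.1, this.2]

lemma tangent_eq_linear (r : ℝ) (v : Vec d) (ρ : ℝ) (m : Vec d) :
    tangent d γ r v ρ m = (pressure γ r - γ * r ^ (γ - 1) * r)
      + ((γ * r ^ (γ - 1) - ‖v‖ ^ 2 / d) * ρ + inner ℝ ((2 / (d : ℝ)) • v) m) := by
  rw [tangent, inner_smul_left]
  simp only [conj_trivial]
  ring

/-- On X₀ convexity puts the tangent plane below f, and f is below Q. Being affine in (ρ, m), this
inequality survives weak closure, which f itself need not do in integrated equalities. All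
information about elements of X inside Ω is extracted from such planes. -/
lemma tangent_le_of_mem_spaceX (hΩ : IsOpen Ω) (hQ : IsGeneralizedPressure T Ω z₀.Q)
    {w : PathSpace d γ T G} (hw : w ∈ spaceX π Ω z₀ mref) {t : Icc (0 : ℝ) T}
    (ht : (t : ℝ) ∈ Ioo 0 T) {r : ℝ} (hr : 0 < r) (v : Vec d) :
    ∀ᵐ x ∂(volume : Measure G).restrict Ω,
      tangent d γ r v (density w t x) (momentum w t x) ≤ z₀.Q t x := by
  have hQt : ContinuousOn (z₀.Q t) (closure Ω) :=
    hQ.cont.comp (Continuous.prodMk_right (t : ℝ)).continuousOn fun x hx => ⟨ht, hx⟩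
  have key := ae_le_of_mem_closure (A := spaceX₀ π Ω z₀ mref) hΩ.measurableSet
    (α := γ * r ^ (γ - 1) - ‖v‖ ^ 2 / d)
    (β := (2 / (d : ℝ)) • v) (h := fun x => z₀.Q t x - (pressure γ r - γ * r ^ (γ - 1) * r))
    (fun n => by
      have hc : IsCompact (closure Ω ∩ compactCovering G n) :=
        (isCompact_compactCovering G n).inter_left isClosed_closure
      have h1 := (hQt.mono inter_subset_left).sub continuousOn_const |>.integrableOn_compact hc
        (μ := volume) (f := fun x => z₀.Q t x - (pressure γ r - γ * r ^ (γ - 1) * r))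
      exact h1.mono_set (inter_subset_inter_left _ subset_closure)) t (fun w hw => by
      obtain ⟨-, -, z, hz⟩ := mem_spaceX₀.1 hw
      filter_upwards [ae_restrict_mem hΩ.measurableSet,
        ae_restrict_of_ae (hz.sub.represents.eq_ρ t), ae_restrict_of_ae (hz.sub.represents.eq_m t)]
        with x hx h1 h2
      have h3 := tangent_le_energy hγ.out (hz.sub.density_pos t ht x) hr v (z.m t x)
      have h4 := hz.energy_lt ht hx
      rw [h1, h2]
      rw [tangent_eq_linear] at h3
      linarith) hw
  filter_upwards [key] with x hx
  rw [tangent_eq_linear]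
  linarith

lemma density_nonneg_of_mem_spaceX (hΩ : IsOpen Ω)
    {w : PathSpace d γ T G} (hw : w ∈ spaceX π Ω z₀ mref) {t : Icc (0 : ℝ) T}
    (ht : (t : ℝ) ∈ Ioo 0 T) :
    ∀ᵐ x ∂(volume : Measure G).restrict Ω, 0 ≤ density w t x := by
  have key := ae_le_of_mem_closure (A := spaceX₀ π Ω z₀ mref) hΩ.measurableSet
    (α := -1) (β := 0) (h := fun x => 0) (fun n => integrableOn_zero) t (fun w hw => by
      obtain ⟨-, -, z, hz⟩ := mem_spaceX₀.1 hw
      filter_upwards [ae_restrict_of_ae (hz.sub.represents.eq_ρ t)] with x h1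
      rw [h1, inner_zero_left]
      linarith [hz.sub.density_pos t ht x]) hw
  filter_upwards [key] with x hx
  rw [inner_zero_left] at hx
  linarith

lemma bounds_of_mem_spaceX (hd : 0 < d) (hΩ : IsOpen Ω) (hQ : IsGeneralizedPressure T Ω z₀.Q)
    {w : PathSpace d γ T G} (hw : w ∈ spaceX π Ω z₀ mref) {t : Icc (0 : ℝ) T}
    (ht : (t : ℝ) ∈ Ioo 0 T) :
    ∀ᵐ x ∂(volume : Measure G).restrict Ω, |density w t x| ≤ z₀.Q t x + γ ∧
      ∀ i, |momentum w t x i| ≤ d * (z₀.Q t x + γ) := by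
  have h1 : ∀ᵐ x ∂(volume : Measure G).restrict Ω, ∀ i : Fin d,
      tangent d γ 1 (EuclideanSpace.single i 1) (density w t x) (momentum w t x) ≤ z₀.Q t x :=
    ae_all_iff.2 fun i => tangent_le_of_mem_spaceX hΩ hQ hw ht one_pos _
  have h2 : ∀ᵐ x ∂(volume : Measure G).restrict Ω, ∀ i : Fin d,
      tangent d γ 1 (EuclideanSpace.single i (-1)) (density w t x) (momentum w t x) ≤ z₀.Q t x :=
    ae_all_iff.2 fun i => tangent_le_of_mem_spaceX hΩ hQ hw ht one_pos _
  filter_upwards [h1, h2, density_nonneg_of_mem_spaceX hΩ hw ht,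
    tangent_le_of_mem_spaceX hΩ hQ hw ht one_pos 0] with x h1 h2 h3 h4
  exact bounds_of_tangent_le hd hγ.out h3 h4 h1 h2

/-- X₀ prescribes the values outside Ω only almost everywhere in space-time. Weak continuity in time
and continuity of z₀ upgrade this to every time. -/
lemma eq_outside_of_mem_spaceX₀ (hT : 0 < T) (hΩ : IsOpen Ω)
    (hz₀ : IsStrictSubsolution π γ T Ω z₀) {w : PathSpace d γ T G}
    (hw : w ∈ spaceX₀ π Ω z₀ mref) (t : Icc (0 : ℝ) T) :
    ∀ᵐ x ∂(volume : Measure G).restrict Ωᶜ,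
      density w t x = z₀.ρ t x ∧ momentum w t x = z₀.m t x := by
  obtain ⟨-, -, z, hz⟩ := mem_spaceX₀.1 hw
  have hae : ∀ᵐ s ∂(volume : Measure ℝ).restrict (Icc 0 T),
      ∀ᵐ x ∂(volume : Measure G).restrict Ωᶜ,
      density w (projIcc 0 T hT.le s) x = z₀.ρ s x ∧
        momentum w (projIcc 0 T hT.le s) x = z₀.m s x := by
    have h := hz.outside
    rw [restrict_prod_eq] at h
    rw [Measure.restrict_congr_set Ioo_ae_eq_Icc.symm]
    filter_upwards [Measure.ae_ae_of_ae_prod h, ae_restrict_mem measurableSet_Ioo] with s hs hsT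
    have hs' := hsT
    rw [projIcc_of_mem hT.le (Ioo_subset_Icc_self hsT)]
    filter_upwards [hs, ae_restrict_of_ae (hz.sub.represents.eq_ρ ⟨s, Ioo_subset_Icc_self hsT⟩),
      ae_restrict_of_ae (hz.sub.represents.eq_m ⟨s, Ioo_subset_Icc_self hsT⟩)] with x h1 h2 h3
    exact ⟨h2.trans h1.1, h3.trans h1.2.1⟩
  have h1 := ae_eq_of_ae_time hT hΩ.measurableSet.compl w.1 hz₀.cont_ρ (by
    filter_upwards [hae] with s hs
    filter_upwards [hs] with x hx
    exact hx.1) t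
  have h2 := ae_eq_of_ae_time hT hΩ.measurableSet.compl w.2 hz₀.cont_m (by
    filter_upwards [hae] with s hs
    filter_upwards [hs] with x hx
    exact hx.2) t
  filter_upwards [h1, h2] with x hx1 hx2
  exact ⟨hx1, hx2⟩

lemma eq_outside_of_mem_spaceX (hT : 0 < T) (hΩ : IsOpen Ω)
    (hz₀ : IsStrictSubsolution π γ T Ω z₀) {w : PathSpace d γ T G}
    (hw : w ∈ spaceX π Ω z₀ mref) (t : Icc (0 : ℝ) T) :
    ∀ᵐ x ∂(volume : Measure G).restrict Ωᶜ,
      density w t x = z₀.ρ t x ∧ momentum w t x = z₀.m t x := by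
  have hcρ : Continuous (z₀.ρ t) := by
    rw [← continuousOn_univ]
    exact hz₀.cont_ρ.comp (Continuous.prodMk_right (t : ℝ)).continuousOn
      fun x _ => ⟨t.2, mem_univ _⟩
  have hcm : Continuous (z₀.m t) := by
    rw [← continuousOn_univ]
    exact hz₀.cont_m.comp (Continuous.prodMk_right (t : ℝ)).continuousOn
      fun x _ => ⟨t.2, mem_univ _⟩
  -- An inequality for all (α, β) is an equality, since signs may be reversed.
  have key : ∀ (α : ℝ) (β : Vec d), ∀ᵐ x ∂(volume : Measure G).restrict Ωᶜ,
      α * density w t x + inner ℝ β (momentum w t x)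
        ≤ α * z₀.ρ t x + inner ℝ β (z₀.m t x) := fun α β =>
    ae_le_of_mem_closure (A := spaceX₀ π Ω z₀ mref) hΩ.measurableSet.compl
      (fun n => ((by fun_prop : Continuous fun x => α * z₀.ρ t x + inner ℝ β (z₀.m t x))
        |>.continuousOn.integrableOn_compact (isCompact_compactCovering G n)).mono_set
          inter_subset_right) t (fun w hw => by
        filter_upwards [eq_outside_of_mem_spaceX₀ hT hΩ hz₀ hw t] with x hx
        rw [hx.1, hx.2]) hw
  have h1 : ∀ᵐ x ∂(volume : Measure G).restrict Ωᶜ, ∀ i : Fin d,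
      momentum w t x i ≤ z₀.m t x i := ae_all_iff.2 fun i => by
    filter_upwards [key 0 (EuclideanSpace.single i 1)] with x hx
    simpa [EuclideanSpace.inner_single_left] using hx
  have h2 : ∀ᵐ x ∂(volume : Measure G).restrict Ωᶜ, ∀ i : Fin d,
      z₀.m t x i ≤ momentum w t x i := ae_all_iff.2 fun i => by
    filter_upwards [key 0 (EuclideanSpace.single i (-1))] with x hx
    simpa [EuclideanSpace.inner_single_left] using hx
  filter_upwards [key 1 0, key (-1) 0, h1, h2] with x k1 k2 k3 k4
  simp only [inner_zero_left, add_zero, one_mul, neg_mul, neg_le_neg_iff] at k1 k2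
  exact ⟨le_antisymm k1 k2, PiLp.ext fun i => le_antisymm (k3 i) (k4 i)⟩

lemma eq_path_of_agreesAtEndpoints {w w' : PathSpace d γ T G} (hw : AgreesAtEndpoints z₀ w)
    (hw' : AgreesAtEndpoints z₀ w') {t : Icc (0 : ℝ) T} (ht : (t : ℝ) = 0 ∨ (t : ℝ) = T) :
    w.1 t = w'.1 t ∧ w.2 t = w'.2 t := by
  have h1 := hw t ht
  have h2 := hw' t ht
  constructor
  · refine (toWeakSpace ℝ (Lp ℝ (ENNReal.ofReal γ) (volume : Measure G))).symm.injective ?_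
    exact Lp.ext (h1.1.trans h2.1.symm)
  · refine (toWeakSpace ℝ (Lp (Vec d) 2 (volume : Measure G))).symm.injective ?_
    exact Lp.ext (h1.2.trans h2.2.symm)

/-- All elements of X₀ have the same L^p classes at the endpoints. Agreement with one fixed element
is a closed condition, as the weak topology is Hausdorff. -/
lemma agreesAtEndpoints_of_mem_spaceX {w : PathSpace d γ T G} (hw : w ∈ spaceX π Ω z₀ mref) :
    AgreesAtEndpoints z₀ w := by
  obtain ⟨w', hw'⟩ : (spaceX₀ π Ω z₀ mref : Set (PathSpace d γ T G)).Nonempty := by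
    rw [← closure_nonempty_iff]
    exact ⟨w, hw⟩
  have hw'e := (mem_spaceX₀.1 hw').2.1
  intro t ht
  have : T2Space (WeakSpace ℝ (Lp ℝ (ENNReal.ofReal γ) (volume : Measure G))) := inferInstance
  have hclosed : IsClosed {w : PathSpace d γ T G | w.1 t = w'.1 t ∧ w.2 t = w'.2 t} :=
    (isClosed_eq (by fun_prop) continuous_const).inter (isClosed_eq (by fun_prop) continuous_const)
  obtain ⟨h1, h2⟩ := closure_minimal (fun u hu =>
    eq_path_of_agreesAtEndpoints (mem_spaceX₀.1 hu).2.1 hw'e ht) hclosed hw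
  have h3 := hw'e t ht
  constructor
  · rw [density_eq, pathFn, h1]
    exact h3.1
  · rw [momentum_eq, pathFn, h2]
    exact h3.2

/-! ### Joint statements in time and space -/

lemma exists_represents (hT : 0 < T) (w : PathSpace d γ T G) :
    ∃ (ρ : ℝ → G → ℝ) (m : ℝ → G → Vec d), Represents w ρ m := by
  obtain ⟨ρ, hρ1, hρ2⟩ := exists_measurable_representative ENNReal.ofReal_ne_top hT.le w.1
  obtain ⟨m, hm1, hm2⟩ := exists_measurable_representative (by simp) hT.le w.2
  exact ⟨ρ, m, hρ1.aestronglyMeasurable, hm1.aestronglyMeasurable, hρ2, hm2⟩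

lemma Represents.outside (hT : 0 < T) (hΩ : IsOpen Ω) (hz₀ : IsStrictSubsolution π γ T Ω z₀)
    {w : PathSpace d γ T G} (hw : w ∈ spaceX π Ω z₀ mref) {ρ : ℝ → G → ℝ} {m : ℝ → G → Vec d}
    (h : Represents w ρ m) :
    ∀ᵐ q ∂(volume : Measure (ℝ × G)).restrict (Ioo 0 T ×ˢ Ωᶜ),
      ρ q.1 q.2 = z₀.ρ q.1 q.2 ∧ m q.1 q.2 = z₀.m q.1 q.2 := by
  have hsub : Ioo 0 T ×ˢ Ωᶜ ⊆ slab T G := prod_mono subset_rfl (subset_univ _)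
  have hsub' : Ioo 0 T ×ˢ Ωᶜ ⊆ Icc 0 T ×ˢ (univ : Set G) :=
    prod_mono Ioo_subset_Icc_self (subset_univ _)
  have hmeas : MeasurableSet (Ioo 0 T ×ˢ Ωᶜ) := measurableSet_Ioo.prod hΩ.measurableSet.compl
  have m1 := h.meas_ρ.mono_set hsub
  have m2 := h.meas_m.mono_set hsub
  have m3 := (hz₀.cont_ρ.mono hsub').aestronglyMeasurable hmeas (μ := volume)
  have m4 := (hz₀.cont_m.mono hsub').aestronglyMeasurable hmeas (μ := volume)
  rw [restrict_prod_eq] at m1 m2 m3 m4 ⊢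
  have hall : ∀ᵐ t ∂(volume : Measure ℝ).restrict (Ioo 0 T),
      ∀ᵐ x ∂(volume : Measure G).restrict Ωᶜ, ρ t x = z₀.ρ t x ∧ m t x = z₀.m t x := by
    filter_upwards [ae_restrict_mem measurableSet_Ioo] with t ht
    filter_upwards [eq_outside_of_mem_spaceX hT hΩ hz₀ hw ⟨t, Ioo_subset_Icc_self ht⟩,
      ae_restrict_of_ae (h.eq_ρ ⟨t, Ioo_subset_Icc_self ht⟩),
      ae_restrict_of_ae (h.eq_m ⟨t, Ioo_subset_Icc_self ht⟩)] with x h1 h2 h3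
    exact ⟨h2.symm.trans h1.1, h3.symm.trans h1.2⟩
  have e1 := ae_eq_of_ae_ae_eq m1 m3 (by
    filter_upwards [hall] with t ht
    filter_upwards [ht] with x hx
    exact hx.1)
  have e2 := ae_eq_of_ae_ae_eq m2 m4 (by
    filter_upwards [hall] with t ht
    filter_upwards [ht] with x hx
    exact hx.2)
  filter_upwards [e1, e2] with q h1 h2
  exact ⟨h1, h2⟩

/-- Each tangent plane comes with its own null set. A countable dense family of parameters (r, v)
gives a common one, and continuity in the parameters covers all the others. -/
lemma Represents.inside (hΩ : IsOpen Ω) (hQ : IsGeneralizedPressure T Ω z₀.Q)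
    {w : PathSpace d γ T G} (hw : w ∈ spaceX π Ω z₀ mref) {ρ : ℝ → G → ℝ} {m : ℝ → G → Vec d}
    (h : Represents w ρ m) :
    ∀ᵐ q ∂(volume : Measure (ℝ × G)).restrict (Ioo 0 T ×ˢ Ω),
      0 ≤ ρ q.1 q.2 ∧ ∀ r > 0, ∀ v, tangent d γ r v (ρ q.1 q.2) (m q.1 q.2) ≤ z₀.Q q.1 q.2 := by
  have hsub : Ioo 0 T ×ˢ Ω ⊆ slab T G := prod_mono subset_rfl (subset_univ _)
  have hsub' : Ioo 0 T ×ˢ Ω ⊆ Ioo 0 T ×ˢ closure Ω := prod_mono subset_rfl subset_closure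
  have hmeas : MeasurableSet (Ioo 0 T ×ˢ Ω) := measurableSet_Ioo.prod hΩ.measurableSet
  have m1 := h.meas_ρ.mono_set hsub
  have m2 := h.meas_m.mono_set hsub
  have m3 := (hQ.cont.mono hsub').aestronglyMeasurable hmeas (μ := volume)
  rw [restrict_prod_eq] at m1 m2 m3 ⊢
  have h0 : ∀ᵐ q ∂((volume : Measure ℝ).restrict (Ioo 0 T)).prod
      ((volume : Measure G).restrict Ω), 0 ≤ ρ q.1 q.2 := by
    refine ae_le_of_ae_ae_le aemeasurable_const m1.aemeasurable ?_
    filter_upwards [ae_restrict_mem measurableSet_Ioo] with t ht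
    filter_upwards [density_nonneg_of_mem_spaceX hΩ hw (t := ⟨t, Ioo_subset_Icc_self ht⟩) ht,
      ae_restrict_of_ae (h.eq_ρ ⟨t, Ioo_subset_Icc_self ht⟩)] with x h1 h2
    exact h1.trans h2.le
  let seq : ℕ → Ioi (0 : ℝ) × Vec d := TopologicalSpace.denseSeq _
  have h1 : ∀ᵐ q ∂((volume : Measure ℝ).restrict (Ioo 0 T)).prod
      ((volume : Measure G).restrict Ω), ∀ n,
      tangent d γ (seq n).1 (seq n).2 (ρ q.1 q.2) (m q.1 q.2) ≤ z₀.Q q.1 q.2 := by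
    refine ae_all_iff.2 fun n => ?_
    refine ae_le_of_ae_ae_le (f := fun q => tangent d γ (seq n).1 (seq n).2 (ρ q.1 q.2)
      (m q.1 q.2)) (g := fun q => z₀.Q q.1 q.2) ?_ m3.aemeasurable ?_
    · simp only [tangent]
      refine AEStronglyMeasurable.aemeasurable ?_
      exact ((aestronglyMeasurable_const.add ((m1.sub aestronglyMeasurable_const).const_mul _)).add
        ((aestronglyMeasurable_const.inner m2).const_mul _)).sub (m1.const_mul _)
    · filter_upwards [ae_restrict_mem measurableSet_Ioo] with t ht
      filter_upwards [tangent_le_of_mem_spaceX hΩ hQ hw (t := ⟨t, Ioo_subset_Icc_self ht⟩) ht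
        (seq n).1.2 (seq n).2, ae_restrict_of_ae (h.eq_ρ ⟨t, Ioo_subset_Icc_self ht⟩),
        ae_restrict_of_ae (h.eq_m ⟨t, Ioo_subset_Icc_self ht⟩)] with x h1 h2 h3
      rwa [h2, h3] at h1
  filter_upwards [h0, h1] with q hq0 hq1
  refine ⟨hq0, fun r hr v => ?_⟩
  have hc : Continuous fun y : Ioi (0 : ℝ) × Vec d =>
      tangent d γ y.1 y.2 (ρ q.1 q.2) (m q.1 q.2) := by
    have hpow : ∀ e : ℝ, Continuous fun y : Ioi (0 : ℝ) × Vec d => (y.1 : ℝ) ^ e := fun e =>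
      (continuous_subtype_val.comp continuous_fst).rpow_const
        fun y => Or.inl (ne_of_gt y.1.2)
    have := hpow γ
    have := hpow (γ - 1)
    simp only [tangent, pressure]
    fun_prop
  have hcl : IsClosed {y : Ioi (0 : ℝ) × Vec d |
      tangent d γ y.1 y.2 (ρ q.1 q.2) (m q.1 q.2) ≤ z₀.Q q.1 q.2} :=
    isClosed_le hc continuous_const
  have hall := hcl.closure_subset_iff.2 (range_subset_iff.2 hq1)
  rw [(TopologicalSpace.denseRange_denseSeq (Ioi (0 : ℝ) × Vec d)).closure_range] at hall
  exact hall (mem_univ (⟨⟨r, hr⟩, v⟩ : Ioi (0 : ℝ) × Vec d))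

end SpaceX

/-- The bounds involve only Q, which is continuous; they supply the dominating functions and the
local integrability of the limit. -/
lemma bounds_of_energy_le {d : ℕ} {γ : ℝ} (hd : 0 < d) (hγ : 1 < γ) {ρ Q : ℝ} {m : Vec d}
    (hρ : 0 < ρ) (h : energy d γ ρ m ≤ Q) :
    |ρ| ≤ Q + γ ∧ (∀ i, |m i| ≤ d * (Q + γ)) ∧ (∀ i j, |ρ⁻¹ * (m i * m j)| ≤ d * Q) ∧
      0 ≤ pressure γ ρ ∧ pressure γ ρ ≤ Q := by
  have hd' : (0 : ℝ) < d := by exact_mod_cast hd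
  have hp : 0 ≤ pressure γ ρ := Real.rpow_nonneg hρ.le _
  have h1 : 0 ≤ ‖m‖ ^ 2 / (d * ρ) := by positivity
  have hle : ∀ v, tangent d γ 1 v ρ m ≤ Q := fun v =>
    (tangent_le_energy hγ hρ one_pos v m).trans h
  obtain ⟨b1, b2⟩ := bounds_of_tangent_le hd hγ hρ.le (hle _) (fun _ => hle _) (fun _ => hle _)
  rw [energy] at h
  refine ⟨b1, b2, fun i j => ?_, hp, by linarith⟩
  have hmi : ∀ i, |m i| ≤ ‖m‖ := fun i => by
    have := PiLp.norm_apply_le m i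
    rwa [Real.norm_eq_abs] at this
  rw [abs_mul, abs_mul, abs_of_pos (inv_pos.2 hρ)]
  calc ρ⁻¹ * (|m i| * |m j|) ≤ ρ⁻¹ * (‖m‖ * ‖m‖) := by
        gcongr
        · exact hmi i
        · exact hmi j
    _ = d * (‖m‖ ^ 2 / (d * ρ)) := by field_simp
    _ ≤ d * Q := by gcongr; linarith

/-! ### The integrated defect relative to the tangent planes of a subsolution -/

section Gap

variable {d : ℕ} {γ T : ℝ} [hγ : Fact (1 < γ)] {G : Type} [AddCommGroup G] [TopologicalSpace G]
  [MeasureSpace G] [BorelSpace G] [SecondCountableTopology G] [LocallyCompactSpace G] [T2Space G]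
  [IsLocallyFiniteMeasure (volume : Measure G)] {π : Vec d →+ G} {Ω : Set G} {z₀ : Fields d G}
  {mref : ℝ → G → Vec d}

/-- A compact box `[a, b] × D` in `(0, T) × Ω`. -/
structure IsBox (T : ℝ) (Ω : Set G) (a b : ℝ) (D : Set G) : Prop where
  le : a ≤ b
  time : Icc a b ⊆ Ioo 0 T
  compact : IsCompact D
  space : D ⊆ Ω

section Box

variable {a b : ℝ} {D : Set G}

lemma IsBox.subset (h : IsBox T Ω a b D) : Icc a b ×ˢ D ⊆ Ioo 0 T ×ˢ Ω :=
  prod_mono h.time h.space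

lemma IsBox.subset' (h : IsBox T Ω a b D) : Icc a b ×ˢ D ⊆ Icc 0 T ×ˢ Ω :=
  prod_mono (h.time.trans Ioo_subset_Icc_self) h.space

lemma IsBox.isCompact (h : IsBox T Ω a b D) : IsCompact (Icc a b ×ˢ D) :=
  isCompact_Icc.prod h.compact

lemma IsBox.measurableSet (h : IsBox T Ω a b D) : MeasurableSet (Icc a b ×ˢ D) :=
  measurableSet_Icc.prod h.compact.isClosed.measurableSet

/-- The coefficients of the tangent plane at the state of `z`. -/
def coeffConst (γ : ℝ) (z : Fields d G) (t : ℝ) (x : G) : ℝ :=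
  z.Q t x - (pressure γ (z.ρ t x) - γ * z.ρ t x ^ (γ - 1) * z.ρ t x)

/-- The coefficient of the density. -/
def coeffDensity (γ : ℝ) (z : Fields d G) (t : ℝ) (x : G) : ℝ :=
  γ * z.ρ t x ^ (γ - 1) - ‖(z.ρ t x)⁻¹ • z.m t x‖ ^ 2 / d

/-- The coefficient of the momentum. -/
def coeffMomentum (z : Fields d G) (t : ℝ) (x : G) : Vec d :=
  (2 / (d : ℝ)) • (z.ρ t x)⁻¹ • z.m t x

/-- The defect of a state relative to the tangent plane at the state of `z`. -/
def gapFun (γ : ℝ) (z : Fields d G) (q : ℝ × G) (ρ : ℝ) (m : Vec d) : ℝ :=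
  z.Q q.1 q.2 - tangent d γ (z.ρ q.1 q.2) ((z.ρ q.1 q.2)⁻¹ • z.m q.1 q.2) ρ m

lemma gapFun_eq (z : Fields d G) (q : ℝ × G) (ρ : ℝ) (m : Vec d) :
    gapFun γ z q ρ m = coeffConst γ z q.1 q.2 - inner ℝ (coeffDensity γ z q.1 q.2) ρ
      - inner ℝ (coeffMomentum z q.1 q.2) m := by
  have : inner ℝ (coeffDensity γ z q.1 q.2) ρ = coeffDensity γ z q.1 q.2 * ρ := by
    simp [mul_comm]
  rw [this, gapFun, tangent_eq_linear, coeffConst, coeffDensity, coeffMomentum]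
  ring

/-- The integrated defect of the path `w` over a box, relative to the tangent planes at `z`. -/
def gap (hT : 0 < T) (a b : ℝ) (D : Set G) (z : Fields d G) (w : PathSpace d γ T G) : ℝ :=
  (∫ q in Icc a b ×ˢ D, coeffConst γ z q.1 q.2)
    - (∫ t in Icc a b, ∫ x in D,
        inner ℝ (coeffDensity γ z t x) (density w (projIcc 0 T hT.le t) x))
    - ∫ t in Icc a b, ∫ x in D,
        inner ℝ (coeffMomentum z t x) (momentum w (projIcc 0 T hT.le t) x)

lemma IsWitness.continuousOn_coeff {w : PathSpace d γ T G} {z : Fields d G}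
    (hz : IsWitness π Ω z₀ w z) (hB : IsBox T Ω a b D) :
    ContinuousOn (fun q : ℝ × G => coeffConst γ z q.1 q.2) (Icc a b ×ˢ D) ∧
    ContinuousOn (fun q : ℝ × G => coeffDensity γ z q.1 q.2) (Icc a b ×ˢ D) ∧
    ContinuousOn (fun q : ℝ × G => coeffMomentum z q.1 q.2) (Icc a b ×ˢ D) := by
  have c1 := hz.cont_ρ.mono hB.subset'
  have c2 := hz.cont_m.mono hB.subset'
  have c3 := hz.cont_Q.mono hB.subset'
  have hne : ∀ q ∈ Icc a b ×ˢ D, z.ρ q.1 q.2 ≠ 0 := fun q hq =>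
    (hz.sub.density_pos q.1 (hB.time hq.1) q.2).ne'
  have hp : ∀ e : ℝ, ContinuousOn (fun q : ℝ × G => z.ρ q.1 q.2 ^ e) (Icc a b ×ˢ D) := fun e =>
    c1.rpow_const fun q hq => Or.inl (hne q hq)
  have hv := (c1.inv₀ hne).smul c2
  exact ⟨c3.sub ((hp γ).sub (((hp (γ - 1)).const_mul γ).mul c1)),
    ((hp (γ - 1)).const_mul γ).sub ((hv.norm.pow 2).div_const _), hv.const_smul (2 / (d : ℝ))⟩

lemma Represents.ae_bounds (hd : 0 < d) (hΩ : IsOpen Ω) (hQ : IsGeneralizedPressure T Ω z₀.Q)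
    {w : PathSpace d γ T G} (hw : w ∈ spaceX π Ω z₀ mref) {ρ : ℝ → G → ℝ} {m : ℝ → G → Vec d}
    (h : Represents w ρ m) :
    ∀ᵐ q ∂(volume : Measure (ℝ × G)).restrict (Ioo 0 T ×ˢ Ω),
      |ρ q.1 q.2| ≤ z₀.Q q.1 q.2 + γ ∧ ∀ i, |m q.1 q.2 i| ≤ d * (z₀.Q q.1 q.2 + γ) := by
  filter_upwards [h.inside hΩ hQ hw] with q hq
  exact bounds_of_tangent_le hd hγ.out hq.1 (hq.2 1 one_pos _) (fun i => hq.2 1 one_pos _)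
    (fun i => hq.2 1 one_pos _)

lemma norm_le_of_abs_le {v : Vec d} {C : ℝ} (h : ∀ i, |v i| ≤ C) : ‖v‖ ≤ d * C := by
  have h1 : v = ∑ i, v i • (EuclideanSpace.single i 1 : Vec d) := by
    ext j
    simp [Pi.single_apply]
  calc ‖v‖ = ‖∑ i, v i • (EuclideanSpace.single i 1 : Vec d)‖ := by rw [← h1]
    _ ≤ ∑ i, ‖v i • (EuclideanSpace.single i 1 : Vec d)‖ := norm_sum_le _ _
    _ ≤ ∑ _i : Fin d, C := by
        refine Finset.sum_le_sum fun i _ => ?_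
        rw [norm_smul, PiLp.norm_single, norm_one, mul_one]
        exact h i
    _ = d * C := by simp

lemma IsBox.exists_bound (hB : IsBox T Ω a b D) (hQ : IsGeneralizedPressure T Ω z₀.Q) :
    ∃ C : ℝ, 0 ≤ C ∧ ∀ q ∈ Icc a b ×ˢ D, z₀.Q q.1 q.2 ≤ C := by
  obtain ⟨C, hC⟩ := hB.isCompact.exists_bound_of_continuousOn
    (hQ.cont.mono (hB.subset.trans (prod_mono subset_rfl subset_closure)))
  exact ⟨max C 0, le_max_right _ _, fun q hq =>
    (le_abs_self _).trans ((hC q hq).trans (le_max_left _ _))⟩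

lemma IsBox.integrableOn (hd : 0 < d) (hΩ : IsOpen Ω) (hQ : IsGeneralizedPressure T Ω z₀.Q)
    (hB : IsBox T Ω a b D) {w : PathSpace d γ T G} (hw : w ∈ spaceX π Ω z₀ mref)
    {ρ : ℝ → G → ℝ} {m : ℝ → G → Vec d} (h : Represents w ρ m) :
    IntegrableOn (fun q : ℝ × G => ρ q.1 q.2) (Icc a b ×ˢ D) ∧
      IntegrableOn (fun q : ℝ × G => m q.1 q.2) (Icc a b ×ˢ D) := by
  obtain ⟨C, hC0, hC⟩ := hB.exists_bound hQ
  have hsub : Icc a b ×ˢ D ⊆ slab T G := hB.subset.trans (prod_mono subset_rfl (subset_univ _))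
  have hb := ae_restrict_of_ae_restrict_of_subset hB.subset (h.ae_bounds hd hΩ hQ hw)
  have : IsFiniteMeasure ((volume : Measure (ℝ × G)).restrict (Icc a b ×ˢ D)) :=
    ⟨by simpa using hB.isCompact.measure_lt_top⟩
  constructor
  · refine Integrable.of_bound (h.meas_ρ.mono_set hsub) (C + γ) ?_
    filter_upwards [hb, ae_restrict_mem hB.measurableSet] with q h1 h2
    exact h1.1.trans (by linarith [hC q h2])
  · refine Integrable.of_bound (h.meas_m.mono_set hsub) (d * (d * (C + γ))) ?_
    filter_upwards [hb, ae_restrict_mem hB.measurableSet] with q h1 h2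
    refine norm_le_of_abs_le fun i => (h1.2 i).trans ?_
    have := hC q h2
    gcongr

lemma integrableOn_inner_box {E : Type} [NormedAddCommGroup E] [InnerProductSpace ℝ E]
    (hB : IsBox T Ω a b D) {g f : ℝ × G → E} (hg : ContinuousOn g (Icc a b ×ˢ D))
    (hf : IntegrableOn f (Icc a b ×ˢ D)) :
    IntegrableOn (fun q => inner ℝ (g q) (f q)) (Icc a b ×ˢ D) := by
  obtain ⟨C, hC⟩ := hB.isCompact.exists_bound_of_continuousOn hg
  refine Integrable.mono' (hf.norm.const_mul C)
    ((hg.aestronglyMeasurable_of_isCompact hB.isCompact hB.measurableSet).inner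
      hf.aestronglyMeasurable) ?_
  filter_upwards [ae_restrict_mem hB.measurableSet] with q hq
  exact (norm_inner_le_norm _ _).trans (mul_le_mul_of_nonneg_right (hC q hq) (norm_nonneg _))

lemma IsBox.integrableOn_gapFun (hd : 0 < d) (hΩ : IsOpen Ω)
    (hQ : IsGeneralizedPressure T Ω z₀.Q) (hB : IsBox T Ω a b D) {w w' : PathSpace d γ T G}
    (hw : w ∈ spaceX π Ω z₀ mref) {z : Fields d G} (hz : IsWitness π Ω z₀ w' z)
    {ρ : ℝ → G → ℝ} {m : ℝ → G → Vec d} (h : Represents w ρ m) :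
    IntegrableOn (fun q : ℝ × G => gapFun γ z q (ρ q.1 q.2) (m q.1 q.2)) (Icc a b ×ˢ D) := by
  obtain ⟨i1, i2⟩ := hB.integrableOn hd hΩ hQ hw h
  obtain ⟨c1, c2, c3⟩ := hz.continuousOn_coeff hB
  simp only [gapFun_eq]
  exact ((c1.integrableOn_compact hB.isCompact).sub (integrableOn_inner_box hB c2 i1)).sub
    (integrableOn_inner_box hB c3 i2)

/-- `gap` is defined through pairings at fixed times, where weak continuity applies; Fubini for a
jointly measurable representative turns it into a space-time integral, where the pointwise
inequalities apply. -/
lemma gap_eq (hT : 0 < T) (hd : 0 < d) (hΩ : IsOpen Ω)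
    (hQ : IsGeneralizedPressure T Ω z₀.Q) (hB : IsBox T Ω a b D) {w w' : PathSpace d γ T G}
    (hw : w ∈ spaceX π Ω z₀ mref) {z : Fields d G} (hz : IsWitness π Ω z₀ w' z)
    {ρ : ℝ → G → ℝ} {m : ℝ → G → Vec d} (h : Represents w ρ m) :
    gap hT a b D z w = ∫ q in Icc a b ×ˢ D, gapFun γ z q (ρ q.1 q.2) (m q.1 q.2) := by
  obtain ⟨i1, i2⟩ := hB.integrableOn hd hΩ hQ hw h
  obtain ⟨c1, c2, c3⟩ := hz.continuousOn_coeff hB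
  have j2 := integrableOn_inner_box hB c2 i1
  have j3 := integrableOn_inner_box hB c3 i2
  have j1 := c1.integrableOn_compact hB.isCompact (μ := volume)
  simp only [gapFun_eq]
  have e1 := (integral_sub (j1.sub j2) j3).trans (congrArg (fun s : ℝ => s - _)
    (integral_sub j1 j2))
  refine Eq.trans ?_ e1.symm
  rw [gap]
  have e2 := setIntegral_prod (μ := (volume : Measure ℝ)) (ν := (volume : Measure G)) _ j2
  have e3 := setIntegral_prod (μ := (volume : Measure ℝ)) (ν := (volume : Measure G)) _ j3
  rw [← Measure.volume_eq_prod] at e2 e3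
  rw [e2, e3]
  congr 1
  · congr 1
    refine setIntegral_congr_fun measurableSet_Icc fun t ht => integral_congr_ae ?_
    have ht' : t ∈ Icc 0 T := Ioo_subset_Icc_self (hB.time ht)
    filter_upwards [ae_restrict_of_ae (h.eq_ρ ⟨t, ht'⟩)] with x hx
    rw [projIcc_of_mem hT.le ht', hx]
  · refine setIntegral_congr_fun measurableSet_Icc fun t ht => integral_congr_ae ?_
    have ht' : t ∈ Icc 0 T := Ioo_subset_Icc_self (hB.time ht)
    filter_upwards [ae_restrict_of_ae (h.eq_m ⟨t, ht'⟩)] with x hx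
    rw [projIcc_of_mem hT.le ht', hx]

/-- The coefficients are continuous on the box, so the gap is a pairing as in
`continuousOn_pairing`. The uniform L¹ bound that this requires comes from the pointwise bounds
valid for all elements of X. -/
lemma continuousOn_gap (hT : 0 < T) (hd : 0 < d) (hΩ : IsOpen Ω)
    (hQ : IsGeneralizedPressure T Ω z₀.Q) (hB : IsBox T Ω a b D) {w' : PathSpace d γ T G}
    {z : Fields d G} (hz : IsWitness π Ω z₀ w' z) :
    ContinuousOn (gap (γ := γ) hT a b D z) (spaceX π Ω z₀ mref) := by
  obtain ⟨c1, c2, c3⟩ := hz.continuousOn_coeff hB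
  obtain ⟨C, hC0, hC⟩ := hB.exists_bound hQ
  have hDm := hB.compact.isClosed.measurableSet
  have hT' : Icc a b ⊆ Icc 0 T := hB.time.trans Ioo_subset_Icc_self
  have hfin : IsFiniteMeasure ((volume : Measure G).restrict D) :=
    ⟨by simpa using hB.compact.measure_lt_top⟩
  have b1 : ∀ w ∈ (spaceX π Ω z₀ mref : Set (PathSpace d γ T G)), ∀ t : Icc (0 : ℝ) T,
      (t : ℝ) ∈ Icc a b → ∫ x in D, ‖density w t x‖ ≤ ∫ x in D, (C + γ) := by
    intro w hw t ht
    refine integral_mono_ae (integrableOn_pathFn (pathFn w.1 t) hB.compact).norm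
      (integrable_const _) ?_
    filter_upwards [ae_restrict_of_ae_restrict_of_subset hB.space
      (bounds_of_mem_spaceX hd hΩ hQ hw (hB.time ht)), ae_restrict_mem hDm] with x h1 h2
    exact h1.1.trans (by linarith [hC (t, x) ⟨ht, h2⟩])
  have b2 : ∀ w ∈ (spaceX π Ω z₀ mref : Set (PathSpace d γ T G)), ∀ t : Icc (0 : ℝ) T,
      (t : ℝ) ∈ Icc a b → ∫ x in D, ‖momentum w t x‖ ≤ ∫ x in D, d * (d * (C + γ)) := by
    intro w hw t ht
    refine integral_mono_ae (integrableOn_pathFn (pathFn w.2 t) hB.compact).norm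
      (integrable_const _) ?_
    filter_upwards [ae_restrict_of_ae_restrict_of_subset hB.space
      (bounds_of_mem_spaceX hd hΩ hQ hw (hB.time ht)), ae_restrict_mem hDm] with x h1 h2
    refine norm_le_of_abs_le fun i => (h1.2 i).trans ?_
    have := hC (t, x) ⟨ht, h2⟩
    gcongr
  have p1 := continuousOn_pairing (E := ℝ) (p := ENNReal.ofReal γ) (T := T) hB.compact hT.le hB.le
    hT' c2 (S := Prod.fst '' (spaceX π Ω z₀ mref : Set (PathSpace d γ T G)))
    (C := ∫ x in D, (C + γ)) (by
      rintro _ ⟨w, hw, rfl⟩ t ht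
      exact b1 w hw t ht)
  have p2 := continuousOn_pairing (E := Vec d) (p := 2) (T := T) hB.compact hT.le hB.le
    hT' c3 (S := Prod.snd '' (spaceX π Ω z₀ mref : Set (PathSpace d γ T G)))
    (C := ∫ x in D, d * (d * (C + γ))) (by
      rintro _ ⟨w, hw, rfl⟩ t ht
      exact b2 w hw t ht)
  have q1 := p1.comp continuous_fst.continuousOn (mapsTo_image _ _)
  have q2 := p2.comp continuous_snd.continuousOn (mapsTo_image _ _)
  exact (continuousOn_const.sub q1).sub q2

end Box

end Gap

/-! ### Exact solutions as limits of subsolutions -/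

/-- The series of the truncated functions has finite integral, so it converges almost everywhere and
its terms tend to zero. Each point lies in all but finitely many B n, where the truncation does
nothing. -/
lemma ae_tendsto_zero_of_summable {α : Type*} [MeasurableSpace α] {μ : Measure α}
    {B : ℕ → Set α} {S : Set α} {F : ℕ → α → ℝ} (hS : MeasurableSet S)
    (hB : ∀ n, MeasurableSet (B n))
    (hBS : ∀ n, B n ⊆ S) (hcov : ∀ q ∈ S, ∀ᶠ n in atTop, q ∈ B n)
    (hF : ∀ n, IntegrableOn (F n) (B n) μ) (hF0 : ∀ n, ∀ᵐ q ∂μ.restrict S, 0 ≤ F n q)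
    (hlt : ∀ n, ∫ q in B n, F n q ∂μ ≤ (1 / 2) ^ n) :
    ∀ᵐ q ∂μ.restrict S, Tendsto (fun n => F n q) atTop (𝓝 0) := by
  let f : ℕ → α → ℝ≥0∞ := fun n => (B n).indicator fun q => ENNReal.ofReal (F n q)
  have hf : ∀ n, AEMeasurable (f n) (μ.restrict S) := fun n => by
    refine AEMeasurable.restrict ?_
    exact (aemeasurable_indicator_iff (hB n)).2 (hF n).aestronglyMeasurable.aemeasurable.ennreal_ofReal
  have hsum : ∫⁻ q in S, ∑' n, f n q ∂μ ≠ ⊤ := by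
    rw [lintegral_tsum hf]
    have hle : ∀ n, ∫⁻ q in S, f n q ∂μ ≤ ENNReal.ofReal ((1 / 2) ^ n) := fun n => by
      rw [lintegral_indicator (hB n), Measure.restrict_restrict (hB n),
        inter_eq_left.2 (hBS n), ← ofReal_integral_eq_lintegral_ofReal (hF n)
          (ae_restrict_of_ae_restrict_of_subset (hBS n) (hF0 n))]
      exact ENNReal.ofReal_le_ofReal (hlt n)
    refine ne_top_of_le_ne_top ?_ (ENNReal.tsum_le_tsum hle)
    rw [← ENNReal.ofReal_tsum_of_nonneg (fun n => by positivity) summable_geometric_two]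
    exact ENNReal.ofReal_ne_top
  have hfin := ae_lt_top' (AEMeasurable.tsum hf) hsum
  filter_upwards [hfin, ae_all_iff.2 hF0, ae_restrict_mem hS] with q h1 h2 h3
  have h4 := ENNReal.tendsto_atTop_zero_of_tsum_ne_top h1.ne
  have h5 := (ENNReal.tendsto_toReal (by simp : (0 : ℝ≥0∞) ≠ ⊤)).comp h4
  simp only [ENNReal.toReal_zero] at h5
  refine h5.congr' ?_
  filter_upwards [hcov q h3] with n hn
  simp only [f, Function.comp, indicator_of_mem hn]
  exact ENNReal.toReal_ofReal (h2 n)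

section Exact

variable {d : ℕ} {γ T : ℝ} [hγ : Fact (1 < γ)] {G : Type} [AddCommGroup G] [TopologicalSpace G]
  [MeasureSpace G] [BorelSpace G] [SecondCountableTopology G] [LocallyCompactSpace G] [T2Space G]
  [IsLocallyFiniteMeasure (volume : Measure G)] {π : Vec d →+ G} {Ω : Set G} {z₀ : Fields d G}
  {mref : ℝ → G → Vec d}

lemma slab_ae {P : ℝ × G → Prop}
    (h1 : ∀ᵐ q ∂(volume : Measure (ℝ × G)).restrict (Ioo 0 T ×ˢ Ω), P q)
    (h2 : ∀ᵐ q ∂(volume : Measure (ℝ × G)).restrict (Ioo 0 T ×ˢ Ωᶜ), P q) :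
    ∀ᵐ q ∂(volume : Measure (ℝ × G)).restrict (slab T G), P q := by
  have : slab T G = Ioo 0 T ×ˢ Ω ∪ Ioo 0 T ×ˢ Ωᶜ := by
    rw [← prod_union, union_compl_self]
    rfl
  rw [this, ae_restrict_union_iff]
  exact ⟨h1, h2⟩

lemma isOpen_slab : IsOpen (slab T G) := isOpen_Ioo.prod isOpen_univ

lemma locallyIntegrableOn_slab {E : Type} [NormedAddCommGroup E] {F : ℝ × G → E} {H : ℝ × G → ℝ}
    (hH : ContinuousOn H (slab T G)) (hF : AEStronglyMeasurable F (volume.restrict (slab T G)))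
    (hle : ∀ᵐ q ∂(volume : Measure (ℝ × G)).restrict (slab T G), ‖F q‖ ≤ H q) :
    LocallyIntegrableOn F (slab T G) := by
  intro q hq
  obtain ⟨U, hU, hUi⟩ := hH.locallyIntegrableOn (μ := volume) isOpen_slab.measurableSet q hq
  refine ⟨U ∩ slab T G, inter_mem hU self_mem_nhdsWithin, ?_⟩
  refine Integrable.mono' (hUi.mono_set inter_subset_left) (hF.mono_set inter_subset_right) ?_
  exact ae_restrict_of_ae_restrict_of_subset inter_subset_right hle

/-- Dominated convergence for integrals against test functions. -/
lemma integral_slab_eq_zero_of_tendsto {F : ℕ → ℝ × G → ℝ} {f H : ℝ × G → ℝ} {K : Set (ℝ × G)}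
    (hK : IsCompact K) (hKs : K ⊆ slab T G) (hH : ContinuousOn H (slab T G))
    (hF : ∀ n, AEStronglyMeasurable (F n) (volume.restrict (slab T G)))
    (h0 : ∀ n, ∀ q ∉ K, F n q = 0)
    (hle : ∀ n, ∀ᵐ q ∂(volume : Measure (ℝ × G)).restrict (slab T G), |F n q| ≤ H q)
    (hlim : ∀ᵐ q ∂(volume : Measure (ℝ × G)).restrict (slab T G),
      Tendsto (fun n => F n q) atTop (𝓝 (f q)))
    (hzero : ∀ n, ∫ q in slab T G, F n q = 0) : ∫ q in slab T G, f q = 0 := by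
  have hKm : MeasurableSet K := hK.isClosed.measurableSet
  have hbound : IntegrableOn (K.indicator fun q => |H q|) (slab T G) := by
    have : IntegrableOn (fun q => |H q|) K := ((hH.mono hKs).integrableOn_compact hK).norm
    exact ((integrable_indicator_iff hKm).2 this).integrableOn
  have := tendsto_integral_of_dominated_convergence (μ := volume.restrict (slab T G)) (F := F)
    (f := f) _ hF hbound (fun n => by
      filter_upwards [hle n] with q hq
      by_cases hqK : q ∈ K
      · rw [indicator_of_mem hqK]
        exact hq.trans (le_abs_self _)
      · rw [indicator_of_notMem hqK, h0 n q hqK, norm_zero]) hlim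
  simp only [hzero] at this
  exact tendsto_nhds_unique this tendsto_const_nhds |>.symm ▸ rfl

lemma IsStrictSubsolution.energy_eq (hd : 0 < d) (hz₀ : IsStrictSubsolution π γ T Ω z₀) {t : ℝ}
    (ht : t ∈ Ioo 0 T) {x : G} (hx : x ∉ Ω) :
    z₀.Q t x = energy d γ (z₀.ρ t x) (z₀.m t x) ∧ ∀ i j, z₀.M t x i j
      + (if i = j then z₀.Q t x else 0) = (z₀.ρ t x)⁻¹ * (z₀.m t x i * z₀.m t x j)
        + if i = j then pressure γ (z₀.ρ t x) else 0 := by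
  have hd' : (0 : ℝ) < d := by exact_mod_cast hd
  obtain ⟨h1, h2, h3⟩ := hz₀.outside t ht x hx
  simp only at h1 h2 h3
  refine ⟨h3, fun i j => ?_⟩
  rw [h2, h3]
  simp only [tracelessSq, tensorSq, Matrix.smul_apply, Matrix.sub_apply, Matrix.of_apply,
    Matrix.one_apply, smul_eq_mul]
  split_ifs
  · field_simp
    ring
  · ring

/-- The paths w' n are not assumed to approach w; small gaps are enough. Their integrands are
nonnegative with summable integrals, so they tend to zero almost everywhere, and `exact_of_tendsto`
gives both the constraint and the pointwise convergence of the witnesses. Their fluxes converge by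
`tendsto_flux`, with bounds in terms of Q alone, so the linear equations pass to the limit. Outside
Ω the witnesses already agree with z₀. -/
theorem isExactSolution_of_seq (hπ : IsLocalModel π) (hT : 0 < T) (hd : 0 < d) (hΩ : IsOpen Ω)
    (hQ : IsGeneralizedPressure T Ω z₀.Q) (hz₀ : IsStrictSubsolution π γ T Ω z₀)
    {w : PathSpace d γ T G} (hw : w ∈ spaceX π Ω z₀ mref) {a b : ℕ → ℝ} {D : ℕ → Set G}
    (hB : ∀ n, IsBox T Ω (a n) (b n) (D n))
    (hcov : ∀ q ∈ Ioo 0 T ×ˢ Ω, ∀ᶠ n in atTop, q ∈ Icc (a n) (b n) ×ˢ D n)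
    {w' : ℕ → PathSpace d γ T G} {z : ℕ → Fields d G} (hz : ∀ n, IsWitness π Ω z₀ (w' n) (z n))
    (hgap : ∀ n, gap hT (a n) (b n) (D n) (z n) w < (1 / 2) ^ n) : IsExactSolution π Ω z₀ w := by
  have hd' : (0 : ℝ) < d := by exact_mod_cast hd
  obtain ⟨ρ, m, hrep⟩ := exists_represents hT w
  have hΩm : MeasurableSet (Ioo 0 T ×ˢ Ω) := measurableSet_Ioo.prod hΩ.measurableSet
  have hΩm' : MeasurableSet (Ioo 0 T ×ˢ Ωᶜ) := measurableSet_Ioo.prod hΩ.measurableSet.compl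
  have hslm : MeasurableSet (slab T G) := isOpen_slab.measurableSet
  have hin := hrep.inside hΩ hQ hw
  have hout := hrep.outside hT hΩ hz₀ hw
  have hQc : ContinuousOn (fun q : ℝ × G => z₀.Q q.1 q.2) (slab T G) :=
    hz₀.cont_Q.mono (prod_mono Ioo_subset_Icc_self subset_rfl)
  -- convergence
  have hgap0 : ∀ᵐ q ∂(volume : Measure (ℝ × G)).restrict (Ioo 0 T ×ˢ Ω),
      Tendsto (fun n => gapFun γ (z n) q (ρ q.1 q.2) (m q.1 q.2)) atTop (𝓝 0) := by
    refine ae_tendsto_zero_of_summable hΩm (fun n => (hB n).measurableSet)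
      (fun n => (hB n).subset) hcov
      (fun n => (hB n).integrableOn_gapFun hd hΩ hQ hw (hz n) hrep) (fun n => ?_) (fun n => ?_)
    · filter_upwards [hin, ae_restrict_mem hΩm] with q h1 h2
      rw [gapFun, (hz n).Q_eq, sub_nonneg]
      exact h1.2 _ ((hz n).sub.density_pos _ h2.1 _) _
    · rw [← gap_eq hT hd hΩ hQ (hB n) hw (hz n) hrep]
      exact (hgap n).le
  have hlim : ∀ᵐ q ∂(volume : Measure (ℝ × G)).restrict (Ioo 0 T ×ˢ Ω),
      0 < ρ q.1 q.2 ∧ z₀.Q q.1 q.2 = energy d γ (ρ q.1 q.2) (m q.1 q.2) ∧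
      Tendsto (fun n => (z n).ρ q.1 q.2) atTop (𝓝 (ρ q.1 q.2)) ∧
      Tendsto (fun n => (z n).m q.1 q.2) atTop (𝓝 (m q.1 q.2)) := by
    filter_upwards [hgap0, hin, ae_restrict_mem hΩm] with q h1 h2 h3
    have hr : ∀ n, 0 < (z n).ρ q.1 q.2 := fun n => (hz n).sub.density_pos _ h3.1 _
    have hQpos : 0 < z₀.Q q.1 q.2 := by
      refine lt_of_le_of_lt ?_ ((hz 0).energy_lt h3.1 h3.2)
      have : 0 ≤ pressure γ ((z 0).ρ q.1 q.2) := Real.rpow_nonneg (hr 0).le _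
      have := hr 0
      rw [energy]
      positivity
    have ht : Tendsto (fun n => tangent d γ ((z n).ρ q.1 q.2)
        (((z n).ρ q.1 q.2)⁻¹ • (z n).m q.1 q.2) (ρ q.1 q.2) (m q.1 q.2)) atTop
        (𝓝 (z₀.Q q.1 q.2)) := by
      have := (tendsto_const_nhds (x := z₀.Q q.1 q.2)).sub h1
      rw [sub_zero] at this
      refine this.congr fun n => ?_
      rw [gapFun, (hz n).Q_eq]
      ring
    obtain ⟨e1, e2, e3, e4⟩ := exact_of_tendsto hd hγ.out h2.1 hQpos h2.2 hr ht
    refine ⟨e1, e2, e3, ?_⟩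
    have := e3.smul e4
    rw [smul_smul, mul_inv_cancel₀ e1.ne', one_smul] at this
    refine this.congr fun n => ?_
    rw [smul_smul, mul_inv_cancel₀ (hr n).ne', one_smul]
  -- the constraint on the whole slab
  have hslab : ∀ᵐ q ∂(volume : Measure (ℝ × G)).restrict (slab T G),
      0 < ρ q.1 q.2 ∧ z₀.Q q.1 q.2 = energy d γ (ρ q.1 q.2) (m q.1 q.2) := by
    refine slab_ae (Ω := Ω) ?_ ?_
    · filter_upwards [hlim] with q hq
      exact ⟨hq.1, hq.2.1⟩
    · filter_upwards [hout, ae_restrict_mem hΩm'] with q h1 h2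
      rw [h1.1, h1.2]
      exact ⟨hz₀.density_pos _ h2.1 _, (hz₀.energy_eq hd h2.1 h2.2).1⟩
  have hbd : ∀ᵐ q ∂(volume : Measure (ℝ × G)).restrict (slab T G),
      |ρ q.1 q.2| ≤ z₀.Q q.1 q.2 + γ ∧ (∀ i, |m q.1 q.2 i| ≤ d * (z₀.Q q.1 q.2 + γ)) ∧
      (∀ i j, |(ρ q.1 q.2)⁻¹ * (m q.1 q.2 i * m q.1 q.2 j)| ≤ d * z₀.Q q.1 q.2) ∧
      0 ≤ pressure γ (ρ q.1 q.2) ∧ pressure γ (ρ q.1 q.2) ≤ z₀.Q q.1 q.2 := by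
    filter_upwards [hslab] with q hq
    exact bounds_of_energy_le hd hγ.out hq.1 hq.2.ge
  -- the approximating fields on the whole slab
  have hconv : ∀ᵐ q ∂(volume : Measure (ℝ × G)).restrict (slab T G),
      (∀ i, Tendsto (fun n => (z n).m q.1 q.2 i) atTop (𝓝 (m q.1 q.2 i))) ∧
      Tendsto (fun n => (z n).ρ q.1 q.2) atTop (𝓝 (ρ q.1 q.2)) ∧
      ∀ i j, Tendsto (fun n => (z n).M q.1 q.2 i j + if i = j then z₀.Q q.1 q.2 else 0) atTop
        (𝓝 ((ρ q.1 q.2)⁻¹ * (m q.1 q.2 i * m q.1 q.2 j)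
          + if i = j then pressure γ (ρ q.1 q.2) else 0)) := by
    refine slab_ae (Ω := Ω) ?_ ?_
    · filter_upwards [hlim, ae_restrict_mem hΩm] with q h1 h2
      obtain ⟨e1, e2, e3, e4⟩ := h1
      refine ⟨fun i => ((EuclideanSpace.proj (𝕜 := ℝ) i).continuous.tendsto _).comp e4, e3,
        fun i j => ?_⟩
      refine tendsto_flux hd e1 e2 (fun n => (hz n).sub.density_pos _ h2.1 _)
        (fun n => (hz n).sub.symm _ h2.1 _) (fun n => ?_) e3 e4 i j
      have := ((hz n).strict _ h2.1 _ h2.2).1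
      rwa [(hz n).Q_eq] at this
    · have hall := ae_all_iff.2 fun n => (hz n).outside
      filter_upwards [hall, hout, ae_restrict_mem hΩm'] with q h1 h2 h3
      refine ⟨fun i => ?_, ?_, fun i j => ?_⟩
      · simp only [h2.2, fun n => (h1 n).2.1]
        exact tendsto_const_nhds
      · simp only [h2.1, fun n => (h1 n).1]
        exact tendsto_const_nhds
      · simp only [fun n => (h1 n).2.2, (hz₀.energy_eq hd h3.1 h3.2).2 i j, h2.1, h2.2]
        exact tendsto_const_nhds
  have hbdn : ∀ n, ∀ᵐ q ∂(volume : Measure (ℝ × G)).restrict (slab T G),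
      |(z n).ρ q.1 q.2| ≤ z₀.Q q.1 q.2 + γ ∧
      (∀ i, |(z n).m q.1 q.2 i| ≤ d * (z₀.Q q.1 q.2 + γ)) ∧
      (∀ i j, |(z n).M q.1 q.2 i j + if i = j then z₀.Q q.1 q.2 else 0|
        ≤ (2 * d + 2) * z₀.Q q.1 q.2) := by
    intro n
    refine slab_ae (Ω := Ω) ?_ ?_
    · filter_upwards [ae_restrict_mem hΩm] with q hq
      have hr := (hz n).sub.density_pos _ hq.1 q.2
      have he := (hz n).energy_lt hq.1 hq.2
      obtain ⟨b1, b2, b3, b4, b5⟩ := bounds_of_energy_le hd hγ.out hr he.le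
      refine ⟨b1, b2, fun i j => ?_⟩
      have hs := ((hz n).strict _ hq.1 _ hq.2).1
      rw [(hz n).Q_eq] at hs
      have := abs_flux_le hd ((hz n).sub.symm _ hq.1 _) hr hs he i j
      have hQ0 : 0 ≤ z₀.Q q.1 q.2 := b4.trans b5
      refine (abs_add_le _ _).trans ?_
      have h2 : |(if i = j then z₀.Q q.1 q.2 else 0)| ≤ z₀.Q q.1 q.2 := by
        split_ifs
        · rw [abs_of_nonneg hQ0]
        · rwa [abs_zero]
      linarith
    · filter_upwards [(hz n).outside, ae_restrict_mem hΩm'] with q h1 hq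
      rw [h1.1, h1.2.1, h1.2.2]
      obtain ⟨e1, e2⟩ := hz₀.energy_eq hd hq.1 hq.2
      obtain ⟨b1, b2, b3, b4, b5⟩ := bounds_of_energy_le hd hγ.out
        (hz₀.density_pos _ hq.1 q.2) e1.ge
      refine ⟨b1, b2, fun i j => ?_⟩
      rw [e2]
      have hQ0 : 0 ≤ z₀.Q q.1 q.2 := b4.trans b5
      refine (abs_add_le _ _).trans ?_
      have h2 : |(if i = j then pressure γ (z₀.ρ q.1 q.2) else 0)| ≤ z₀.Q q.1 q.2 := by
        split_ifs
        · rwa [abs_of_nonneg b4]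
        · rwa [abs_zero]
      have := b3 i j
      nlinarith
  -- measurability
  have mρ := hrep.meas_ρ
  have hcoord : ∀ {f : ℝ × G → Vec d}, AEStronglyMeasurable f (volume.restrict (slab T G)) →
      ∀ i, AEStronglyMeasurable (fun q => f q i) (volume.restrict (slab T G)) := fun hf i =>
    (EuclideanSpace.proj (𝕜 := ℝ) i).continuous.comp_aestronglyMeasurable hf
  have mp : AEStronglyMeasurable (fun q : ℝ × G => pressure γ (ρ q.1 q.2))
      (volume.restrict (slab T G)) := (mρ.aemeasurable.pow_const γ).aestronglyMeasurable
  have mflux : ∀ i j, AEStronglyMeasurable (fun q : ℝ × G => m q.1 q.2 i * m q.1 q.2 j / ρ q.1 q.2)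
      (volume.restrict (slab T G)) := fun i j =>
    (((hcoord hrep.meas_m i).mul (hcoord hrep.meas_m j)).aemeasurable.div
      mρ.aemeasurable).aestronglyMeasurable
  have mdt : ∀ {φ : ℝ → G → ℝ}, IsTestFunction π T φ →
      AEStronglyMeasurable (fun q : ℝ × G => dt φ q.1 q.2) (volume.restrict (slab T G)) :=
    fun hφ => (continuous_dt hπ hφ).aestronglyMeasurable
  have mdx : ∀ {φ : ℝ → G → ℝ}, IsTestFunction π T φ → ∀ j,
      AEStronglyMeasurable (fun q : ℝ × G => dx π φ j q.1 q.2) (volume.restrict (slab T G)) :=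
    fun hφ j => (continuous_dx hπ hφ j).aestronglyMeasurable
  refine ⟨agreesAtEndpoints_of_mem_spaceX hw,
    fun t _ => eq_outside_of_mem_spaceX hT hΩ hz₀ hw t, ρ, m, hrep, ?_, ?_⟩
  · refine ⟨?_, ?_, ?_, ?_, ?_, ?_, ?_⟩
    · filter_upwards [hslab] with q hq
      exact hq.1
    · refine locallyIntegrableOn_slab (H := fun q => z₀.Q q.1 q.2 + γ)
        (hQc.add continuousOn_const) mρ ?_
      filter_upwards [hbd] with q hq
      exact hq.1
    · refine locallyIntegrableOn_slab (H := fun q => d * (d * (z₀.Q q.1 q.2 + γ)))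
        (((hQc.add continuousOn_const).const_mul _).const_mul _) hrep.meas_m ?_
      filter_upwards [hbd] with q hq
      exact norm_le_of_abs_le hq.2.1
    · intro i j
      refine locallyIntegrableOn_slab (H := fun q => d * z₀.Q q.1 q.2)
        (hQc.const_mul _) (mflux i j) ?_
      filter_upwards [hbd] with q hq
      rw [div_eq_inv_mul]
      exact hq.2.2.1 i j
    · refine locallyIntegrableOn_slab (H := fun q => z₀.Q q.1 q.2) hQc mp ?_
      filter_upwards [hbd] with q hq
      rw [Real.norm_eq_abs, abs_of_nonneg hq.2.2.2.1]
      exact hq.2.2.2.2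
    · intro i φ hφ
      -- The pressure is moved into the diagonal of the flux, since M + Q I is the quantity with
      -- limit m⊗m/ρ + p(ρ) I. The same identity serves the approximations and the limit.
      have hsum : ∀ (Q c : ℝ) (g : Fin d → ℝ) (M : Fin d → ℝ),
          c + ∑ j, M j * g j + Q * g i = c + ∑ j, (M j + if i = j then Q else 0) * g j := by
        intro Q c g M
        simp [add_mul, Finset.sum_add_distrib, add_assoc]
      have hzero : ∀ n, ∫ q in slab T G, ((z n).m q.1 q.2 i * dt φ q.1 q.2
          + ∑ j, ((z n).M q.1 q.2 i j + if i = j then z₀.Q q.1 q.2 else 0) * dx π φ j q.1 q.2)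
            = 0 := fun n => by
        refine Eq.trans ?_ ((hz n).sub.linear.1 i φ hφ)
        simp only [(hz n).Q_eq, hsum]
      simp only [Matrix.smul_apply, smul_eq_mul, tensorSq, Matrix.of_apply, hsum]
      refine integral_slab_eq_zero_of_tendsto hφ.compact hφ.supp
        (H := fun q => d * (z₀.Q q.1 q.2 + γ) * |dt φ q.1 q.2|
          + ∑ j, (2 * d + 2) * z₀.Q q.1 q.2 * |dx π φ j q.1 q.2|) ?_ (fun n => ?_)
        (fun n q hq => ?_) (fun n => ?_) ?_ hzero
      · have c1 := (continuous_dt hπ hφ).continuousOn (s := slab T G)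
        have c2 := fun j => (continuous_dx hπ hφ j).continuousOn (s := slab T G)
        exact (((hQc.add continuousOn_const).const_mul _).mul c1.abs).add
          (continuousOn_finsetSum _ fun j _ => (hQc.const_mul _).mul (c2 j).abs)
      · refine ((hcoord (hz n).sub.represents.meas_m i).mul (mdt hφ)).add ?_
        refine Finset.aestronglyMeasurable_fun_sum _ fun j _ => ?_
        refine ((((hz n).sub.locInt_M i j).aestronglyMeasurable).add ?_).mul (mdx hφ j)
        split_ifs
        · exact hQc.aestronglyMeasurable hslm
        · exact aestronglyMeasurable_const
      · rw [dt_eq_zero_off hπ hφ hq]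
        simp [dx_eq_zero_off hπ hφ _ hq]
      · filter_upwards [hbdn n] with q hq
        refine (abs_add_le _ _).trans (add_le_add ?_ ((Finset.abs_sum_le_sum_abs _ _).trans
          (Finset.sum_le_sum fun j _ => ?_)))
        · rw [abs_mul]
          exact mul_le_mul_of_nonneg_right (hq.2.1 i) (abs_nonneg _)
        · rw [abs_mul]
          exact mul_le_mul_of_nonneg_right (hq.2.2 i j) (abs_nonneg _)
      · filter_upwards [hconv] with q hq
        exact ((hq.1 i).mul_const _).add (tendsto_finsetSum _ fun j _ => (hq.2.2 i j).mul_const _)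
    · intro φ hφ
      refine integral_slab_eq_zero_of_tendsto hφ.compact hφ.supp
        (F := fun n q => (z n).ρ q.1 q.2 * dt φ q.1 q.2
          + ∑ j, (z n).m q.1 q.2 j * dx π φ j q.1 q.2)
        (H := fun q => (z₀.Q q.1 q.2 + γ) * |dt φ q.1 q.2|
          + ∑ j, d * (z₀.Q q.1 q.2 + γ) * |dx π φ j q.1 q.2|) ?_ (fun n => ?_)
        (fun n q hq => ?_) (fun n => ?_) ?_ fun n => (hz n).sub.linear.2 φ hφ
      · have c1 := (continuous_dt hπ hφ).continuousOn (s := slab T G)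
        have c2 := fun j => (continuous_dx hπ hφ j).continuousOn (s := slab T G)
        exact ((hQc.add continuousOn_const).mul c1.abs).add
          (continuousOn_finsetSum _ fun j _ =>
            ((hQc.add continuousOn_const).const_mul _).mul (c2 j).abs)
      · refine ((hz n).sub.represents.meas_ρ.mul (mdt hφ)).add ?_
        exact Finset.aestronglyMeasurable_fun_sum _ fun j _ =>
          (hcoord (hz n).sub.represents.meas_m j).mul (mdx hφ j)
      · simp only
        rw [dt_eq_zero_off hπ hφ hq]
        simp [dx_eq_zero_off hπ hφ _ hq]
      · filter_upwards [hbdn n] with q hq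
        refine (abs_add_le _ _).trans (add_le_add ?_ ((Finset.abs_sum_le_sum_abs _ _).trans
          (Finset.sum_le_sum fun j _ => ?_)))
        · rw [abs_mul]
          exact mul_le_mul_of_nonneg_right hq.1 (abs_nonneg _)
        · rw [abs_mul]
          exact mul_le_mul_of_nonneg_right (hq.2.1 j) (abs_nonneg _)
      · filter_upwards [hconv] with q hq
        exact (hq.2.1.mul_const _).add (tendsto_finsetSum _ fun j _ => (hq.1 j).mul_const _)
  · filter_upwards [hlim] with q hq
    rw [hq.2.1]
    rfl

end Exact

/-! ### Waves as perturbations of paths -/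

/-- The momentum of a wave as a vector field. -/
def WavePotential.momVec {d : ℕ} (W : WavePotential d) (y : ℝ × Vec d) : Vec d :=
  WithLp.toLp 2 fun i => W.mom i y

/-- The flux of a wave as a matrix field. -/
def WavePotential.fluxMat {d : ℕ} (W : WavePotential d) (y : ℝ × Vec d) : Mat d :=
  Matrix.of fun i j => W.flux i j y

lemma WavePotential.continuous_momVec {d : ℕ} (W : WavePotential d) : Continuous W.momVec :=
  (PiLp.continuous_toLp 2 _).comp (continuous_pi fun i => continuous_smoothFn (W.mom i))

lemma WavePotential.continuous_fluxMat {d : ℕ} (W : WavePotential d) : Continuous W.fluxMat :=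
  continuous_matrix fun i j => continuous_smoothFn (W.flux i j)

lemma WavePotential.fluxMat_mem {d : ℕ} (W : WavePotential d) (y : ℝ × Vec d) :
    W.fluxMat y ∈ symTraceFree d := by
  refine ⟨?_, W.trace_flux y⟩
  ext i j
  change W.flux j i y = W.flux i j y
  rw [W.flux_symm]

section PathOfContinuous

variable {E : Type} [NormedAddCommGroup E] [InnerProductSpace ℝ E] [FiniteDimensional ℝ E]
variable {G : Type} [MeasureSpace G] [TopologicalSpace G] [BorelSpace G]
  [SecondCountableTopology G] [LocallyCompactSpace G] [T2Space G]
  [IsLocallyFiniteMeasure (volume : Measure G)]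
variable {p : ℝ≥0∞} [hp : Fact (1 ≤ p)] {T : ℝ}

/-- A continuous field with compact support is a weakly continuous path. -/
lemma exists_path_of_continuous {f : ℝ → G → E} (hf : Continuous fun q : ℝ × G => f q.1 q.2)
    {K : Set (ℝ × G)} (hK : IsCompact K) (h0 : ∀ q ∉ K, f q.1 q.2 = 0) :
    ∃ v : WPath E G p T, ∀ t, pathFn v t =ᵐ[volume] f t := by
  let S : Set G := Prod.snd '' K
  have hS : IsCompact S := hK.image continuous_snd
  have hSm : MeasurableSet S := hS.isClosed.measurableSet
  have hft : ∀ t, Continuous (f t) := fun t => hf.comp (Continuous.prodMk_right t)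
  have hfS : ∀ t, ∀ x ∉ S, f t x = 0 := fun t x hx =>
    h0 (t, x) fun h => hx ⟨(t, x), h, rfl⟩
  have : CompactSpace S := isCompact_iff_compactSpace.1 hS
  let cg : C(ℝ, C(S, E)) := ContinuousMap.curry ⟨fun z : ℝ × S => f z.1 z.2,
    hf.comp (by fun_prop : Continuous fun z : ℝ × S => (z.1, (z.2 : G)))⟩
  have hmem : ∀ t, MemLp (f t) p := fun t => by
    refine memLp_of_bounded_of_support (hft t).aestronglyMeasurable (C := ‖cg t‖) (fun x => ?_)
      hSm hS.measure_lt_top.ne (hfS t)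
    by_cases hx : x ∈ S
    · exact (cg t).norm_coe_le_norm ⟨x, hx⟩
    · rw [hfS t x hx, norm_zero]
      exact norm_nonneg _
  let F : ℝ → Lp E p (volume : Measure G) := fun t => (hmem t).toLp
  have hF : Continuous F := by
    rw [continuous_iff_continuousAt]
    intro t
    have hbound : ∀ s, ‖F s - F t‖ ≤ ((volume S) ^ p.toReal⁻¹).toReal * ‖cg s - cg t‖ := by
      intro s
      have h1 : F s - F t = ((hmem s).sub (hmem t)).toLp := (MemLp.toLp_sub _ _).symm
      rw [h1, Lp.norm_toLp, ← eLpNorm_restrict_eq_of_support_subset (s := S)]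
      · have hle := eLpNorm_le_of_ae_bound (p := p) (μ := (volume : Measure G).restrict S)
          (f := f s - f t) (C := ‖cg s - cg t‖) (by
            filter_upwards [ae_restrict_mem hSm] with x hx
            exact (cg s - cg t).norm_coe_le_norm ⟨x, hx⟩)
        rw [Measure.restrict_apply_univ] at hle
        refine (ENNReal.toReal_mono ?_ hle).trans ?_
        · refine ENNReal.mul_ne_top ?_ ENNReal.ofReal_ne_top
          exact ENNReal.rpow_ne_top_of_nonneg (by positivity) hS.measure_lt_top.ne
        · rw [ENNReal.toReal_mul, ENNReal.toReal_ofReal (norm_nonneg _)]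
      · intro x hx
        by_contra hxS
        exact hx (by simp [hfS _ x hxS])
    rw [ContinuousAt, tendsto_iff_norm_sub_tendsto_zero]
    refine squeeze_zero (fun s => norm_nonneg _) hbound ?_
    have h2 := (tendsto_iff_norm_sub_tendsto_zero.1 (cg.continuous.tendsto t)).const_mul
      (((volume S) ^ p.toReal⁻¹).toReal)
    rwa [mul_zero] at h2
  refine ⟨⟨fun t => toWeakSpaceCLM ℝ (Lp E p (volume : Measure G)) (F t),
    (toWeakSpaceCLM ℝ _).continuous.comp (hF.comp continuous_subtype_val)⟩, fun t => ?_⟩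
  exact (hmem t).coeFn_toLp

end PathOfContinuous

section Waves

variable {d : ℕ} {T : ℝ} {G : Type} [AddCommGroup G] [TopologicalSpace G]
  [MeasureSpace G] [BorelSpace G] [SecondCountableTopology G] [LocallyCompactSpace G] [T2Space G]
  [IsLocallyFiniteMeasure (volume : Measure G)] {π : Vec d →+ G}

lemma push_slice (hπ : IsLocalModel π) {F : Type*} [Zero F] {x₀ : Vec d} (f : ℝ × Vec d → F)
    (t : ℝ) {x : Vec d} (hx : x ∈ Metric.ball x₀ (1 / 4)) : push π x₀ f t (π x) = f (t, x) :=
  push_lift hπ f (y := (t, x)) ⟨mem_univ _, hx⟩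

lemma integral_inner_push (hπ : IsLocalModel π) {x₀ : Vec d} {f : ℝ × Vec d → Vec d}
    (hf : Continuous fun q : ℝ × G => push π x₀ f q.1 q.2) {h : G → Vec d}
    (hh : AEStronglyMeasurable h volume) (t : ℝ) :
    ∫ x, inner ℝ (h x) (push π x₀ f t x)
      = ∫ x in Metric.ball x₀ (1 / 4), inner ℝ (h (π x)) (f (t, x)) := by
  have h1 : ∫ x in π '' Metric.ball x₀ (1 / 4), inner ℝ (h x) (push π x₀ f t x)
      = ∫ x, inner ℝ (h x) (push π x₀ f t x) := by
    refine setIntegral_eq_integral_of_forall_compl_eq_zero fun x hx => ?_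
    rw [push, dif_neg, inner_zero_right]
    rintro ⟨y, hy, rfl⟩
    exact hx ⟨y, hy, rfl⟩
  have hmp := hπ.measurePreserving x₀
  have hpt : Continuous fun x => push π x₀ f t x := hf.comp (Continuous.prodMk_right t)
  rw [← h1, ← hmp.map_eq, integral_map hmp.measurable.aemeasurable]
  · refine setIntegral_congr_fun Metric.isOpen_ball.measurableSet fun x hx => ?_
    rw [push_slice hπ f t hx]
  · rw [hmp.map_eq]
    exact hh.restrict.inner hpt.aestronglyMeasurable

/-- Waves of increasing frequency tend to zero weakly, uniformly in time. -/
lemma tendsto_wave (hπ : IsLocalModel π) {x₀ : Vec d} {K : Set (ℝ × Vec d)} (hK : IsCompact K)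
    (hKx : K ⊆ cyl x₀) {W : ℕ → WavePotential d} (hW : ∀ n, ∀ y ∉ K, (W n).Φ y = 0)
    {ξ η : Vec d} (hξη : ∀ n, (W n).ξ = ξ ∧ (W n).η = η) (hs : IsSmall fun n y => (W n).stream y)
    {C : ℝ} (hC : ∀ n, 1 ≤ n → ∀ y, ‖(W n).momVec y‖ ≤ C) {v : ℕ → WPath (Vec d) G 2 T}
    (hv : ∀ n t, pathFn (v n) t =ᵐ[volume] push π x₀ (W n).momVec t) :
    Tendsto v atTop (𝓝 0) := by
  refine tendsto_zero_path fun l ε hε => ?_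
  -- By Riesz every functional on L² is the pairing with some h.
  let h : Lp (Vec d) 2 (volume : Measure G) := (InnerProductSpace.toDual ℝ _).symm l
  have hl : ∀ u, l u = ∫ x, inner ℝ (h x) (u x) := fun u => by
    rw [← L2.inner_def, InnerProductSpace.toDual_symm_apply]
  have hC0 : 0 ≤ C := (norm_nonneg _).trans (hC 1 le_rfl 0)
  have hpc : ∀ n, Continuous fun q : ℝ × G => push π x₀ (W n).momVec q.1 q.2 := fun n =>
    continuous_push hπ (W n).continuous_momVec hK hKx fun y hy => by
      have := ((W n).off_d hK.isClosed (hW n) y hy).1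
      ext i
      exact this i
  set B : Set (Vec d) := Metric.ball x₀ (1 / 4)
  have hBm : MeasurableSet B := Metric.isOpen_ball.measurableSet
  have hfin : IsFiniteMeasure ((volume : Measure (Vec d)).restrict B) :=
    ⟨by simpa using Metric.isBounded_ball.measure_lt_top⟩
  have hmp := hπ.measurePreserving x₀
  have hg2 : MemLp (fun x => h (π x)) 2 ((volume : Measure (Vec d)).restrict B) :=
    ((Lp.memLp h).restrict (π '' B)).comp_measurePreserving hmp
  have hg1 : MemLp (B.indicator fun x => h (π x)) 1 volume :=
    (memLp_indicator_iff_restrict hBm).2 (hg2.mono_exponent (by norm_num))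
  -- The waves are bounded by C uniformly in n, so an L¹ approximation of h in the chart by a smooth
  -- H costs at most ε/2. For the fixed H, integration by parts onto the stream function gives decay
  -- of order 1/n.
  obtain ⟨H, hH1, hH2, hH3⟩ := hg1.exist_eLpNorm_sub_le (by simp) le_rfl
    (by positivity : 0 < ε / 2 / (C + 1))
  let Hc : Fin d → smoothFn (Vec d) := fun i =>
    ⟨fun x => H x i, (EuclideanSpace.proj (𝕜 := ℝ) i).contDiff.comp hH2⟩
  have hHc : ∀ i, HasCompactSupport (Hc i) := fun i =>
    hH1.comp_left (g := fun y : Vec d => y i) rfl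
  set A : ℝ := (∑ i, (|η i| * ∫ x, |pd ξ (Hc i) x|)) + ∑ i, (|ξ i| * ∫ x, |pd η (Hc i) x|)
  obtain ⟨Cs, hCs⟩ := hs
  have hlim : Tendsto (fun n : ℕ => Cs / n * A) atTop (𝓝 0) := by
    have := (tendsto_const_div_atTop_nhds_zero_nat Cs).mul_const A
    rwa [zero_mul] at this
  filter_upwards [(tendsto_order.1 hlim).2 (ε / 2) (by positivity), eventually_ge_atTop 1]
    with n hn hn1 t
  have hHint : Integrable H := hH2.continuous.integrable_of_hasCompactSupport hH1
  have hmc : Continuous fun x : Vec d => (W n).momVec ((t : ℝ), x) :=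
    (W n).continuous_momVec.comp (Continuous.prodMk_right (t : ℝ))
  have e1 : l (pathFn (v n) t)
      = ∫ x, inner ℝ (B.indicator (fun x => h (π x)) x) ((W n).momVec ((t : ℝ), x)) := by
    rw [hl]
    have : ∫ x, inner ℝ (h x) (pathFn (v n) t x)
        = ∫ x, inner ℝ (h x) (push π x₀ (W n).momVec t x) := by
      refine integral_congr_ae ?_
      filter_upwards [hv n t] with x hx
      rw [hx]
    rw [this, integral_inner_push hπ (hpc n) (Lp.aestronglyMeasurable h), ← integral_indicator hBm]
    refine integral_congr_ae (Eventually.of_forall fun x => ?_)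
    by_cases hx : x ∈ B
    · simp only [indicator_of_mem hx]
    · simp only [indicator_of_notMem hx, inner_zero_left]
  have hint : ∀ g : Vec d → Vec d, Integrable g →
      Integrable fun x => inner ℝ (g x) ((W n).momVec ((t : ℝ), x)) := fun g hg => by
    refine Integrable.mono' (hg.norm.mul_const C)
      (hg.aestronglyMeasurable.inner hmc.aestronglyMeasurable) (Eventually.of_forall fun x => ?_)
    exact (norm_inner_le_norm _ _).trans
      (mul_le_mul_of_nonneg_left (hC n hn1 _) (norm_nonneg _))
  have hgi : Integrable (B.indicator fun x => h (π x)) := memLp_one_iff_integrable.1 hg1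
  have e2 : |l (pathFn (v n) t) - ∫ x, inner ℝ (H x) ((W n).momVec ((t : ℝ), x))| ≤ ε / 2 := by
    rw [e1, ← integral_sub (hint _ hgi) (hint _ hHint), ← Real.norm_eq_abs]
    simp only [← inner_sub_left]
    have hd1 : Integrable fun x => B.indicator (fun x => h (π x)) x - H x := hgi.sub hHint
    calc ‖∫ x, inner ℝ (B.indicator (fun x => h (π x)) x - H x) ((W n).momVec ((t : ℝ), x))‖
        ≤ ∫ x, ‖B.indicator (fun x => h (π x)) x - H x‖ * C := by
          refine norm_integral_le_of_norm_le (hd1.norm.mul_const C)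
            (Eventually.of_forall fun x => ?_)
          exact (norm_inner_le_norm _ _).trans
            (mul_le_mul_of_nonneg_left (hC n hn1 _) (norm_nonneg _))
      _ = (∫ x, ‖B.indicator (fun x => h (π x)) x - H x‖) * C := integral_mul_const _ _
      _ ≤ ε / 2 / (C + 1) * C := by
          refine mul_le_mul_of_nonneg_right ?_ hC0
          have h1 := ENNReal.toReal_mono ENNReal.ofReal_ne_top hH3
          rw [ENNReal.toReal_ofReal (by positivity), eLpNorm_one_eq_lintegral_enorm,
            ← integral_norm_eq_lintegral_enorm (hgi.sub hHint).aestronglyMeasurable] at h1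
          exact h1
      _ ≤ ε / 2 / (C + 1) * (C + 1) := by gcongr; linarith
      _ = ε / 2 := by field_simp
  have e3 : |∫ x, inner ℝ (H x) ((W n).momVec ((t : ℝ), x))| ≤ Cs / n * A := by
    have e4 : ∫ x, inner ℝ (H x) ((W n).momVec ((t : ℝ), x))
        = ∑ i, ∫ x, Hc i x * (W n).mom i ((t : ℝ), x) := by
      rw [← integral_finsetSum]
      · refine integral_congr_ae (Eventually.of_forall fun x => ?_)
        simp only [PiLp.inner_apply, RCLike.inner_apply, conj_trivial]
        exact Finset.sum_congr rfl fun i _ => mul_comm _ _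
      · intro i _
        exact ((continuous_smoothFn (Hc i)).mul ((continuous_smoothFn ((W n).mom i)).comp
          (Continuous.prodMk_right (t : ℝ)))).integrable_of_hasCompactSupport
            (hHc i).mul_right
    rw [e4]
    have := (W n).integral_mom Hc hHc (hCs n hn1) t
    rw [(hξη n).1, (hξη n).2, ← mul_add] at this
    exact this
  calc |l (pathFn (v n) t)|
      ≤ |l (pathFn (v n) t) - ∫ x, inner ℝ (H x) ((W n).momVec ((t : ℝ), x))|
        + |∫ x, inner ℝ (H x) ((W n).momVec ((t : ℝ), x))| := by
          have := abs_add_le (l (pathFn (v n) t)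
            - ∫ x, inner ℝ (H x) ((W n).momVec ((t : ℝ), x)))
            (∫ x, inner ℝ (H x) ((W n).momVec ((t : ℝ), x)))
          rwa [sub_add_cancel] at this
    _ < ε := by linarith

end Waves

/-- Integrability of f is not needed: if it fails, it fails for the sum as well, and that integral
is zero by convention. -/
lemma integral_add_eq_zero {α : Type*} [MeasurableSpace α] {μ : Measure α} {f g : α → ℝ}
    (hf : ∫ x, f x ∂μ = 0) (hg : ∫ x, g x ∂μ = 0) (hgi : Integrable g μ) :
    ∫ x, (f x + g x) ∂μ = 0 := by
  by_cases h : Integrable f μ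
  · rw [integral_add h hgi, hf, hg, add_zero]
  · refine integral_undef fun hc => h ?_
    exact (hc.sub hgi).congr (Eventually.of_forall fun x => by simp)

section Perturb

variable {d : ℕ} {γ T : ℝ} [hγ : Fact (1 < γ)] {G : Type} [AddCommGroup G] [TopologicalSpace G]
  [MeasureSpace G] [BorelSpace G] [SecondCountableTopology G] [LocallyCompactSpace G] [T2Space G]
  [IsLocallyFiniteMeasure (volume : Measure G)] {π : Vec d →+ G} {Ω : Set G} {z₀ : Fields d G}
  {mref : ℝ → G → Vec d}

lemma push_cases {F : Type*} [Zero F] (x₀ : Vec d) (f : ℝ × Vec d → F) (t : ℝ) (x : G) :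
    push π x₀ f t x = 0 ∨ ∃ y, push π x₀ f t x = f y := by
  rw [push]
  split_ifs with h
  · exact Or.inr ⟨_, rfl⟩
  · exact Or.inl rfl

lemma push_comp {F F' : Type*} [Zero F] [Zero F'] (x₀ : Vec d) (f : ℝ × Vec d → F) (g : F → F')
    (hg : g 0 = 0) (t : ℝ) (x : G) :
    g (push π x₀ f t x) = push π x₀ (fun y => g (f y)) t x := by
  simp only [push]
  split_ifs
  · rfl
  · exact hg

/-- The superposition of a subsolution and a wave. -/
def addWave (π : Vec d →+ G) (x₀ : Vec d) (W : WavePotential d) (z : Fields d G) : Fields d G where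
  ρ := z.ρ
  m := fun t x => z.m t x + push π x₀ W.momVec t x
  M := fun t x => z.M t x + push π x₀ W.fluxMat t x
  Q := z.Q

/-- A wave that keeps a strict subsolution admissible leads to a strict subsolution. -/
lemma addWave_mem (hπ : IsLocalModel π) (hd : 0 < d) (hΩ : IsOpen Ω)
    {w : PathSpace d γ T G} {z : Fields d G}
    (hw : w ∈ spaceX₀ π Ω z₀ mref) (hz : IsWitness π Ω z₀ w z) {x₀ : Vec d} {K : Set (ℝ × Vec d)}
    (hK : IsCompact K) (hKx : K ⊆ cyl x₀) (hKΩ : ∀ y ∈ K, lift π y ∈ Ioo 0 T ×ˢ Ω)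
    {W : WavePotential d} (hW : ∀ y ∉ K, W.Φ y = 0)
    (hadm : ∀ y ∈ K, (z.ρ (lift π y).1 (lift π y).2, z.m (lift π y).1 (lift π y).2 + W.momVec y,
      z.M (lift π y).1 (lift π y).2 + W.fluxMat y, z.Q (lift π y).1 (lift π y).2)
        ∈ admissible d γ) {v : WPath (Vec d) G 2 T}
    (hv : ∀ t, pathFn v t =ᵐ[volume] push π x₀ W.momVec t) :
    ((w.1, w.2 + v) : PathSpace d γ T G) ∈ spaceX₀ π Ω z₀ mref ∧
      IsWitness π Ω z₀ ((w.1, w.2 + v) : PathSpace d γ T G) (addWave π x₀ W z) := by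
  obtain ⟨hsupp, hend, -⟩ := mem_spaceX₀.1 hw
  have hoff := W.off_d hK.isClosed hW
  have hm0 : ∀ y ∉ K, W.momVec y = 0 := fun y hy => PiLp.ext fun i => (hoff y hy).1 i
  have hM0 : ∀ y ∉ K, W.fluxMat y = 0 := fun y hy => by
    ext i j
    exact (hoff y hy).2 i j
  have hcm : Continuous fun q : ℝ × G => push π x₀ W.momVec q.1 q.2 :=
    continuous_push hπ W.continuous_momVec hK hKx hm0
  have hcM : Continuous fun q : ℝ × G => push π x₀ W.fluxMat q.1 q.2 :=
    continuous_push hπ W.continuous_fluxMat hK hKx hM0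
  have hKc : IsCompact (lift π '' K) := hK.image (continuous_lift hπ)
  have hpm : ∀ q ∉ lift π '' K, push π x₀ W.momVec q.1 q.2 = 0 := fun q hq => push_eq_zero hm0 hq
  have hpM : ∀ q ∉ lift π '' K, push π x₀ W.fluxMat q.1 q.2 = 0 := fun q hq => push_eq_zero hM0 hq
  have hKs : lift π '' K ⊆ Ioo 0 T ×ˢ Ω := by
    rintro _ ⟨y, hy, rfl⟩
    exact hKΩ y hy
  have hKT : K ⊆ Ioo 0 T ×ˢ univ := fun y hy => ⟨(hKΩ y hy).1, mem_univ _⟩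
  have hmom : ∀ t : Icc (0 : ℝ) T, momentum ((w.1, w.2 + v) : PathSpace d γ T G) t
      =ᵐ[volume] fun x => momentum w t x + push π x₀ W.momVec t x := fun t => by
    have h1 : momentum ((w.1, w.2 + v) : PathSpace d γ T G) t
        =ᵐ[volume] fun x => momentum w t x + pathFn v t x :=
      Lp.coeFn_add (pathFn w.2 t) (pathFn v t)
    filter_upwards [h1, hv t] with x h1 h2
    rw [h1, h2]
  have hcMij : ∀ i j, Continuous fun q : ℝ × G => push π x₀ W.fluxMat q.1 q.2 i j := fun i j =>
    hcM.matrix_elem i j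
  have hwit : IsWitness π Ω z₀ ((w.1, w.2 + v) : PathSpace d γ T G) (addWave π x₀ W z) := by
    have hstrict : ∀ t ∈ Ioo 0 T, ∀ x ∈ Ω, (z.ρ t x, z.m t x + push π x₀ W.momVec t x,
        z.M t x + push π x₀ W.fluxMat t x, z.Q t x) ∈ admissible d γ := by
      intro t ht x hx
      by_cases hq : (t, x) ∈ lift π '' K
      · obtain ⟨y, hy, hyq⟩ := hq
        have h1 := hadm y hy
        have h2 := push_lift hπ W.momVec (hKx hy)
        have h3 := push_lift hπ W.fluxMat (hKx hy)
        rw [hyq] at h1 h2 h3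
        rwa [← h2, ← h3] at h1
      · have h2 := hpm _ hq
        have h3 := hpM _ hq
        simp only at h2 h3
        rw [h2, h3, add_zero, add_zero]
        exact (mem_admissible_iff hd (hz.sub.symm t ht x) (hz.sub.density_pos t ht x)).2
          (hz.strict t ht x hx)
    have hsym : ∀ t ∈ Ioo 0 T, ∀ x, z.M t x + push π x₀ W.fluxMat t x ∈ symTraceFree d := by
      intro t ht x
      have h1 := hz.sub.symm t ht x
      have h2 : push π x₀ W.fluxMat t x ∈ symTraceFree d := by
        rcases push_cases (π := π) x₀ W.fluxMat t x with h | ⟨y, h⟩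
        · rw [h]
          exact ⟨Matrix.isSymm_zero, Matrix.trace_zero _ _⟩
        · rw [h]
          exact W.fluxMat_mem y
      exact ⟨h1.1.add h2.1, by rw [Matrix.trace_add, h1.2, h2.2, add_zero]⟩
    have hineq : ∀ t ∈ Ioo 0 T, ∀ x ∈ Ω, _ := fun t ht x hx =>
      (mem_admissible_iff hd (hsym t ht x) (hz.sub.density_pos t ht x)).1 (hstrict t ht x hx)
    refine ⟨hz.Q_eq, ⟨⟨hz.sub.represents.meas_ρ, ?_, hz.sub.represents.eq_ρ, fun t => ?_⟩,
      hz.sub.density_pos, hsym, fun i j => ?_, fun i j => ?_, ⟨fun i φ hφ => ?_, fun φ hφ => ?_⟩,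
      fun t ht x hx => (hineq t ht x hx).1.le⟩, ?_, hz.cont_ρ, hz.cont_m.add hcm.continuousOn,
      hz.cont_M.add hcM.continuousOn, hz.cont_Q, hineq⟩
    · exact hz.sub.represents.meas_m.add hcm.aestronglyMeasurable
    · filter_upwards [hmom t, hz.sub.represents.eq_m t] with x h1 h2
      rw [h1, h2]
      rfl
    · exact (hz.sub.locInt_M i j).add
        ((hcMij i j).locallyIntegrable.locallyIntegrableOn _)
    · refine (hz.sub.int_M i j).add (Integrable.integrableOn ?_)
      refine (hcMij i j).integrable_of_hasCompactSupport
        (HasCompactSupport.intro hKc fun q hq => ?_)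
      rw [hpM q hq]
      rfl
    · have hA := hz.sub.linear.1 i φ hφ
      have hB := integral_push_momentum hπ hK hKx hKT W hW hφ i
      have hBi : Integrable (fun q : ℝ × G => push π x₀ (W.mom i) q.1 q.2 * dt φ q.1 q.2
          + ∑ j, push π x₀ (W.flux i j) q.1 q.2 * dx π φ j q.1 q.2)
          (volume.restrict (slab T G)) := by
        have c1 : Continuous fun q : ℝ × G => push π x₀ (W.mom i) q.1 q.2 :=
          continuous_push hπ (continuous_smoothFn _) hK hKx fun y hy => (hoff y hy).1 i
        have c2 : ∀ j, Continuous fun q : ℝ × G => push π x₀ (W.flux i j) q.1 q.2 := fun j =>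
          continuous_push hπ (continuous_smoothFn _) hK hKx fun y hy => (hoff y hy).2 i j
        refine Integrable.integrableOn (Continuous.integrable_of_hasCompactSupport ?_
          (HasCompactSupport.intro hφ.compact fun q hq => ?_))
        · exact (c1.mul (continuous_dt hπ hφ)).add
            (continuous_finsetSum _ fun j _ => (c2 j).mul (continuous_dx hπ hφ j))
        · rw [dt_eq_zero_off hπ hφ hq]
          simp [dx_eq_zero_off hπ hφ _ hq]
      have hpi : ∀ t x, push π x₀ W.momVec t x i = push π x₀ (W.mom i) t x := fun t x =>
        push_comp x₀ W.momVec (fun a : Vec d => a i) rfl t x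
      have hpij : ∀ t x j, push π x₀ W.fluxMat t x i j = push π x₀ (W.flux i j) t x :=
        fun t x j => push_comp x₀ W.fluxMat (fun a : Mat d => a i j) rfl t x
      have heq : ∀ q : ℝ × G, (z.m q.1 q.2 + push π x₀ W.momVec q.1 q.2) i * dt φ q.1 q.2
          + ∑ j, (z.M q.1 q.2 + push π x₀ W.fluxMat q.1 q.2) i j * dx π φ j q.1 q.2
          + z.Q q.1 q.2 * dx π φ i q.1 q.2
          = (z.m q.1 q.2 i * dt φ q.1 q.2 + ∑ j, z.M q.1 q.2 i j * dx π φ j q.1 q.2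
            + z.Q q.1 q.2 * dx π φ i q.1 q.2)
            + (push π x₀ (W.mom i) q.1 q.2 * dt φ q.1 q.2
              + ∑ j, push π x₀ (W.flux i j) q.1 q.2 * dx π φ j q.1 q.2) := by
        intro q
        simp only [PiLp.add_apply, Matrix.add_apply, add_mul, Finset.sum_add_distrib, hpi, hpij]
        ring
      simp only [addWave, heq]
      exact integral_add_eq_zero hA hB hBi
    · have hA := hz.sub.linear.2 φ hφ
      have hB := integral_push_mass hπ hK hKx hKT W hW hφ
      have hBi : Integrable (fun q : ℝ × G =>
          ∑ j, push π x₀ (W.mom j) q.1 q.2 * dx π φ j q.1 q.2)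
          (volume.restrict (slab T G)) := by
        have c1 : ∀ i, Continuous fun q : ℝ × G => push π x₀ (W.mom i) q.1 q.2 := fun i =>
          continuous_push hπ (continuous_smoothFn _) hK hKx fun y hy => (hoff y hy).1 i
        refine Integrable.integrableOn (Continuous.integrable_of_hasCompactSupport ?_
          (HasCompactSupport.intro hφ.compact fun q hq => ?_))
        · exact continuous_finsetSum _ fun j _ => (c1 j).mul (continuous_dx hπ hφ j)
        · simp [dx_eq_zero_off hπ hφ _ hq]
      have hpi : ∀ t x i, push π x₀ W.momVec t x i = push π x₀ (W.mom i) t x := fun t x i =>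
        push_comp x₀ W.momVec (fun a : Vec d => a i) rfl t x
      have heq : ∀ q : ℝ × G, z.ρ q.1 q.2 * dt φ q.1 q.2
          + ∑ j, (z.m q.1 q.2 + push π x₀ W.momVec q.1 q.2) j * dx π φ j q.1 q.2
          = (z.ρ q.1 q.2 * dt φ q.1 q.2 + ∑ j, z.m q.1 q.2 j * dx π φ j q.1 q.2)
            + ∑ j, push π x₀ (W.mom j) q.1 q.2 * dx π φ j q.1 q.2 := by
        intro q
        simp only [PiLp.add_apply, add_mul, Finset.sum_add_distrib, hpi]
        ring
      simp only [addWave, heq]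
      exact integral_add_eq_zero hA hB hBi
    · filter_upwards [hz.outside, ae_restrict_mem (measurableSet_Ioo.prod
        hΩ.measurableSet.compl)] with q h1 h2
      have hq : q ∉ lift π '' K := fun h => h2.2 (hKs h).2
      simp only [addWave, hpm q hq, hpM q hq, add_zero]
      exact h1
  refine ⟨mem_spaceX₀.2 ⟨fun t => ?_, fun t ht => ⟨(hend t ht).1, ?_⟩, _, hwit⟩, hwit⟩
  · obtain ⟨C, hC1, hC2, hC3⟩ := hsupp t
    refine ⟨C ∪ Prod.snd '' (lift π '' K), hC1.union (hKc.image continuous_snd), ?_, ?_⟩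
    · refine union_subset hC2 ?_
      rintro _ ⟨q, hq, rfl⟩
      exact (hKs hq).2
    · filter_upwards [hC3, hmom t] with x h1 h2 h3
      rw [h2, h1 fun h => h3 (Or.inl h), hpm ((t : ℝ), x) fun h => h3 (Or.inr ⟨_, h, rfl⟩),
        add_zero]
  -- The wave is supported over the open time interval, so it vanishes at both endpoints.
  · filter_upwards [(hend t ht).2, hmom t] with x h1 h2
    rw [h2, h1, hpm ((t : ℝ), x) fun h => ?_, add_zero]
    have := (hKs h).1
    rcases ht with ht | ht
    · exact absurd ht this.1.ne'
    · exact absurd ht this.2.ne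

end Perturb

/-- The squares for the two phases add up to one, so one of the phases carries at least half of the
volume. This replaces a Riemann–Lebesgue argument. -/
lemma exists_phase {X : Type*} [MeasurableSpace X] {μ : Measure X} {S : Set X} (f : X → ℝ)
    (hf : Measurable f) (hS : μ S ≠ ⊤) :
    ∃ α ∈ ({0, Real.pi / 2} : Finset ℝ), μ.real S / 2 ≤ ∫ y in S, Real.sin (f y + α) ^ 2 ∂μ := by
  have hfin : IsFiniteMeasure (μ.restrict S) := ⟨by simpa using hS.lt_top⟩
  have hi : ∀ α : ℝ, IntegrableOn (fun y => Real.sin (f y + α) ^ 2) S μ := fun α => by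
    refine Integrable.of_bound (C := 1) ?_ (Eventually.of_forall fun y => ?_)
    · exact ((Real.continuous_sin.measurable.comp (hf.add_const α)).pow_const 2).aestronglyMeasurable
    · rw [Real.norm_eq_abs, abs_of_nonneg (sq_nonneg _)]
      exact Real.sin_sq_le_one _
  have hsum : (∫ y in S, Real.sin (f y + 0) ^ 2 ∂μ)
      + ∫ y in S, Real.sin (f y + Real.pi / 2) ^ 2 ∂μ = μ.real S := by
    rw [← integral_add (hi _) (hi _)]
    simp only [Real.sin_add_pi_div_two, add_zero, Real.sin_sq_add_cos_sq]
    simp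
  by_contra! h
  have h1 := h 0 (by simp)
  have h2 := h (Real.pi / 2) (by simp)
  linarith

/-! ### Oscillations localised in a single ball -/

section Ball

variable {d : ℕ} {γ T : ℝ} [hγ : Fact (1 < γ)] {G : Type} [AddCommGroup G] [TopologicalSpace G]
  [MeasureSpace G] [BorelSpace G] [SecondCountableTopology G] [LocallyCompactSpace G] [T2Space G]
  [IsLocallyFiniteMeasure (volume : Measure G)] {π : Vec d →+ G} {Ω : Set G} {z₀ : Fields d G}
  {mref : ℝ → G → Vec d}

/-- The waves supported in a ball with amplitude `θ`: they are weakly small, and their momentum has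
a definite size in the mean. -/
lemma exists_waves (hd : 2 ≤ d) {c : ℝ × Vec d} {r θ : ℝ} (hr : 0 < r) (hθ : θ ≠ 0) {η u : Vec d}
    (hη : ‖η‖ = 1) (huη : inner ℝ u η = 0) :
    ∃ (W : ℕ → WavePotential d) (ξ : Vec d) (C : ℝ), (∀ n, (W n).ξ = ξ ∧ (W n).η = η) ∧
      (∀ n, ∀ y ∉ Metric.closedBall c r, (W n).Φ y = 0) ∧
      (IsSmall fun n y => (W n).stream y) ∧ (∀ n, 1 ≤ n → ∀ y, ‖(W n).momVec y‖ ≤ C) ∧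
      (∀ δ > 0, ∀ᶠ n in atTop, ∀ y, ∃ s ∈ Icc (-1 : ℝ) 1, ∃ (e : Vec d) (E : Mat d),
        (∀ i, |e i| ≤ δ) ∧ (∀ i j, |E i j| ≤ δ) ∧ (W n).momVec y = (s * θ) • η + e ∧
        (W n).fluxMat y = (s * θ) • symProd η u + E) ∧
      ∀ᶠ n in atTop, θ ^ 2 / 8 * volume.real (Metric.closedBall c (r / 2))
        ≤ ∫ y in Metric.closedBall c r, ‖(W n).momVec y‖ ^ 2 := by
  -- The cutoff equals one on the half ball, where the lower bound for the oscillation is obtained.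
  let bump : ContDiffBump c := ⟨r / 2, r, by positivity, by linarith⟩
  let χ : smoothFn (ℝ × Vec d) := ⟨fun y => θ * bump y, contDiff_const.mul bump.contDiff⟩
  have hχc : HasCompactSupport χ := bump.hasCompactSupport.mul_left
  have hχs : tsupport χ ⊆ Metric.closedBall c r := by
    have h1 := tsupport_mul_subset_right (f := fun _ : ℝ × Vec d => θ) (g := bump)
    rw [bump.tsupport_eq] at h1
    exact h1
  have hχy : ∀ y, χ y = bump y * θ := fun y => mul_comm _ _
  obtain ⟨φ, W, hΦ, hm, hM, hst, ξ, hξη⟩ := exists_wavePotential hd hη huη χ hχc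
  choose Cm hCm using hm
  choose CM hCM using hM
  choose Cs hCs using hst
  -- The phase depends on n but takes only two values, so the O(1/n) constants may be summed into
  -- one.
  let P : Finset ℝ := {0, Real.pi / 2}
  set C : ℝ := ∑ α ∈ P, (∑ i, |Cm α i| + ∑ i, ∑ j, |CM α i j| + |Cs α|)
  have hCα : ∀ α ∈ P, ∑ i, |Cm α i| + ∑ i, ∑ j, |CM α i j| + |Cs α| ≤ C := fun α hα =>
    Finset.single_le_sum (f := fun α => ∑ i, |Cm α i| + ∑ i, ∑ j, |CM α i j| + |Cs α|)
      (fun α _ => by positivity) hα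
  have hC1 : ∀ α ∈ P, ∀ i, Cm α i ≤ C := fun α hα i => by
    have h1 := Finset.single_le_sum (f := fun i => |Cm α i|) (fun i _ => abs_nonneg _)
      (Finset.mem_univ i)
    have h2 : 0 ≤ ∑ i, ∑ j, |CM α i j| := by positivity
    linarith [hCα α hα, le_abs_self (Cm α i), abs_nonneg (Cs α)]
  have hC2 : ∀ α ∈ P, ∀ i j, CM α i j ≤ C := fun α hα i j => by
    have h1 := Finset.single_le_sum (f := fun j => |CM α i j|) (fun j _ => abs_nonneg _)
      (Finset.mem_univ j)
    have h2 := Finset.single_le_sum (f := fun i => ∑ j, |CM α i j|) (fun i _ => by positivity)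
      (Finset.mem_univ i)
    have h3 : 0 ≤ ∑ i, |Cm α i| := by positivity
    linarith [hCα α hα, le_abs_self (CM α i j), abs_nonneg (Cs α)]
  have hC3 : ∀ α ∈ P, Cs α ≤ C := fun α hα => by
    have h2 : 0 ≤ ∑ i, ∑ j, |CM α i j| := by positivity
    have h3 : 0 ≤ ∑ i, |Cm α i| := by positivity
    linarith [hCα α hα, le_abs_self (Cs α)]
  have hC0 : 0 ≤ C := by positivity
  have hKH : volume (Metric.closedBall c (r / 2)) ≠ ⊤ := measure_closedBall_lt_top.ne
  have hphase := fun n : ℕ => exists_phase (μ := (volume : Measure (ℝ × Vec d)))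
    (S := Metric.closedBall c (r / 2)) (fun y => (n : ℝ) * φ y)
    (by fun_prop : Continuous fun y => (n : ℝ) * φ y).measurable hKH
  choose α hαP hα using hphase
  have hle : ∀ {n : ℕ} {a : ℝ}, 1 ≤ n → a ≤ C → a / n ≤ C / n := fun hn ha =>
    div_le_div_of_nonneg_right ha (Nat.cast_nonneg _)
  have hlim : Tendsto (fun n : ℕ => C / n) atTop (𝓝 0) := tendsto_const_div_atTop_nhds_zero_nat C
  let s : ℕ → ℝ × Vec d → ℝ := fun n y => bump y * Real.sin (n * φ y + α n)
  have hs1 : ∀ n y, |s n y| ≤ 1 := fun n y => by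
    rw [abs_mul, abs_of_nonneg bump.nonneg]
    exact mul_le_one₀ bump.le_one (abs_nonneg _) (Real.abs_sin_le_one _)
  have hsχ : ∀ n y, χ y * Real.sin (n * φ y + α n) = s n y * θ := fun n y => by
    rw [hχy]
    ring
  let e : ℕ → ℝ × Vec d → Vec d := fun n y => (W n (α n)).momVec y - (s n y * θ) • η
  have he : ∀ n, 1 ≤ n → ∀ y i, |e n y i| ≤ C / n := fun n hn y i => by
    have h1 := (hCm (α n) i n hn y).trans (hle hn (hC1 _ (hαP n) i))
    beta_reduce at h1
    rw [hsχ] at h1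
    exact h1
  have hE : ∀ n, 1 ≤ n → ∀ y i j,
      |((W n (α n)).fluxMat y - (s n y * θ) • symProd η u) i j| ≤ C / n := fun n hn y i j => by
    have h1 := (hCM (α n) i j n hn y).trans (hle hn (hC2 _ (hαP n) i j))
    beta_reduce at h1
    rw [hsχ] at h1
    exact h1
  have hdec : ∀ n y, (W n (α n)).momVec y = (s n y * θ) • η + e n y := fun n y => by simp [e]
  have hnorm : ∀ n y, ‖(s n y * θ) • η‖ = |s n y| * |θ| := fun n y => by
    rw [norm_smul, hη, mul_one, Real.norm_eq_abs, abs_mul]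
  refine ⟨fun n => W n (α n), ξ, |θ| + d * C, fun n => hξη n _, fun n y hy => ?_,
    ⟨C, fun n hn y => (hCs (α n) n hn y).trans (hle hn (hC3 _ (hαP n)))⟩, fun n hn y => ?_,
    fun δ hδ => ?_, ?_⟩
  · exact hΦ n _ y fun h => hy (hχs h)
  · have h1 : ‖e n y‖ ≤ d * C := norm_le_of_abs_le fun i => (he n hn y i).trans
      (div_le_self hC0 (Nat.one_le_cast.2 hn))
    have h2 : |s n y| * |θ| ≤ |θ| := mul_le_of_le_one_left (abs_nonneg _) (hs1 n y)
    rw [hdec]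
    refine (norm_add_le _ _).trans ?_
    rw [hnorm]
    linarith
  · filter_upwards [(tendsto_order.1 hlim).2 δ hδ, eventually_ge_atTop 1] with n hn hn1 y
    exact ⟨s n y, abs_le.1 (hs1 n y), e n y, _, fun i => (he n hn1 y i).trans hn.le,
      fun i j => (hE n hn1 y i j).trans hn.le, hdec n y, by simp⟩
  · have hH : 0 < volume.real (Metric.closedBall c (r / 2)) := by
      rw [measureReal_def]
      exact ENNReal.toReal_pos (Metric.measure_closedBall_pos _ _ (by positivity)).ne' hKH
    set vK := volume.real (Metric.closedBall c r)
    have hlim2 : Tendsto (fun n : ℕ => (d * (C / n)) ^ 2 * vK) atTop (𝓝 0) := by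
      have := ((hlim.const_mul (d : ℝ)).pow 2).mul_const vK
      simpa using this
    have hθ2 : 0 < θ ^ 2 := by positivity
    filter_upwards [(tendsto_order.1 hlim2).2 (θ ^ 2 / 8 * volume.real
      (Metric.closedBall c (r / 2))) (by positivity), eventually_ge_atTop 1] with n hn hn1
    have hK : IsCompact (Metric.closedBall c r) := isCompact_closedBall _ _
    have hsc : Continuous fun y => s n y ^ 2 := by
      have := bump.continuous
      fun_prop
    -- This is |a|² ≤ 2|a + e|² + 2|e|². The choice of phase then gives θ²/4 times the volume of the
    -- half ball, and for large n the error takes away at most half of it.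
    have hpt : ∀ y, θ ^ 2 / 2 * s n y ^ 2 - (d * (C / n)) ^ 2 ≤ ‖(W n (α n)).momVec y‖ ^ 2 := by
      intro y
      have h1 : ‖e n y‖ ≤ d * (C / n) := norm_le_of_abs_le fun i => he n hn1 y i
      have h2 : |s n y| * |θ| ≤ ‖(W n (α n)).momVec y‖ + ‖e n y‖ := by
        rw [← hnorm, ← sub_eq_iff_eq_add.2 (hdec n y)]
        exact norm_sub_le _ _
      have h3 : (|s n y| * |θ|) ^ 2 = s n y ^ 2 * θ ^ 2 := by
        rw [mul_pow, sq_abs, sq_abs]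
      have h4 : (|s n y| * |θ|) ^ 2 ≤ (‖(W n (α n)).momVec y‖ + ‖e n y‖) ^ 2 :=
        pow_le_pow_left₀ (by positivity) h2 2
      have h5 : ‖e n y‖ ^ 2 ≤ (d * (C / n)) ^ 2 := pow_le_pow_left₀ (norm_nonneg _) h1 2
      nlinarith [sq_nonneg (‖(W n (α n)).momVec y‖ - ‖e n y‖)]
    have i1 : IntegrableOn (fun y => θ ^ 2 / 2 * s n y ^ 2) (Metric.closedBall c r) :=
      (hsc.const_mul _).continuousOn.integrableOn_compact hK
    have i2 : IntegrableOn (fun _ : ℝ × Vec d => (d * (C / (n : ℝ))) ^ 2) (Metric.closedBall c r) :=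
      continuousOn_const.integrableOn_compact hK
    have h1 : ∫ y in Metric.closedBall c r, (θ ^ 2 / 2 * s n y ^ 2 - (d * (C / n)) ^ 2)
        ≤ ∫ y in Metric.closedBall c r, ‖(W n (α n)).momVec y‖ ^ 2 :=
      integral_mono (i1.sub i2) (((W n (α n)).continuous_momVec.norm.pow
        2).continuousOn.integrableOn_compact hK) hpt
    rw [integral_sub i1 i2, integral_const_mul, setIntegral_const, smul_eq_mul] at h1
    have h2 : ∫ y in Metric.closedBall c (r / 2), s n y ^ 2
        ≤ ∫ y in Metric.closedBall c r, s n y ^ 2 :=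
      setIntegral_mono_set (hsc.continuousOn.integrableOn_compact hK)
        (Eventually.of_forall fun y => sq_nonneg _)
        (Metric.closedBall_subset_closedBall (by linarith)).eventuallyLE
    have h3 : ∫ y in Metric.closedBall c (r / 2), s n y ^ 2
        = ∫ y in Metric.closedBall c (r / 2), Real.sin (n * φ y + α n) ^ 2 := by
      refine setIntegral_congr_fun Metric.isClosed_closedBall.measurableSet fun y hy => ?_
      simp only [s, bump.one_of_mem_closedBall hy, one_mul]
    have h4 := hα n
    have h5 : θ ^ 2 / 2 * (volume.real (Metric.closedBall c (r / 2)) / 2)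
        ≤ θ ^ 2 / 2 * ∫ y in Metric.closedBall c r, s n y ^ 2 :=
      mul_le_mul_of_nonneg_left (by linarith) (by positivity)
    rw [mul_comm] at hn
    linarith

/-- A perturbation of a subsolution in a single ball. -/
lemma exists_perturbation (hπ : IsLocalModel π) (hd : 2 ≤ d) (hΩ : IsOpen Ω)
    {w : PathSpace d γ T G} {z : Fields d G}
    (hw : w ∈ spaceX₀ π Ω z₀ mref) (hz : IsWitness π Ω z₀ w z) {x₀ : Vec d} {c : ℝ × Vec d}
    {r θ δ : ℝ} (hr : 0 < r) (hθ : θ ≠ 0) (hδ : 0 < δ) (hKx : Metric.closedBall c r ⊆ cyl x₀)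
    (hKΩ : ∀ y ∈ Metric.closedBall c r, lift π y ∈ Ioo 0 T ×ˢ Ω) {η u : Vec d}
    (hη : ‖η‖ = 1) (huη : inner ℝ u η = 0)
    (hadm : ∀ y ∈ Metric.closedBall c r, ∀ s ∈ Icc (-1 : ℝ) 1, ∀ (e : Vec d) (E : Mat d),
      (∀ i, |e i| ≤ δ) → (∀ i j, |E i j| ≤ δ) →
      (z.ρ (lift π y).1 (lift π y).2, z.m (lift π y).1 (lift π y).2 + ((s * θ) • η + e),
        z.M (lift π y).1 (lift π y).2 + ((s * θ) • symProd η u + E),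
        z.Q (lift π y).1 (lift π y).2) ∈ admissible d γ) {N : Set (PathSpace d γ T G)}
    (hN : N ∈ 𝓝 w) :
    ∃ w' ∈ spaceX₀ π Ω z₀ mref, ∃ z', IsWitness π Ω z₀ w' z' ∧ w' ∈ N ∧ z'.ρ = z.ρ ∧
      (∀ q ∉ lift π '' Metric.closedBall c r, z'.m q.1 q.2 = z.m q.1 q.2 ∧
        z'.M q.1 q.2 = z.M q.1 q.2) ∧
      θ ^ 2 / 8 * volume.real (Metric.closedBall c (r / 2)) ≤ ∫ y in Metric.closedBall c r,
        ‖z'.m (lift π y).1 (lift π y).2 - z.m (lift π y).1 (lift π y).2‖ ^ 2 := by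
  obtain ⟨W, ξ, C, hξη, hΦ, hst, hC, hform, hgain⟩ := exists_waves hd hr hθ hη huη (c := c)
  have hK : IsCompact (Metric.closedBall c r) := isCompact_closedBall _ _
  have hm0 : ∀ n, ∀ y ∉ Metric.closedBall c r, (W n).momVec y = 0 := fun n y hy =>
    PiLp.ext fun i => ((W n).off_d hK.isClosed (hΦ n) y hy).1 i
  have hM0 : ∀ n, ∀ y ∉ Metric.closedBall c r, (W n).fluxMat y = 0 := fun n y hy => by
    ext i j
    exact ((W n).off_d hK.isClosed (hΦ n) y hy).2 i j
  have hpath := fun n => exists_path_of_continuous (p := 2) (T := T)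
    (continuous_push hπ (W n).continuous_momVec hK hKx (hm0 n)) (hK.image (continuous_lift hπ))
    fun q hq => push_eq_zero (hm0 n) hq
  choose v hv using hpath
  have hvlim := tendsto_wave hπ hK hKx hΦ hξη hst hC hv
  have hwlim : Tendsto (fun n => ((w.1, w.2 + v n) : PathSpace d γ T G)) atTop (𝓝 w) := by
    have h2 : Tendsto (fun n => w.2 + v n) atTop (𝓝 (w.2 + 0)) := tendsto_const_nhds.add hvlim
    rw [add_zero] at h2
    exact tendsto_const_nhds.prodMk_nhds h2
  obtain ⟨n, h1, h2, h3⟩ := ((hform δ hδ).and (hgain.and (hwlim.eventually hN))).exists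
  obtain ⟨m1, m2⟩ := addWave_mem hπ (by omega) hΩ hw hz hK hKx hKΩ (hΦ n) (fun y hy => by
    obtain ⟨s, hs, e, E, he, hE, e1, e2⟩ := h1 y
    rw [e1, e2]
    exact hadm y hy s hs e E he hE) (hv n)
  refine ⟨_, m1, _, m2, h3, rfl, fun q hq => ?_, h2.trans (le_of_eq ?_)⟩
  · simp only [addWave]
    rw [push_eq_zero (hm0 n) hq, push_eq_zero (hM0 n) hq, add_zero, add_zero]
    exact ⟨rfl, rfl⟩
  · refine setIntegral_congr_fun hK.measurableSet fun y hy => ?_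
    simp only [addWave]
    rw [push_lift hπ _ (hKx hy), add_sub_cancel_left]

end Ball

/-! ### Many disjoint balls, and the gain in terms of the excess -/

section Balls

variable {d : ℕ} {γ T : ℝ} [hγ : Fact (1 < γ)] {G : Type} [AddCommGroup G] [TopologicalSpace G]
  [MeasureSpace G] [BorelSpace G] [SecondCountableTopology G] [LocallyCompactSpace G] [T2Space G]
  [IsLocallyFiniteMeasure (volume : Measure G)] {π : Vec d →+ G} {Ω : Set G} {z₀ : Fields d G}
  {mref : ℝ → G → Vec d}

/-- A closed ball in which the subsolution `z` can be perturbed by waves in the direction `η`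
with amplitude `θ`. -/
structure IsGoodBall (γ : ℝ) (π : Vec d →+ G) (z : Fields d G) (c : ℝ × Vec d) (r θ : ℝ) :
    Prop where
  r_pos : 0 < r
  θ_ne : θ ≠ 0
  adm : ∃ η u : Vec d, ‖η‖ = 1 ∧ inner ℝ u η = 0 ∧ ∃ δ > 0,
    ∀ y ∈ Metric.closedBall c r, ∀ s ∈ Icc (-1 : ℝ) 1, ∀ (e : Vec d) (E : Mat d),
      (∀ i, |e i| ≤ δ) → (∀ i j, |E i j| ≤ δ) →
      (z.ρ (lift π y).1 (lift π y).2, z.m (lift π y).1 (lift π y).2 + ((s * θ) • η + e),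
        z.M (lift π y).1 (lift π y).2 + ((s * θ) • symProd η u + E),
        z.Q (lift π y).1 (lift π y).2) ∈ admissible d γ

/-- Perturbations in finitely many disjoint balls. -/
lemma exists_perturbations (hπ : IsLocalModel π) (hd : 2 ≤ d) (hΩ : IsOpen Ω)
    {w : PathSpace d γ T G} {z : Fields d G}
    (hw : w ∈ spaceX₀ π Ω z₀ mref) (hz : IsWitness π Ω z₀ w z) {x₀ : Vec d}
    {r θ : ℝ × Vec d → ℝ} (s : Finset (ℝ × Vec d))
    (hgood : ∀ c ∈ s, IsGoodBall γ π z c (r c) (θ c))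
    (hdisj : (s : Set (ℝ × Vec d)).PairwiseDisjoint fun c => Metric.closedBall c (r c))
    (hKx : ∀ c ∈ s, Metric.closedBall c (r c) ⊆ cyl x₀)
    (hKΩ : ∀ c ∈ s, ∀ y ∈ Metric.closedBall c (r c), lift π y ∈ Ioo 0 T ×ˢ Ω) :
    ∀ N ∈ 𝓝 w, ∃ w' ∈ spaceX₀ π Ω z₀ mref, ∃ z', IsWitness π Ω z₀ w' z' ∧ w' ∈ N ∧ z'.ρ = z.ρ ∧
      (∀ q, (∀ c ∈ s, q ∉ lift π '' Metric.closedBall c (r c)) → z'.m q.1 q.2 = z.m q.1 q.2 ∧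
        z'.M q.1 q.2 = z.M q.1 q.2) ∧
      ∀ c ∈ s, θ c ^ 2 / 8 * volume.real (Metric.closedBall c (r c / 2))
        ≤ ∫ y in Metric.closedBall c (r c),
          ‖z'.m (lift π y).1 (lift π y).2 - z.m (lift π y).1 (lift π y).2‖ ^ 2 := by
  classical
  induction s using Finset.induction_on with
  | empty =>
    intro N hN
    exact ⟨w, hw, z, hz, mem_of_mem_nhds hN, rfl, fun q _ => ⟨rfl, rfl⟩, by simp⟩
  | insert c s hcs ih =>
    intro N hN
    have hsub : ∀ c' ∈ s, c' ∈ insert c s := fun c' h => Finset.mem_insert_of_mem h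
    have hc : c ∈ insert c s := Finset.mem_insert_self _ _
    obtain ⟨w₁, hw₁, z₁, hz₁, hN₁, hρ₁, hoff₁, hgain₁⟩ := ih (fun c' h => hgood c' (hsub c' h))
      (hdisj.subset (by simp)) (fun c' h => hKx c' (hsub c' h))
      (fun c' h => hKΩ c' (hsub c' h)) (interior N) (interior_mem_nhds.2 hN)
    -- All balls lie in one cylinder where the lift is injective, so their images are disjoint as
    -- well; earlier waves do not affect the next ball.
    have hdis : ∀ c' ∈ s, ∀ y ∈ Metric.closedBall c (r c), ∀ y' ∈ Metric.closedBall c' (r c'),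
        lift π y ≠ lift π y' := fun c' hc' y hy y' hy' h => by
      have hyy := injOn_lift hπ x₀ (hKx c hc hy) (hKx c' (hsub c' hc') hy') h
      have hne : c ≠ c' := fun h => hcs (h ▸ hc')
      exact (Set.disjoint_left.1 (hdisj hc (hsub c' hc') hne) hy) (hyy ▸ hy')
    have hz₁c : ∀ y ∈ Metric.closedBall c (r c),
        z₁.m (lift π y).1 (lift π y).2 = z.m (lift π y).1 (lift π y).2 ∧
        z₁.M (lift π y).1 (lift π y).2 = z.M (lift π y).1 (lift π y).2 := fun y hy =>
      hoff₁ (lift π y) fun c' hc' h => by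
        obtain ⟨y', hy', hyy⟩ := h
        exact hdis c' hc' y hy y' hy' hyy.symm
    have hg := hgood c hc
    obtain ⟨η, u, hη, huη, δ, hδ, hadm⟩ := hg.adm
    obtain ⟨w₂, hw₂, z₂, hz₂, hN₂, hρ₂, hoff₂, hgain₂⟩ := exists_perturbation hπ hd hΩ hw₁ hz₁
      hg.r_pos hg.θ_ne hδ (hKx c hc) (hKΩ c hc) hη huη (fun y hy s hs e E he hE => by
        rw [hρ₁, (hz₁c y hy).1, (hz₁c y hy).2, hz₁.Q_eq, ← hz.Q_eq]
        exact hadm y hy s hs e E he hE) (isOpen_interior.mem_nhds hN₁)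
    refine ⟨w₂, hw₂, z₂, hz₂, interior_subset hN₂, hρ₂.trans hρ₁, fun q hq => ?_, fun c' hc' => ?_⟩
    · have h1 := hoff₁ q fun c' hc' => hq c' (hsub c' hc')
      have h2 := hoff₂ q (hq c hc)
      exact ⟨h2.1.trans h1.1, h2.2.trans h1.2⟩
    · rcases Finset.mem_insert.1 hc' with rfl | hc'
      · refine hgain₂.trans (le_of_eq ?_)
        refine setIntegral_congr_fun Metric.isClosed_closedBall.measurableSet fun y hy => ?_
        rw [(hz₁c y hy).1]
      · refine (hgain₁ c' hc').trans (le_of_eq ?_)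
        refine setIntegral_congr_fun Metric.isClosed_closedBall.measurableSet fun y hy => ?_
        have := (hoff₂ (lift π y) (by
          rintro ⟨y', hy', hyy⟩
          exact hdis c' hc' y' hy' y hy hyy)).1
        rw [this]

/-- The energy defect of a subsolution. -/
def excess (γ : ℝ) (z : Fields d G) (q : ℝ × G) : ℝ :=
  z.Q q.1 q.2 - energy d γ (z.ρ q.1 q.2) (z.m q.1 q.2)

lemma IsWitness.excess_pos {w : PathSpace d γ T G} {z : Fields d G} (hz : IsWitness π Ω z₀ w z)
    {q : ℝ × G} (hq : q ∈ Ioo 0 T ×ˢ Ω) : 0 < excess γ z q := by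
  rw [excess, hz.Q_eq]
  exact sub_pos.2 (hz.energy_lt hq.1 hq.2)

lemma IsWitness.excess_le {w : PathSpace d γ T G} {z : Fields d G} (hz : IsWitness π Ω z₀ w z)
    {q : ℝ × G} (hq : q ∈ Ioo 0 T ×ˢ Ω) : excess γ z q ≤ z₀.Q q.1 q.2 := by
  rw [excess, hz.Q_eq]
  have h1 := hz.sub.density_pos q.1 hq.1 q.2
  have h2 : 0 ≤ pressure γ (z.ρ q.1 q.2) := Real.rpow_nonneg h1.le _
  have : 0 ≤ energy d γ (z.ρ q.1 q.2) (z.m q.1 q.2) := by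
    rw [energy]
    positivity
  linarith

lemma IsWitness.continuousOn_excess (hd : 0 < d) {w : PathSpace d γ T G} {z : Fields d G}
    (hz : IsWitness π Ω z₀ w z) : ContinuousOn (excess γ z) (Ioo 0 T ×ˢ Ω) := by
  have hd' : (0 : ℝ) < d := by exact_mod_cast hd
  have hsub : Ioo 0 T ×ˢ Ω ⊆ Icc 0 T ×ˢ Ω := prod_mono Ioo_subset_Icc_self subset_rfl
  have c1 := hz.cont_ρ.mono hsub
  have hne : ∀ q ∈ Ioo 0 T ×ˢ Ω, z.ρ q.1 q.2 ≠ 0 := fun q hq =>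
    (hz.sub.density_pos q.1 hq.1 q.2).ne'
  exact (hz.cont_Q.mono hsub).sub ((c1.rpow_const fun q hq => Or.inl (hne q hq)).add
    (((hz.cont_m.mono hsub).norm.pow 2).div (c1.const_mul _) fun q hq =>
      mul_ne_zero hd'.ne' (hne q hq)))

/-- The constant in the gain of a perturbation. -/
def gainConst (d : ℕ) (C : ℝ) : ℝ :=
  (64 * (64 * d ^ 2 * (C + 1)) * 2 ^ Module.finrank ℝ (ℝ × Vec d))⁻¹

/-- The segment of `exists_segment` at the centre is compact and the admissible set is open, so one
amplitude and one direction work throughout a small ball, with room for the O(1/n) errors. By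
continuity, excess and density in the ball are at most twice their values at the centre; hence the
gain, computed from the centre, is comparable with the integral of the squared excess. -/
lemma exists_goodBall (hπ : IsLocalModel π) (hd : 2 ≤ d) (hΩ : IsOpen Ω)
    {w : PathSpace d γ T G} {z : Fields d G} (hz : IsWitness π Ω z₀ w z) {U : Set (ℝ × Vec d)}
    (hU : IsOpen U) (hUΩ : ∀ y ∈ U, lift π y ∈ Ioo 0 T ×ˢ Ω) {c : ℝ × Vec d} (hc : c ∈ U) {C : ℝ}
    (hC : z₀.Q (lift π c).1 (lift π c).2 ≤ C) :
    ∃ r θ : ℝ, IsGoodBall γ π z c r θ ∧ r ≤ 1 ∧ Metric.closedBall c r ⊆ U ∧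
      (∀ y ∈ Metric.closedBall c r,
        z.ρ (lift π y).1 (lift π y).2 ≤ 2 * z.ρ (lift π c).1 (lift π c).2) ∧
      gainConst d C * ∫ y in Metric.closedBall c r, excess γ z (lift π y) ^ 2
        ≤ (2 * z.ρ (lift π c).1 (lift π c).2)⁻¹ *
          (θ ^ 2 / 8 * volume.real (Metric.closedBall c (r / 2))) := by
  have hd0 : 0 < d := by omega
  have hd' : (0 : ℝ) < d := by exact_mod_cast hd0
  have hcΩ := hUΩ c hc
  have hnhds : Icc 0 T ×ˢ Ω ∈ 𝓝 (lift π c) :=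
    mem_of_superset ((isOpen_Ioo.prod hΩ).mem_nhds hcΩ) (prod_mono Ioo_subset_Icc_self subset_rfl)
  have hnhds' : Ioo 0 T ×ˢ Ω ∈ 𝓝 (lift π c) := (isOpen_Ioo.prod hΩ).mem_nhds hcΩ
  have hl : ContinuousAt (lift π) c := (continuous_lift hπ).continuousAt
  have cρ : ContinuousAt (fun y => z.ρ (lift π y).1 (lift π y).2) c :=
    ContinuousAt.comp (g := fun q : ℝ × G => z.ρ q.1 q.2) (hz.cont_ρ.continuousAt hnhds) hl
  have cm : ContinuousAt (fun y => z.m (lift π y).1 (lift π y).2) c :=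
    ContinuousAt.comp (g := fun q : ℝ × G => z.m q.1 q.2) (hz.cont_m.continuousAt hnhds) hl
  have cM : ContinuousAt (fun y => z.M (lift π y).1 (lift π y).2) c :=
    ContinuousAt.comp (g := fun q : ℝ × G => z.M q.1 q.2) (hz.cont_M.continuousAt hnhds) hl
  have cQ : ContinuousAt (fun y => z.Q (lift π y).1 (lift π y).2) c :=
    ContinuousAt.comp (g := fun q : ℝ × G => z.Q q.1 q.2) (hz.cont_Q.continuousAt hnhds) hl
  have cF : ContinuousAt (fun y => excess γ z (lift π y)) c :=
    ContinuousAt.comp (g := excess γ z) ((hz.continuousOn_excess hd0).continuousAt hnhds') hl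
  have hρ := hz.sub.density_pos _ hcΩ.1 (lift π c).2
  have hF := hz.excess_pos hcΩ
  obtain ⟨η, u, θ, hη, huη, hθ, hseg⟩ := exists_segment hd
    (hz.sub.symm _ hcΩ.1 (lift π c).2) ((mem_admissible_iff hd0 (hz.sub.symm _ hcΩ.1 _) hρ).2
      (hz.strict _ hcΩ.1 _ hcΩ.2))
  have hev : ∀ᶠ x : (ℝ × Vec d) × (Vec d × (Fin d → Fin d → ℝ)) in 𝓝 (c, 0),
      ∀ s ∈ Icc (-1 : ℝ) 1,
      (z.ρ (lift π x.1).1 (lift π x.1).2,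
        z.m (lift π x.1).1 (lift π x.1).2 + ((s * θ) • η + x.2.1),
        z.M (lift π x.1).1 (lift π x.1).2 + ((s * θ) • symProd η u + Matrix.of x.2.2),
        z.Q (lift π x.1).1 (lift π x.1).2) ∈ admissible d γ := by
    -- The tube lemma in s: the neighbourhood is uniform over the compact parameter interval.
    refine isCompact_Icc.eventually_forall_of_forall_eventually fun s hs => ?_
    have c1 : ContinuousAt (fun p : ((ℝ × Vec d) × (Vec d × (Fin d → Fin d → ℝ))) × ℝ =>
        (z.ρ (lift π p.1.1).1 (lift π p.1.1).2,
        z.m (lift π p.1.1).1 (lift π p.1.1).2 + ((p.2 * θ) • η + p.1.2.1),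
        z.M (lift π p.1.1).1 (lift π p.1.1).2 + ((p.2 * θ) • symProd η u + Matrix.of p.1.2.2),
        z.Q (lift π p.1.1).1 (lift π p.1.1).2)) ((c, 0), s) := by
      have h1 : ContinuousAt (fun p : ((ℝ × Vec d) × (Vec d × (Fin d → Fin d → ℝ))) × ℝ => p.1.1)
          ((c, 0), s) := by fun_prop
      have h2 : Continuous fun p : ((ℝ × Vec d) × (Vec d × (Fin d → Fin d → ℝ))) × ℝ =>
          Matrix.of p.1.2.2 := by
        refine continuous_matrix fun i j => ?_
        simp only [Matrix.of_apply]
        fun_prop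
      have h3 : Continuous fun p : ((ℝ × Vec d) × (Vec d × (Fin d → Fin d → ℝ))) × ℝ =>
          (p.2 * θ) • symProd η u := by fun_prop
      have h4 : ∀ {Y : Type} [TopologicalSpace Y] {g : ℝ × Vec d → Y}, ContinuousAt g c →
          ContinuousAt (fun p : ((ℝ × Vec d) × (Vec d × (Fin d → Fin d → ℝ))) × ℝ => g p.1.1)
            ((c, 0), s) := fun {Y _ g} hg => ContinuousAt.comp (g := g) hg h1
      refine (h4 cρ).prodMk
        (ContinuousAt.prodMk ?_ (ContinuousAt.prodMk ?_ ?_))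
      · exact (h4 cm).add (by fun_prop)
      · exact (h4 cM).add (h3.add h2).continuousAt
      · exact h4 cQ
    refine c1.eventually ((isOpen_admissible d γ).mem_nhds ?_)
    have := hseg s hs
    simpa using this
  obtain ⟨ε, hε, hball⟩ := Metric.nhds_basis_closedBall.eventually_iff.1 hev
  have hev2 : ∀ᶠ y in 𝓝 c, y ∈ U ∧
      z.ρ (lift π y).1 (lift π y).2 ≤ 2 * z.ρ (lift π c).1 (lift π c).2 ∧
      excess γ z (lift π y) ≤ 2 * excess γ z (lift π c) := by
    filter_upwards [hU.mem_nhds hc, (tendsto_order.1 cρ).2 (2 * z.ρ (lift π c).1 (lift π c).2)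
      (by linarith), (tendsto_order.1 cF).2 (2 * excess γ z (lift π c)) (by linarith)]
      with y h1 h2 h3
    exact ⟨h1, h2.le, h3.le⟩
  obtain ⟨ε', hε', hball'⟩ := Metric.nhds_basis_closedBall.eventually_iff.1 hev2
  have hQp : 0 < z.Q (lift π c).1 (lift π c).2 - pressure γ (z.ρ (lift π c).1 (lift π c).2) := by
    have h1 : 0 ≤ ‖z.m (lift π c).1 (lift π c).2‖ ^ 2 / (d * z.ρ (lift π c).1 (lift π c).2) := by
      positivity
    rw [excess, energy] at hF
    linarith
  have hθ' : θ ^ 2 = excess γ z (lift π c) ^ 2 * z.ρ (lift π c).1 (lift π c).2 / (64 * d ^ 2 *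
      (z.Q (lift π c).1 (lift π c).2 - pressure γ (z.ρ (lift π c).1 (lift π c).2))) := by
    rw [hθ, excess, energy, sub_sub]
  have hθ0 : θ ≠ 0 := by
    have : 0 < θ ^ 2 := by
      rw [hθ']
      positivity
    intro h
    simp [h] at this
  set r := min ε (min ε' 1)
  have hr : 0 < r := lt_min hε (lt_min hε' one_pos)
  have hrε : r ≤ ε := min_le_left _ _
  have hrε' : r ≤ ε' := (min_le_right _ _).trans (min_le_left _ _)
  have hsub : ∀ y ∈ Metric.closedBall c r, y ∈ Metric.closedBall c ε' := fun y hy =>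
    Metric.closedBall_subset_closedBall hrε' hy
  -- Entries of size ε/(d + 1) keep both the Euclidean norm of e and the supremum norm of E below ε.
  refine ⟨r, θ, ⟨hr, hθ0, η, u, hη, huη, ε / (d + 1), by positivity, ?_⟩,
    (min_le_right _ _).trans (min_le_right _ _), fun y hy => (hball' (hsub y hy)).1,
    fun y hy => (hball' (hsub y hy)).2.1, ?_⟩
  · intro y hy s hs e E he hE
    have hle : ε / (d + 1) ≤ ε := div_le_self hε.le (by linarith)
    have h1 : ‖e‖ ≤ ε := by
      refine (norm_le_of_abs_le he).trans ?_
      rw [mul_div_assoc', div_le_iff₀ (by positivity)]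
      nlinarith
    have h2 : ‖(fun i j => E i j : Fin d → Fin d → ℝ)‖ ≤ ε :=
      (pi_norm_le_iff_of_nonneg hε.le).2 fun i => (pi_norm_le_iff_of_nonneg hε.le).2 fun j =>
        (hE i j).trans hle
    have h3 : ((y, e, fun i j => E i j) : (ℝ × Vec d) × (Vec d × (Fin d → Fin d → ℝ)))
        ∈ Metric.closedBall (c, 0) ε := by
      rw [Metric.mem_closedBall, Prod.dist_eq, max_le_iff]
      refine ⟨(Metric.mem_closedBall.1 hy).trans hrε, ?_⟩
      rw [dist_zero_right, Prod.norm_def, max_le_iff]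
      exact ⟨h1, h2⟩
    exact hball h3 s hs
  · have hv := Measure.addHaar_real_closedBall (volume : Measure (ℝ × Vec d)) c hr.le
    have hv2 := Measure.addHaar_real_closedBall (volume : Measure (ℝ × Vec d)) c
      (by positivity : 0 ≤ r / 2)
    have hvv : volume.real (Metric.closedBall c r) = 2 ^ Module.finrank ℝ (ℝ × Vec d) *
        volume.real (Metric.closedBall c (r / 2)) := by
      rw [hv, hv2, div_pow]
      field_simp
    have hint : ∫ y in Metric.closedBall c r, excess γ z (lift π y) ^ 2
        ≤ 4 * excess γ z (lift π c) ^ 2 * volume.real (Metric.closedBall c r) := by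
      have h1 : ∀ y ∈ Metric.closedBall c r, ‖excess γ z (lift π y) ^ 2‖
          ≤ 4 * excess γ z (lift π c) ^ 2 := fun y hy => by
        have h2 := hball' (hsub y hy)
        have h3 := hz.excess_pos (hUΩ y h2.1)
        rw [Real.norm_eq_abs, abs_of_nonneg (sq_nonneg _)]
        nlinarith [h2.2.2]
      exact (le_abs_self _).trans
        (norm_setIntegral_le_of_norm_le_const measure_closedBall_lt_top h1)
    have hQC : z.Q (lift π c).1 (lift π c).2 - pressure γ (z.ρ (lift π c).1 (lift π c).2)
        ≤ C + 1 := by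
      have : 0 ≤ pressure γ (z.ρ (lift π c).1 (lift π c).2) := Real.rpow_nonneg hρ.le _
      rw [hz.Q_eq]
      linarith
    have hC1 : 0 < C + 1 := hQp.trans_le hQC
    have hκ : 0 ≤ gainConst d C := by
      rw [gainConst]
      positivity
    have hθlow : excess γ z (lift π c) ^ 2 * z.ρ (lift π c).1 (lift π c).2 / (64 * d ^ 2 * (C + 1))
        ≤ θ ^ 2 := by
      rw [hθ']
      gcongr
    set v := volume.real (Metric.closedBall c (r / 2))
    have hv0 : 0 ≤ v := measureReal_nonneg
    set F := excess γ z (lift π c)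
    set R := z.ρ (lift π c).1 (lift π c).2
    -- In `gainConst` the outer 64 is 4 · 2 · 8: the growth of the squared excess in the ball, the
    -- growth of the density, and the wave. The power of two compares the ball with its half, and 64
    -- d² (C + 1) bounds the denominator of θ².
    calc gainConst d C * ∫ y in Metric.closedBall c r, excess γ z (lift π y) ^ 2
        ≤ gainConst d C * (4 * F ^ 2 * volume.real (Metric.closedBall c r)) :=
          mul_le_mul_of_nonneg_left hint hκ
      _ = (2 * R)⁻¹ * (F ^ 2 * R / (64 * d ^ 2 * (C + 1)) / 8 * v) := by
          rw [hvv, gainConst]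
          field_simp
          ring
      _ ≤ (2 * R)⁻¹ * (θ ^ 2 / 8 * v) := by gcongr

end Balls

/-- Finitely many disjoint balls carry a fixed fraction of the integral of a nonnegative
function. -/
lemma exists_finset_disjoint_balls_large_integral {E : Type*} [NormedAddCommGroup E]
    [NormedSpace ℝ E] [FiniteDimensional ℝ E] [MeasurableSpace E] [BorelSpace E]
    {μ : Measure E} {N : ℕ} {τ : ℝ} (hτ : 1 < τ)
    (hN : IsEmpty (Besicovitch.SatelliteConfig E N τ)) {U S : Set E} (hU : MeasurableSet U)
    (hS : MeasurableSet S) (hSU : S ⊆ U) {f : E → ℝ} (hf : IntegrableOn f U μ)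
    (hf0 : ∀ y ∈ U, 0 ≤ f y) {r : E → ℝ} (hr : ∀ y ∈ S, 0 < r y) (hr1 : ∀ y ∈ S, r y ≤ 1)
    (hrU : ∀ y ∈ S, Metric.closedBall y (r y) ⊆ U) :
    ∃ t : Finset E, ↑t ⊆ S ∧ (t : Set E).PairwiseDisjoint (fun y => Metric.closedBall y (r y)) ∧
      ((N : ℝ) + 1)⁻¹ * ∫ y in S, f y ∂μ ≤ ∑ c ∈ t, ∫ y in Metric.closedBall c (r c), f y ∂μ := by
  have hval : ∀ A, MeasurableSet A → A ⊆ U →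
      (μ.restrict U).withDensity (fun y => ENNReal.ofReal (f y)) A
        = ENNReal.ofReal (∫ y in A, f y ∂μ) := fun A hA hAU => by
    rw [withDensity_apply _ hA, Measure.restrict_restrict hA, inter_eq_left.2 hAU,
      ofReal_integral_eq_lintegral_ofReal (hf.mono_set hAU)
        (ae_restrict_of_forall_mem hA fun y hy => hf0 y (hAU hy))]
  have hfin : IsFiniteMeasure ((μ.restrict U).withDensity fun y => ENNReal.ofReal (f y)) := by
    refine ⟨?_⟩
    rw [withDensity_apply _ MeasurableSet.univ, Measure.restrict_univ,
      ← ofReal_integral_eq_lintegral_ofReal hf (ae_restrict_of_forall_mem hU hf0)]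
    exact ENNReal.ofReal_lt_top
  -- Besicovitch is applied to the finite measure with density f; the finitely many balls miss at
  -- most the fraction N/(N + 1) of S.
  obtain ⟨t, htS, hle, hdisj⟩ := Besicovitch.exist_finset_disjoint_balls_large_measure
    ((μ.restrict U).withDensity fun y => ENNReal.ofReal (f y)) hτ hN S r hr hr1
  refine ⟨t, htS, hdisj, ?_⟩
  set V := ⋃ x ∈ t, Metric.closedBall x (r x) with hV
  have hVm : MeasurableSet V :=
    t.measurableSet_biUnion fun _ _ => Metric.isClosed_closedBall.measurableSet
  have hVU : V ⊆ U := iUnion₂_subset fun c hc => hrU c (htS hc)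
  have hsum : ∫ y in V, f y ∂μ = ∑ c ∈ t, ∫ y in Metric.closedBall c (r c), f y ∂μ :=
    integral_biUnion_finset t (fun _ _ => Metric.isClosed_closedBall.measurableSet) hdisj
      fun c hc => hf.mono_set (hrU c (htS hc))
  have h0 : 0 ≤ ∫ y in S, f y ∂μ := setIntegral_nonneg hS fun y hy => hf0 y (hSU hy)
  have hN0 : (0 : ℝ) < N + 1 := by positivity
  have hle' : ∫ y in S \ V, f y ∂μ ≤ N / (N + 1) * ∫ y in S, f y ∂μ := by
    rw [hval _ (hS.diff hVm) (sdiff_subset.trans hSU), hval _ hS hSU] at hle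
    have : (N : ℝ≥0∞) / (N + 1) = ENNReal.ofReal (N / (N + 1)) := by
      rw [ENNReal.ofReal_div_of_pos hN0, ENNReal.ofReal_natCast,
        ENNReal.ofReal_add (by positivity) zero_le_one, ENNReal.ofReal_natCast, ENNReal.ofReal_one]
    rw [this, ← ENNReal.ofReal_mul (by positivity)] at hle
    exact (ENNReal.ofReal_le_ofReal_iff (by positivity)).1 hle
  have hsplit := integral_inter_add_sdiff (μ := μ) hVm (hf.mono_set hSU)
  have hmono : ∫ y in S ∩ V, f y ∂μ ≤ ∫ y in V, f y ∂μ :=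
    setIntegral_mono_set (hf.mono_set hVU)
      (ae_restrict_of_forall_mem hVm fun y hy => hf0 y (hVU hy))
      (Eventually.of_forall inter_subset_right)
  have hid : ((N : ℝ) + 1)⁻¹ * ∫ y in S, f y ∂μ
      = (∫ y in S, f y ∂μ) - N / (N + 1) * ∫ y in S, f y ∂μ := by
    field_simp
    ring
  rw [← hsum]
  linarith

/-! ### A uniform gain for subsolutions with non-small excess -/

section Improvement

variable {d : ℕ} {γ T : ℝ} [hγ : Fact (1 < γ)] {G : Type} [AddCommGroup G] [TopologicalSpace G]
  [MeasureSpace G] [BorelSpace G] [SecondCountableTopology G] [LocallyCompactSpace G] [T2Space G]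
  [IsLocallyFiniteMeasure (volume : Measure G)] {π : Vec d →+ G} {Ω : Set G} {z₀ : Fields d G}
  {mref : ℝ → G → Vec d}

lemma gainConst_pos (hd : 0 < d) {C : ℝ} (hC : 0 ≤ C) : 0 < gainConst d C := by
  have : (0 : ℝ) < d := by exact_mod_cast hd
  rw [gainConst]
  positivity

/-- The weighted distance of two momentum fields. -/
def momentumDist (z z' : Fields d G) (q : ℝ × G) : ℝ :=
  ‖z'.m q.1 q.2 - z.m q.1 q.2‖ ^ 2 / z.ρ q.1 q.2

lemma IsWitness.momentumDist_nonneg {w : PathSpace d γ T G} {z : Fields d G}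
    (hz : IsWitness π Ω z₀ w z) (z' : Fields d G) {q : ℝ × G} (hq : q ∈ Ioo 0 T ×ˢ Ω) :
    0 ≤ momentumDist z z' q :=
  div_nonneg (sq_nonneg _) (hz.sub.density_pos q.1 hq.1 q.2).le

lemma IsWitness.continuousOn_momentumDist {w w' : PathSpace d γ T G} {z z' : Fields d G}
    (hz : IsWitness π Ω z₀ w z) (hz' : IsWitness π Ω z₀ w' z') :
    ContinuousOn (momentumDist z z') (Ioo 0 T ×ˢ Ω) := by
  have hsub : Ioo 0 T ×ˢ Ω ⊆ Icc 0 T ×ˢ Ω := prod_mono Ioo_subset_Icc_self subset_rfl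
  exact (((hz'.cont_m.mono hsub).sub (hz.cont_m.mono hsub)).norm.pow 2).div
    (hz.cont_ρ.mono hsub) fun q hq => (hz.sub.density_pos q.1 hq.1 q.2).ne'

/-- The improvement of a subsolution in a single chart. -/
lemma exists_improvement_chart (hπ : IsLocalModel π) (hd : 2 ≤ d) (hΩ : IsOpen Ω) {N₀ : ℕ} {τ : ℝ}
    (hτ : 1 < τ) (hN₀ : IsEmpty (Besicovitch.SatelliteConfig (ℝ × Vec d) N₀ τ))
    {a b : ℝ} {D : Set G} (hB : IsBox T Ω a b D) {C : ℝ} (hC0 : 0 ≤ C)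
    (hC : ∀ q ∈ Icc a b ×ˢ D, z₀.Q q.1 q.2 ≤ C)
    {x₀ : Vec d} {U S : Set (ℝ × Vec d)} (hU : IsOpen U) (hUx : U ⊆ cyl x₀)
    (hUv : volume U ≠ ⊤) (hUB : ∀ y ∈ U, lift π y ∈ Icc a b ×ˢ D) (hS : MeasurableSet S)
    (hSU : S ⊆ U) {w : PathSpace d γ T G} {z : Fields d G}
    (hw : w ∈ spaceX₀ π Ω z₀ mref) (hz : IsWitness π Ω z₀ w z) :
    ∀ N ∈ 𝓝 w, ∃ w' ∈ spaceX₀ π Ω z₀ mref, ∃ z', IsWitness π Ω z₀ w' z' ∧ w' ∈ N ∧ z'.ρ = z.ρ ∧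
      gainConst d C * (((N₀ : ℝ) + 1)⁻¹ * ∫ y in S, excess γ z (lift π y) ^ 2)
        ≤ ∫ q in Icc a b ×ˢ D, momentumDist z z' q := by
  intro N hN
  have hd0 : 0 < d := by omega
  have hUΩ : ∀ y ∈ U, lift π y ∈ Ioo 0 T ×ˢ Ω := fun y hy => hB.subset (hUB y hy)
  have hl : ContinuousOn (lift π) U := (continuous_lift hπ).continuousOn
  have hFc : ContinuousOn (fun y => excess γ z (lift π y) ^ 2) U :=
    ((hz.continuousOn_excess hd0).comp hl hUΩ).pow 2
  have hFi : IntegrableOn (fun y => excess γ z (lift π y) ^ 2) U := by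
    refine IntegrableOn.of_bound hUv.lt_top (hFc.aestronglyMeasurable hU.measurableSet)
      (C ^ 2) (ae_restrict_of_forall_mem hU.measurableSet fun y hy => ?_)
    have h1 := hz.excess_pos (hUΩ y hy)
    have h2 := (hz.excess_le (hUΩ y hy)).trans (hC _ (hUB y hy))
    rw [Real.norm_eq_abs, abs_of_nonneg (sq_nonneg _)]
    gcongr
  -- Radius and amplitude are needed on S only; elsewhere they take the dummy value zero.
  have hex : ∀ c, ∃ r θ : ℝ, c ∈ S → IsGoodBall γ π z c r θ ∧ r ≤ 1 ∧ Metric.closedBall c r ⊆ U ∧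
      (∀ y ∈ Metric.closedBall c r,
        z.ρ (lift π y).1 (lift π y).2 ≤ 2 * z.ρ (lift π c).1 (lift π c).2) ∧
      gainConst d C * ∫ y in Metric.closedBall c r, excess γ z (lift π y) ^ 2
        ≤ (2 * z.ρ (lift π c).1 (lift π c).2)⁻¹ *
          (θ ^ 2 / 8 * volume.real (Metric.closedBall c (r / 2))) := fun c => by
    by_cases hc : c ∈ S
    · obtain ⟨r, θ, h⟩ := exists_goodBall hπ hd hΩ hz hU hUΩ (hSU hc) (hC _ (hUB c (hSU hc)))
      exact ⟨r, θ, fun _ => h⟩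
    · exact ⟨0, 0, fun h => absurd h hc⟩
  choose r θ hrθ using hex
  obtain ⟨t, htS, hdisj, hlarge⟩ := exists_finset_disjoint_balls_large_integral hτ hN₀
    hU.measurableSet hS hSU hFi (fun y _ => sq_nonneg _) (fun c hc => (hrθ c hc).1.r_pos)
    (fun c hc => (hrθ c hc).2.1) (fun c hc => (hrθ c hc).2.2.1)
  have hballU : ∀ c ∈ t, Metric.closedBall c (r c) ⊆ U := fun c hc => (hrθ c (htS hc)).2.2.1
  obtain ⟨w', hw', z', hz', hN', hρ', -, hgain⟩ := exists_perturbations hπ hd hΩ hw hz (x₀ := x₀) t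
    (fun c hc => (hrθ c (htS hc)).1) hdisj (fun c hc => (hballU c hc).trans hUx)
    (fun c hc y hy => hUΩ y (hballU c hc hy)) N hN
  refine ⟨w', hw', z', hz', hN', hρ', ?_⟩
  have hgc := hz.continuousOn_momentumDist hz'
  have hglc : ContinuousOn (fun y => momentumDist z z' (lift π y)) U := hgc.comp hl hUΩ
  set V := ⋃ x ∈ t, Metric.closedBall x (r x) with hV
  have hVm : MeasurableSet V :=
    t.measurableSet_biUnion fun _ _ => Metric.isClosed_closedBall.measurableSet
  have hVU : V ⊆ U := iUnion₂_subset hballU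
  have hball : ∀ c ∈ t, gainConst d C * ∫ y in Metric.closedBall c (r c), excess γ z (lift π y) ^ 2
      ≤ ∫ y in Metric.closedBall c (r c), momentumDist z z' (lift π y) := fun c hc => by
    obtain ⟨-, -, h3, h4, h5⟩ := hrθ c (htS hc)
    have hρc : 0 < z.ρ (lift π c).1 (lift π c).2 :=
      hz.sub.density_pos _ (hUΩ c (hSU (htS hc))).1 _
    refine h5.trans ((mul_le_mul_of_nonneg_left (hgain c hc) (by positivity)).trans ?_)
    rw [← integral_const_mul]
    have hsub : Icc 0 T ×ˢ Ω ⊇ Ioo 0 T ×ˢ Ω := prod_mono Ioo_subset_Icc_self subset_rfl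
    have hmc : ContinuousOn (fun y => z'.m (lift π y).1 (lift π y).2 - z.m (lift π y).1 (lift π y).2)
        U := (hz'.cont_m.sub hz.cont_m).comp hl fun y hy => hsub (hUΩ y hy)
    have hK : IsCompact (Metric.closedBall c (r c)) := isCompact_closedBall _ _
    refine setIntegral_mono_on
      ((((hmc.mono h3).norm.pow 2).integrableOn_compact hK).const_mul _)
      ((hglc.mono h3).integrableOn_compact hK) hK.isClosed.measurableSet fun y hy => ?_
    have hρy : 0 < z.ρ (lift π y).1 (lift π y).2 := hz.sub.density_pos _ (hUΩ y (h3 hy)).1 _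
    rw [momentumDist, div_eq_inv_mul]
    have := h4 y hy
    gcongr
  have hsum : ∫ y in V, momentumDist z z' (lift π y)
      = ∑ c ∈ t, ∫ y in Metric.closedBall c (r c), momentumDist z z' (lift π y) :=
    integral_biUnion_finset t (fun _ _ => Metric.isClosed_closedBall.measurableSet) hdisj
      fun c hc => (hglc.mono (hballU c hc)).integrableOn_compact (isCompact_closedBall _ _)
  calc gainConst d C * (((N₀ : ℝ) + 1)⁻¹ * ∫ y in S, excess γ z (lift π y) ^ 2)
      ≤ gainConst d C * ∑ c ∈ t, ∫ y in Metric.closedBall c (r c), excess γ z (lift π y) ^ 2 :=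
        mul_le_mul_of_nonneg_left hlarge (gainConst_pos hd0 hC0).le
    _ = ∑ c ∈ t, gainConst d C * ∫ y in Metric.closedBall c (r c), excess γ z (lift π y) ^ 2 :=
        Finset.mul_sum _ _ _
    _ ≤ ∑ c ∈ t, ∫ y in Metric.closedBall c (r c), momentumDist z z' (lift π y) :=
        Finset.sum_le_sum hball
    _ = ∫ q in lift π '' V, momentumDist z z' q := by
        rw [← hsum, setIntegral_lift hπ hVm (hVU.trans hUx)]
    _ ≤ ∫ q in Icc a b ×ˢ D, momentumDist z z' q := by
        refine setIntegral_mono_set ((hgc.mono hB.subset).integrableOn_compact hB.isCompact)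
          (ae_restrict_of_forall_mem hB.measurableSet fun q hq =>
            hz.momentumDist_nonneg z' (hB.subset hq)) (Eventually.of_forall ?_)
        rintro _ ⟨y, hy, rfl⟩
        exact hUB y (hVU hy)

/-- Cauchy–Schwarz in the form f² ≥ 2cf - c² with c = ε/V, integrated over S. -/
lemma sq_div_le_integral_sq {α : Type*} [MeasurableSpace α] {μ : Measure α} {f : α → ℝ}
    {S : Set α} (hf : IntegrableOn f S μ) (hf2 : IntegrableOn (fun y => f y ^ 2) S μ)
    (hS : μ S ≠ ⊤) {ε V : ℝ} (hV0 : 0 < V) (hV : μ.real S ≤ V)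
    (hε : 0 ≤ ε) (h : ε ≤ ∫ y in S, f y ∂μ) : ε ^ 2 / V ≤ ∫ y in S, f y ^ 2 ∂μ := by
  have hc : IntegrableOn (fun _ => (ε / V) ^ 2) S μ := integrableOn_const hS
  have h1 : ∫ y in S, (2 * (ε / V) * f y - (ε / V) ^ 2) ∂μ ≤ ∫ y in S, f y ^ 2 ∂μ :=
    integral_mono ((hf.const_mul _).sub hc) hf2 fun y => by
      beta_reduce
      nlinarith [sq_nonneg (f y - ε / V)]
  rw [integral_sub (hf.const_mul _) hc, integral_const_mul, setIntegral_const, smul_eq_mul] at h1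
  refine le_trans ?_ h1
  have h2 : μ.real S * (ε / V) ^ 2 ≤ V * (ε / V) ^ 2 := by gcongr
  have h3 : 2 * (ε / V) * ε ≤ 2 * (ε / V) * ∫ y in S, f y ∂μ := by gcongr
  have h4 : 2 * (ε / V) * ε - V * (ε / V) ^ 2 = ε ^ 2 / V := by
    field_simp
    ring
  linarith

/-- A subsolution with positive integrated excess can be improved by a fixed amount, arbitrarily
close to it in the path space. -/
lemma exists_improvement (hπ : IsLocalModel π) (hd : 2 ≤ d) (hΩ : IsOpen Ω)
    (hQ : IsGeneralizedPressure T Ω z₀.Q) {a b a' b' : ℝ} {D D' : Set G}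
    (hB : IsBox T Ω a b D) (hB' : IsBox T Ω a' b' D')
    (hBB' : Icc a b ×ˢ D ⊆ interior (Icc a' b' ×ˢ D')) {ε : ℝ} (hε : 0 < ε) :
    ∃ β > 0, ∀ w ∈ (spaceX₀ π Ω z₀ mref : Set (PathSpace d γ T G)), ∀ z, IsWitness π Ω z₀ w z →
      ε ≤ ∫ q in Icc a b ×ˢ D, excess γ z q → ∀ N ∈ 𝓝 w, ∃ w' ∈ spaceX₀ π Ω z₀ mref,
        ∃ z', IsWitness π Ω z₀ w' z' ∧ w' ∈ N ∧ z'.ρ = z.ρ ∧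
          β ≤ ∫ q in Icc a' b' ×ˢ D', momentumDist z z' q := by
  classical
  have hd0 : 0 < d := by omega
  obtain ⟨C, hC0, hC⟩ := hB'.exists_bound hQ
  obtain ⟨N₀, τ, hτ, hN₀⟩ := HasBesicovitchCovering.no_satelliteConfig (α := ℝ × Vec d)
  have hex : ∀ q : ℝ × G, ∃ (y : ℝ × Vec d) (r : ℝ), q ∈ Icc a b ×ˢ D → lift π y = q ∧ 0 < r ∧
      Metric.ball y r ⊆ cyl y.2 ∩ lift π ⁻¹' interior (Icc a' b' ×ˢ D') := fun q => by
    obtain ⟨y, rfl⟩ := surjective_lift hπ q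
    by_cases hq : lift π y ∈ Icc a b ×ˢ D
    · have hopen : IsOpen (cyl y.2 ∩ lift π ⁻¹' interior (Icc a' b' ×ˢ D')) :=
        (isOpen_cyl y.2).inter (isOpen_interior.preimage (continuous_lift hπ))
      obtain ⟨r, hr, hsub⟩ := Metric.isOpen_iff.1 hopen y
        ⟨⟨mem_univ _, Metric.mem_ball_self (by norm_num)⟩, hBB' hq⟩
      exact ⟨y, r, fun _ => ⟨rfl, hr, hsub⟩⟩
    · exact ⟨y, 0, fun h => absurd h hq⟩
  choose y r hyr using hex
  have hopenU : ∀ q, IsOpen (lift π '' Metric.ball (y q) (r q)) := fun q =>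
    isOpenMap_lift hπ _ Metric.isOpen_ball
  obtain ⟨t, htB, hcov⟩ := hB.isCompact.elim_nhds_subcover
    (fun q => lift π '' Metric.ball (y q) (r q)) fun q hq => (hopenU q).mem_nhds
      ⟨y q, Metric.mem_ball_self (hyr q hq).2.1, (hyr q hq).1⟩
  -- If every chart of the finite cover carried less than ε₁ of the excess, the total would be at
  -- most ε - ε₁ < ε. The summand 1 makes this strict and avoids dividing by zero.
  set ε₁ := ε / (t.card + 1) with hε₁
  have hε₁0 : 0 < ε₁ := by positivity
  -- V bounds the volume of every chart. The cover, ε₁ and V are fixed before the subsolution is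
  -- chosen, so the gain β is uniform.
  set V : ℝ := ∑ q ∈ t, volume.real (Metric.ball (y q) (r q)) + 1 with hV
  have hV0 : 0 < V := by
    have : 0 ≤ ∑ q ∈ t, volume.real (Metric.ball (y q) (r q)) :=
      Finset.sum_nonneg fun _ _ => measureReal_nonneg
    linarith
  refine ⟨gainConst d C * (((N₀ : ℝ) + 1)⁻¹ * (ε₁ ^ 2 / V)),
    mul_pos (gainConst_pos hd0 hC0) (by positivity), fun w hw z hz hle N hN => ?_⟩
  have hFc := (hz.continuousOn_excess hd0).mono hB.subset
  have hFi : IntegrableOn (excess γ z) (Icc a b ×ˢ D) := hFc.integrableOn_compact hB.isCompact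
  have hUm : ∀ q, MeasurableSet (lift π '' Metric.ball (y q) (r q)) := fun q =>
    (hopenU q).measurableSet
  obtain ⟨q, hq, hqε⟩ : ∃ q ∈ t, ε₁ ≤ ∫ x in (Icc a b ×ˢ D) ∩ lift π '' Metric.ball (y q) (r q),
      excess γ z x := by
    by_contra! hcon
    have h1 : ∫ x in Icc a b ×ˢ D, excess γ z x
        ≤ ∑ q ∈ t, ∫ x in (Icc a b ×ˢ D) ∩ lift π '' Metric.ball (y q) (r q), excess γ z x := by
      have : ∀ q ∈ t, ∫ x in (Icc a b ×ˢ D) ∩ lift π '' Metric.ball (y q) (r q), excess γ z x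
          = ∫ x in Icc a b ×ˢ D, (lift π '' Metric.ball (y q) (r q)).indicator (excess γ z) x :=
        fun q _ => (setIntegral_indicator (hUm q)).symm
      rw [Finset.sum_congr rfl this, ← integral_finsetSum _ fun q _ => hFi.indicator (hUm q)]
      refine setIntegral_mono_on hFi (integrable_finsetSum _ fun q _ => hFi.indicator (hUm q))
        hB.measurableSet fun x hx => ?_
      obtain ⟨q, hq, hxq⟩ := mem_iUnion₂.1 (hcov hx)
      refine le_trans (le_of_eq (indicator_of_mem hxq (excess γ z)).symm)
        (Finset.single_le_sum (f := fun q => (lift π '' Metric.ball (y q) (r q)).indicator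
          (excess γ z) x) (fun q _ => ?_) hq)
      exact indicator_apply_nonneg fun _ => (hz.excess_pos (hB.subset hx)).le
    have h2 : ∑ q ∈ t, ∫ x in (Icc a b ×ˢ D) ∩ lift π '' Metric.ball (y q) (r q), excess γ z x
        ≤ t.card * ε₁ := by
      rw [← nsmul_eq_mul]
      exact Finset.sum_le_card_nsmul _ _ _ fun q hq => (hcon q hq).le
    have h3 : (t.card : ℝ) * ε₁ + ε₁ = ε := by
      rw [hε₁]
      field_simp
    linarith
  have hsub := (hyr q (htB q hq)).2.2
  set S := Metric.ball (y q) (r q) ∩ lift π ⁻¹' (Icc a b ×ˢ D) with hS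
  have hSm : MeasurableSet S := Metric.isOpen_ball.measurableSet.inter
    ((continuous_lift hπ).measurable hB.measurableSet)
  have hSx : S ⊆ cyl (y q).2 := fun x hx => (hsub hx.1).1
  have himg : (Icc a b ×ˢ D) ∩ lift π '' Metric.ball (y q) (r q) = lift π '' S := by
    rw [hS, image_inter_preimage, inter_comm]
  have hi : IntegrableOn (fun x => excess γ z (lift π x)) S ∧
      IntegrableOn (fun x => excess γ z (lift π x) ^ 2) S := by
    have hc : ContinuousOn (fun x => excess γ z (lift π x)) S :=
      hFc.comp (continuous_lift hπ).continuousOn fun x hx => hx.2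
    have hSv : volume S < ⊤ := (measure_mono inter_subset_left).trans_lt measure_ball_lt_top
    obtain ⟨M, hM⟩ := hB.isCompact.exists_bound_of_continuousOn hFc
    refine ⟨IntegrableOn.of_bound hSv (hc.aestronglyMeasurable hSm) M
      (ae_restrict_of_forall_mem hSm fun x hx => hM _ hx.2),
      IntegrableOn.of_bound hSv ((hc.pow 2).aestronglyMeasurable hSm) (M ^ 2)
      (ae_restrict_of_forall_mem hSm fun x hx => ?_)⟩
    rw [norm_pow]
    exact pow_le_pow_left₀ (norm_nonneg _) (hM _ hx.2) 2
  rw [himg, setIntegral_lift hπ hSm hSx] at hqε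
  obtain ⟨w', hw', z', hz', hN', hρ', hgain⟩ := exists_improvement_chart hπ hd hΩ hτ hN₀ hB' hC0 hC
    Metric.isOpen_ball (fun x hx => (hsub hx).1) measure_ball_lt_top.ne
    (fun x hx => interior_subset (hsub hx).2) hSm inter_subset_left hw hz N hN
  refine ⟨w', hw', z', hz', hN', hρ', le_trans ?_ hgain⟩
  have hSv : volume.real S ≤ V := by
    have h1 : volume.real S ≤ volume.real (Metric.ball (y q) (r q)) :=
      measureReal_mono inter_subset_left measure_ball_lt_top.ne
    have h2 : volume.real (Metric.ball (y q) (r q))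
        ≤ ∑ q ∈ t, volume.real (Metric.ball (y q) (r q)) :=
      Finset.single_le_sum (f := fun q => volume.real (Metric.ball (y q) (r q)))
        (fun _ _ => measureReal_nonneg) hq
    linarith
  have := sq_div_le_integral_sq hi.1 hi.2
    ((measure_mono inter_subset_left).trans_lt measure_ball_lt_top).ne hV0 hSv hε₁0.le hqε
  have := gainConst_pos hd0 hC0
  gcongr

end Improvement

/-! ### Density of small excess and the Baire category conclusion -/

section Residual

variable {d : ℕ} {γ T : ℝ} [hγ : Fact (1 < γ)] {G : Type} [AddCommGroup G] [TopologicalSpace G]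
  [MeasureSpace G] [BorelSpace G] [SecondCountableTopology G] [LocallyCompactSpace G] [T2Space G]
  [IsLocallyFiniteMeasure (volume : Measure G)] {π : Vec d →+ G} {Ω : Set G} {z₀ : Fields d G}
  {mref : ℝ → G → Vec d}

section Box

variable {a b a' b' : ℝ} {D D' : Set G}

lemma gap_self (hT : 0 < T) (hd : 0 < d) (hΩ : IsOpen Ω) (hQ : IsGeneralizedPressure T Ω z₀.Q)
    (hB : IsBox T Ω a b D) {w : PathSpace d γ T G} (hw : w ∈ spaceX₀ π Ω z₀ mref)
    {z : Fields d G} (hz : IsWitness π Ω z₀ w z) :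
    gap hT a b D z w = ∫ q in Icc a b ×ˢ D, excess γ z q := by
  rw [gap_eq hT hd hΩ hQ hB (subset_closure hw) hz hz.sub.represents]
  refine setIntegral_congr_fun hB.measurableSet fun q hq => ?_
  rw [gapFun, tangent_self (hz.sub.density_pos _ (hB.time hq.1) _), excess]

/-- At fixed density f is a quadratic function of m, so its remainder over the tangent plane is
exactly |m' - m|²/(dρ). Since the left side is nearly unaffected by a weakly small oscillation, an
oscillation of definite size must lower the excess. -/
lemma gap_eq_of_density_eq (hT : 0 < T) (hd : 0 < d) (hΩ : IsOpen Ω)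
    (hQ : IsGeneralizedPressure T Ω z₀.Q) (hB : IsBox T Ω a b D) {w w' : PathSpace d γ T G}
    (hw' : w' ∈ spaceX₀ π Ω z₀ mref) {z z' : Fields d G} (hz : IsWitness π Ω z₀ w z)
    (hz' : IsWitness π Ω z₀ w' z') (hρ : z'.ρ = z.ρ) :
    gap hT a b D z w' = (∫ q in Icc a b ×ˢ D, excess γ z' q)
      + (d : ℝ)⁻¹ * ∫ q in Icc a b ×ˢ D, momentumDist z z' q := by
  rw [gap_eq hT hd hΩ hQ hB (subset_closure hw') hz hz'.sub.represents, ← integral_const_mul,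
    ← integral_add
      (((hz'.continuousOn_excess hd).mono hB.subset).integrableOn_compact hB.isCompact)
      ((((hz.continuousOn_momentumDist hz').mono hB.subset).integrableOn_compact
        hB.isCompact).const_mul _)]
  refine setIntegral_congr_fun hB.measurableSet fun q hq => ?_
  have h1 := hz.sub.density_pos _ (hB.time hq.1) q.2
  rw [gapFun, excess, momentumDist, hρ, hz'.Q_eq, hz.Q_eq,
    energy_eq_tangent_add h1 (z.m q.1 q.2) (z'.m q.1 q.2)]
  field_simp
  ring

/-- Subsolutions with small integrated excess are dense. -/
lemma exists_excess_lt (hπ : IsLocalModel π) (hT : 0 < T) (hd : 2 ≤ d) (hΩ : IsOpen Ω)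
    (hQ : IsGeneralizedPressure T Ω z₀.Q) (hB : IsBox T Ω a b D) (hB' : IsBox T Ω a' b' D')
    (hBB' : Icc a b ×ˢ D ⊆ interior (Icc a' b' ×ˢ D')) {ε : ℝ} (hε : 0 < ε)
    {w : PathSpace d γ T G} (hw : w ∈ spaceX₀ π Ω z₀ mref) :
    ∀ N ∈ 𝓝 w, ∃ w' ∈ spaceX₀ π Ω z₀ mref, ∃ z', IsWitness π Ω z₀ w' z' ∧ w' ∈ N ∧
      ∫ q in Icc a b ×ˢ D, excess γ z' q < ε := by
  have hd0 : 0 < d := by omega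
  have hd' : (0 : ℝ) < d := by exact_mod_cast hd0
  obtain ⟨β, hβ, himp⟩ := exists_improvement (γ := γ) (z₀ := z₀) (mref := mref) hπ hd hΩ hQ hB hB'
    hBB' hε
  -- The induction counts how many decrements β/(2d) fit into the excess on the larger box. Each
  -- round is triggered by excess at least ε on the smaller box, and the excess on the larger box
  -- cannot become negative.
  have key : ∀ (k : ℕ) (w : PathSpace d γ T G), w ∈ spaceX₀ π Ω z₀ mref → ∀ z,
      IsWitness π Ω z₀ w z → ∫ q in Icc a' b' ×ˢ D', excess γ z q ≤ k * (β / (2 * d)) →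
      ∀ N ∈ 𝓝 w, ∃ w' ∈ spaceX₀ π Ω z₀ mref, ∃ z', IsWitness π Ω z₀ w' z' ∧ w' ∈ N ∧
        ∫ q in Icc a b ×ˢ D, excess γ z' q < ε := by
    intro k
    induction k with
    | zero =>
      intro w hw z hz hle N hN
      refine ⟨w, hw, z, hz, mem_of_mem_nhds hN, lt_of_le_of_lt ?_ hε⟩
      refine le_trans (setIntegral_mono_set
        (((hz.continuousOn_excess hd0).mono hB'.subset).integrableOn_compact hB'.isCompact)
        (ae_restrict_of_forall_mem hB'.measurableSet fun q hq =>
          (hz.excess_pos (hB'.subset hq)).le)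
        (Eventually.of_forall (hBB'.trans interior_subset))) ?_
      simpa using hle
    | succ k ih =>
      intro w hw z hz hle N hN
      by_cases hsmall : ∫ q in Icc a b ×ˢ D, excess γ z q < ε
      · exact ⟨w, hw, z, hz, mem_of_mem_nhds hN, hsmall⟩
      have hδ : 0 < β / (2 * d) := by positivity
      -- Close to w the gap relative to z rises by less than β/(2d), while the new momentum accounts
      -- for at least β/d of it; so the excess falls by at least β/(2d).
      have hcont := continuousOn_gap hT hd0 hΩ hQ hB' hz w (subset_closure hw : w ∈
        (spaceX π Ω z₀ mref : Set (PathSpace d γ T G)))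
      have hev := eventually_nhdsWithin_iff.1 ((tendsto_order.1 hcont).2
        (gap hT a' b' D' z w + β / (2 * d)) (by linarith))
      obtain ⟨w₁, hw₁, z₁, hz₁, hN₁, hρ₁, hgain⟩ := himp w hw z hz (not_lt.1 hsmall)
        (interior N ∩ {w' | w' ∈ spaceX π Ω z₀ mref →
          gap hT a' b' D' z w' < gap hT a' b' D' z w + β / (2 * d)})
        (inter_mem (interior_mem_nhds.2 hN) hev)
      have h1 := hN₁.2 (subset_closure hw₁)
      rw [gap_self hT hd0 hΩ hQ hB' hw hz,
        gap_eq_of_density_eq hT hd0 hΩ hQ hB' hw₁ hz hz₁ hρ₁] at h1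
      have h2 : (d : ℝ)⁻¹ * β
          ≤ (d : ℝ)⁻¹ * ∫ q in Icc a' b' ×ˢ D', momentumDist z z₁ q := by gcongr
      have h3 : (d : ℝ)⁻¹ * β = β / (2 * d) + β / (2 * d) := by
        field_simp
        ring
      push_cast at hle
      obtain ⟨w₂, hw₂, z₂, hz₂, hN₂, hlt⟩ := ih w₁ hw₁ z₁ hz₁ (by linarith) (interior N)
        (isOpen_interior.mem_nhds hN₁.1)
      exact ⟨w₂, hw₂, z₂, hz₂, interior_subset hN₂, hlt⟩
  obtain ⟨-, -, z, hz⟩ := mem_spaceX₀.1 hw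
  obtain ⟨k, hk⟩ := exists_nat_ge ((∫ q in Icc a' b' ×ˢ D', excess γ z q) / (β / (2 * d)))
  exact key k w hw z hz ((div_le_iff₀ (by positivity)).1 hk)

end Box

/-- An exhaustion of `(0, T) × Ω` by compact boxes. -/
lemma exists_box_exhaustion (hT : 0 < T) (hΩ : IsOpen Ω) :
    ∃ (a b : ℕ → ℝ) (D : ℕ → Set G), (∀ n, IsBox T Ω (a n) (b n) (D n)) ∧
      (∀ n, Icc (a n) (b n) ×ˢ D n ⊆ interior (Icc (a (n + 1)) (b (n + 1)) ×ˢ D (n + 1))) ∧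
      ∀ q ∈ Ioo 0 T ×ˢ Ω, ∀ᶠ n in atTop, q ∈ Icc (a n) (b n) ×ˢ D n := by
  have : LocallyCompactSpace Ω := hΩ.locallyCompactSpace
  let K : CompactExhaustion Ω := CompactExhaustion.choice Ω
  have hlt : ∀ n : ℕ, T / ((n + 1 : ℕ) + 3) < T / (n + 3) := fun n => by
    push_cast
    gcongr
    linarith
  have hhalf : ∀ n : ℕ, T / (n + 3) < T / 2 := fun n => by
    gcongr
    linarith [n.cast_nonneg (α := ℝ)]
  have hpos : ∀ n : ℕ, 0 < T / ((n : ℝ) + 3) := fun n => by positivity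
  have hlim : Tendsto (fun n : ℕ => T / ((n : ℝ) + 3)) atTop (𝓝 0) :=
    tendsto_const_nhds.div_atTop (tendsto_atTop_add_const_right _ _ tendsto_natCast_atTop_atTop)
  -- A denominator above two makes the time intervals nonempty, and its strict growth places each
  -- interval in the interior of the next.
  refine ⟨fun n => T / (n + 3), fun n => T - T / (n + 3), fun n => Subtype.val '' K n,
    fun n => ⟨by linarith [hhalf n], fun t ht => ?_, (K.isCompact n).image continuous_subtype_val,
      Subtype.coe_image_subset _ _⟩, fun n => ?_, fun q hq => ?_⟩
  · exact ⟨(hpos n).trans_le ht.1, ht.2.trans_lt (by linarith [hpos n])⟩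
  · rw [interior_prod_eq, interior_Icc]
    refine prod_mono (fun t ht => ⟨(hlt n).trans_le ht.1, ht.2.trans_lt (by linarith [hlt n])⟩) ?_
    exact (image_mono (K.subset_interior_succ n)).trans
      (hΩ.isOpenMap_subtype_val.image_interior_subset _)
  · obtain ⟨N, hN⟩ := K.exists_mem ⟨q.2, hq.2⟩
    filter_upwards [(tendsto_order.1 hlim).2 q.1 hq.1.1,
      (tendsto_order.1 hlim).2 (T - q.1) (by linarith [hq.1.2]), eventually_ge_atTop N]
      with n h1 h2 h3
    exact ⟨⟨h1.le, by linarith⟩, ⟨q.2, hq.2⟩, K.subset h3 hN, rfl⟩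

/-- Exact solutions are residual in the closure of the strict subsolutions. -/
theorem isExactSolution_mem_residual (hπ : IsLocalModel π) (hT : 0 < T) (hd : 2 ≤ d)
    (hΩ : IsOpen Ω) (hQ : IsGeneralizedPressure T Ω z₀.Q)
    (hz₀ : IsStrictSubsolution π γ T Ω z₀) :
    {w : (spaceX π Ω z₀ mref : Set (PathSpace d γ T G)) | IsExactSolution π Ω z₀ w.1}
      ∈ residual (spaceX π Ω z₀ mref : Set (PathSpace d γ T G)) := by
  have hd0 : 0 < d := by omega
  obtain ⟨a, b, D, hB, hBB, hcov⟩ := exists_box_exhaustion (Ω := Ω) hT hΩ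
  -- The reference subsolution is arbitrary and may lie far from w. For a fixed one the condition is
  -- open, so O n is a union of open sets.
  let O : ℕ → Set (spaceX π Ω z₀ mref : Set (PathSpace d γ T G)) := fun n =>
    {w | ∃ w' ∈ (spaceX₀ π Ω z₀ mref : Set (PathSpace d γ T G)), ∃ z, IsWitness π Ω z₀ w' z ∧
      gap hT (a n) (b n) (D n) z w.1 < (1 / 2) ^ n}
  have hO : ∀ n, O n ∈ residual (spaceX π Ω z₀ mref : Set (PathSpace d γ T G)) := fun n => by
    refine residual_of_dense_open (isOpen_iff_mem_nhds.2 ?_) fun x => mem_closure_iff.2 ?_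
    · rintro w ⟨w', hw', z, hz, hlt⟩
      have hc := continuousOn_iff_continuous_domRestrict.1
        (continuousOn_gap (mref := mref) hT hd0 hΩ hQ (hB n) hz)
      filter_upwards [(hc.tendsto w).eventually_lt_const hlt] with v hv
      exact ⟨w', hw', z, hz, hv⟩
    -- Density: approximate by an element of X₀, then by one of small excess; the latter serves as
    -- its own reference, where gap and integrated excess coincide.
    · rintro _ ⟨N, hN, rfl⟩ hx
      obtain ⟨w, hwN, hw⟩ := mem_closure_iff.1 x.2 N hN hx
      obtain ⟨w', hw', z, hz, hN', hlt⟩ := exists_excess_lt hπ hT hd hΩ hQ (hB n) (hB (n + 1))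
        (hBB n) (pow_pos one_half_pos n) hw N (hN.mem_nhds hwN)
      rw [← gap_self hT hd0 hΩ hQ (hB n) hw' hz] at hlt
      exact ⟨⟨w', subset_closure hw'⟩, hN', w', hw', z, hz, hlt⟩
  refine mem_of_superset (countable_iInter_mem.2 hO) fun w hw => ?_
  choose w' hw' z hz hlt using mem_iInter.1 hw
  exact isExactSolution_of_seq hπ hT hd0 hΩ hQ hz₀ w.2 hB hcov hz hlt

end Residual

end IsentropicEuler

end

open IsentropicEuler in
theorem mainTheorem1 (d : ℕ) (hd : 2 ≤ d) (γ : ℝ) [Fact (1 < γ)] (T : ℝ) (hT : 0 < T) :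
    -- the whole space
    (∀ (Ω : Set (Vec d)) (z₀ : Fields d (Vec d)), IsOpen Ω →
      IsGeneralizedPressure T Ω z₀.Q →
      IsStrictSubsolution (AddMonoidHom.id (Vec d)) γ T Ω z₀ →
      ∀ mref : ℝ → Vec d → Vec d, mref = 0 ∨ mref = z₀.m →
        {w : (spaceX (AddMonoidHom.id (Vec d)) Ω z₀ mref : Set (PathSpace d γ T (Vec d))) |
          IsExactSolution (AddMonoidHom.id (Vec d)) Ω z₀ w.1} ∈ residual _) ∧
    -- the flat torus
    (∀ (Ω : Set (UnitAddTorus (Fin d))) (z₀ : Fields d (UnitAddTorus (Fin d))), IsOpen Ω →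
      IsGeneralizedPressure T Ω z₀.Q →
      IsStrictSubsolution (torusMap d) γ T Ω z₀ →
      ∀ mref : ℝ → UnitAddTorus (Fin d) → Vec d, mref = 0 ∨ mref = z₀.m →
        {w : (spaceX (torusMap d) Ω z₀ mref :
            Set (PathSpace d γ T (UnitAddTorus (Fin d)))) |
          IsExactSolution (torusMap d) Ω z₀ w.1} ∈ residual _) := by
  exact ⟨fun Ω z₀ hΩ hQ hz₀ mref _ =>
      isExactSolution_mem_residual (isLocalModel_id d) hT hd hΩ hQ hz₀,
    fun Ω z₀ hΩ hQ hz₀ mref _ =>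
      isExactSolution_mem_residual (isLocalModel_torus d) hT hd hΩ hQ hz₀⟩
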